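/- **Setting.** Let $\mathcal S_1,\mathcal S_2,\mathcal A,\mathcal B$ be finite non-empty sets, $\mathcal S=\mathcal S_1\times\mathcal S_2$, and $H,K\ge 1$ integers. Consider an $H$-step two-player zero-sum Markov game with a fixed initial state $s_1=(s_1^1,s_1^2)\in\mathcal S$, mean rewards $r_h:\mathcal S\times\mathcal A\times\mathcal B\to[0,1]$ and factored independent transitions $\mathcal P_h(s'|s,a,b)=\mathcal P_h^1(s^{1\prime}|s^1,a)\,\mathcal P_h^2(s^{2\prime}|s^2,b)$. Policies have the form $\mu_h(a|s^1)$ for Player 1 and $\nu_h(b|s^2)$ for Player 2. $V_h^{\mu,\nu}(s)$ is the expected sum of the mean rewards $r_{h'}(s_{h'},a_{h'},b_{h'})$ over $h'=h,\dots,H$, started from $s_h=s$. The game is played for $K$ episodes with policies $\mu^k,\nu^k$. The sequence $\mu^1,\dots,\mu^K$ is arbitrary and may be adversarial: $\mu^k$ may depend on everything that happened before episode $k$ and on private randomness. In episode $k$ the players draw their actions independently from $\mu^k,\nu^k$, the states follow $\mathcal P$, and only the trajectory $(s_h^k,a_h^k,b_h^k,s_{h+1}^k)_{h\le H}$ and rewards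 $r_h^k\in[0,1]$ along it are observed, where $r_h^k$ has conditional mean $r_h(s_h^k,a_h^k,b_h^k)$ given the past and $(s_h^k,a_h^k,b_h^k)$. **Algorithm of Player 2.** Fix $\delta\in(0,1)$ and $\gamma=\sqrt{\log|\mathcal B|/(KH^2)}$. For $k\ge1$ let $N_h^k(s,a,b),N_h^k(s^1,a),N_h^k(s^2,b)$ be the visit counts at step $h$ in the episodes $1,\dots,k$, and $$\hat r_h^k(s,a,b)=\frac{\sum_{\tau=1}^k\mathbf 1\{(s_h^\tau,a_h^\tau,b_h^\tau)=(s,a,b)\}\,r_h^\tau}{\max\{N_h^k(s,a,b),1\}},$$ $$\hat{\mathcal P}_h^{1,k}(s^{1\prime}|s^1,a)=\frac{\#\{\tau\le k:(s_h^{1,\tau},a_h^\tau,s_{h+1}^{1,\tau})=(s^1,a,s^{1\prime})\}}{\max\{N_h^k(s^1,a),1\}},$$ similarly $\hat{\mathcal P}_h^{2,k}(s^{2\prime}|s^2,b)$, $\hat{\mathcal P}_h^k=\hat{\mathcal P}_h^{1,k}\hat{\mathcal P}_h^{2,k}$, and $$\beta_h^k(s,a,b)=\sqrt{\tfrac{4\log(|\mathcal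 S_1||\mathcal S_2||\mathcal A||\mathcal B|HK/\delta)}{\max\{N_h^k(s,a,b),1\}}}+\sqrt{\tfrac{2H^2|\mathcal S_1|\log(2|\mathcal S_1||\mathcal A|HK/\delta)}{\max\{N_h^k(s^1,a),1\}}}+\sqrt{\tfrac{2H^2|\mathcal S_2|\log(2|\mathcal S_2||\mathcal B|HK/\delta)}{\max\{N_h^k(s^2,b),1\}}}.$$ For $k=0$: $\hat r^0=\beta^0=0$, $\hat{\mathcal P}^{1,0},\hat{\mathcal P}^{2,0}$ and $\nu^0$ are uniform, and $\mu^0$ is any policy. For $k=0,\dots,K-1$, Player 2 sets $\underline V_{H+1}^k=0$ and computes for $h=H,\dots,1$ $$\underline Q_h^k(s,a,b)=\max\Big\{\min\big\{\hat r_h^k(s,a,b)+\textstyle\sum_{s'}\hat{\mathcal P}_h^k(s'|s,a,b)\underline V_{h+1}^k(s')-\beta_h^k(s,a,b),\,H-h+1\big\},0\Big\},$$ $$\underline V_h^k(s)=\sum_{a,b}\mu_h^k(a|s^1)\,\underline Q_h^k(s,a,b)\,\nu_h^k(b|s^2),$$ the empirical reaching probabilities $d_1^k(s^1)=\mathbf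 1\{s^1=s_1^1\}$, $d_{h+1}^k(s^1)=\sum_{\tilde s^1,a}d_h^k(\tilde s^1)\mu_h^k(a|\tilde s^1)\hat{\mathcal P}_h^{1,k}(s^1|\tilde s^1,a)$, and then, for every $s^2$, lets $\nu^{k+1}(\cdot|s^2)$ be the minimizer over policies $\nu$ of $$\sum_{h=1}^H\Big[\sum_b\big(\nu_h(b|s^2)-\nu_h^k(b|s^2)\big)\sum_{s^1}d_h^k(s^1)\sum_a\mu_h^k(a|s^1)\underline Q_h^k(s^1,s^2,a,b)+\gamma^{-1}D_{\mathrm{KL}}\big(\nu_h(\cdot|s^2),\nu_h^k(\cdot|s^2)\big)\Big].$$ (If $|\mathcal B|=1$, so that $\gamma=0$, there is only one policy.) **Theorem.** There are universal constants $c>0$ and $p\in\mathbb N$ such that in this setting, for all $\delta\in(0,1)$ and every Player 1 sequence, with probability at least $1-4\delta$, $$\mathrm{Regret}_2(K):=\sum_{k=1}^KV_1^{\mu^k,\nu^k}(s_1)-\min_{\nu}\sum_{k=1}^KV_1^{\mu^k,\nu}(s_1)\;\le\;c\,\Big(\log\frac{|\mathcal S_1||\mathcal S_2||\mathcal A||\mathcal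 B|HK}{\delta}\Big)^{p}\,C\sqrt T,$$ where $T=KH$ and $C=\sqrt{(|\mathcal S_1|^2|\mathcal A|+|\mathcal S_2|^2|\mathcal B|)H^3}+\sqrt{|\mathcal S_1||\mathcal S_2||\mathcal A||\mathcal B|H}$. -/

import Mathlib

open MeasureTheory ProbabilityTheory

namespace FactoredGame

noncomputable section

/-! Steps of an episode are indexed by `0, …, H - 1` (so that the terminal state has index `H`),
episodes by `1, …, K`; the index `0` for an episode refers to the initialization. -/

/-- A Markov policy: at every step `h`, a probability distribution over the actions `A` for every
state of the player's own component of the state space. -/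
structure Policy (S A : Type*) [Fintype A] where
  prob : ℕ → S → A → ℝ
  nonneg : ∀ h s a, 0 ≤ prob h s a
  sum_eq_one : ∀ h s, ∑ a, prob h s a = 1

/-- A step-dependent transition model: `prob h s a s'` is the probability to go from `s` to `s'`
at step `h` under action `a`. -/
structure Transition (S A : Type*) [Fintype S] where
  prob : ℕ → S → A → S → ℝ
  nonneg : ∀ h s a s', 0 ≤ prob h s a s'
  sum_eq_one : ∀ h s a, ∑ s', prob h s a s' = 1

/-- A tabular episodic two-player zero-sum Markov game with factored independent transition, a
fixed initial state and mean rewards in `[0, 1]`. -/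
structure Game (S₁ S₂ A B : Type*) [Fintype S₁] [Fintype S₂] where
  P₁ : Transition S₁ A
  P₂ : Transition S₂ B
  r : ℕ → S₁ × S₂ → A → B → ℝ
  r_nonneg : ∀ h s a b, 0 ≤ r h s a b
  r_le_one : ∀ h s a b, r h s a b ≤ 1
  init : S₁ × S₂

/-- The trajectories and rewards observed in the episodes: `state k h`, `act₁ k h`, `act₂ k h`,
`rew k h` are the state, the two actions and the (bandit) reward at step `h` of episode `k`. -/
structure PlayLog (S₁ S₂ A B : Type*) where
  state : ℕ → ℕ → S₁ × S₂
  act₁ : ℕ → ℕ → A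
  act₂ : ℕ → ℕ → B
  rew : ℕ → ℕ → ℝ

section Value

variable {S₁ S₂ A B : Type*} [Fintype S₁] [Fintype S₂] [Fintype A] [Fintype B]

/-- The joint transition probability `P_h(s' | s, a, b)`. -/
def Game.trans (G : Game S₁ S₂ A B) (h : ℕ) (s : S₁ × S₂) (a : A) (b : B) (s' : S₁ × S₂) : ℝ :=
  G.P₁.prob h s.1 a s'.1 * G.P₂.prob h s.2 b s'.2

open scoped Classical in
/-- The probability of the `n`-step trajectory with states `σ 0, …, σ n` and action pairs
`α 0, …, α (n - 1)` when the players start in state `s` at step `h` and follow `μ` and `ν`. -/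
def Game.pathProb (G : Game S₁ S₂ A B) (μ : Policy S₁ A) (ν : Policy S₂ B) {n : ℕ} (h : ℕ)
    (s : S₁ × S₂) (σ : Fin (n + 1) → S₁ × S₂) (α : Fin n → A × B) : ℝ :=
  (if σ 0 = s then 1 else 0) *
    ∏ i : Fin n, (μ.prob (h + i) (σ i.castSucc).1 (α i).1 *
      ν.prob (h + i) (σ i.castSucc).2 (α i).2 *
      G.trans (h + i) (σ i.castSucc) (α i).1 (α i).2 (σ i.succ))

/-- The expected total reward of `n` steps, started in state `s` at step `h`. -/
def Game.expReward (G : Game S₁ S₂ A B) (μ : Policy S₁ A) (ν : Policy S₂ B) (n h : ℕ)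
    (s : S₁ × S₂) : ℝ :=
  ∑ σ : Fin (n + 1) → S₁ × S₂, ∑ α : Fin n → A × B, G.pathProb μ ν h s σ α *
    ∑ i : Fin n, G.r (h + i) (σ i.castSucc) (α i).1 (α i).2

/-- The value function `V_h^{μ,ν}(s)` in the game of horizon `H`. -/
def Game.value (G : Game S₁ S₂ A B) (H : ℕ) (μ : Policy S₁ A) (ν : Policy S₂ B) (h : ℕ)
    (s : S₁ × S₂) : ℝ :=
  G.expReward μ ν (H - h) h s

open scoped Classical in
theorem Game.pathProb_cons (G : Game S₁ S₂ A B) (μ : Policy S₁ A) (ν : Policy S₂ B) {n : ℕ}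
    (h : ℕ) (s x : S₁ × S₂) (σ : Fin (n + 1) → S₁ × S₂) (y : A × B) (α : Fin n → A × B) :
    G.pathProb μ ν h s (Fin.cons x σ : Fin (n + 2) → S₁ × S₂) (Fin.cons y α : Fin (n + 1) → A × B) =
      (if x = s then 1 else 0) * (μ.prob h x.1 y.1 * ν.prob h x.2 y.2 *
        G.trans h x y.1 y.2 (σ 0)) * G.pathProb μ ν (h + 1) (σ 0) σ α := by
  have e : ∀ i : Fin n, h + ((i : ℕ) + 1) = h + 1 + i := fun i => by omega
  simp [Game.pathProb, Fin.prod_univ_succ, e, mul_assoc]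

theorem sum_fin_cons {n : ℕ} {X : Type*} [Fintype X] (f : (Fin (n + 1) → X) → ℝ) :
    ∑ v, f v = ∑ x, ∑ w : Fin n → X, f (Fin.cons x w) := by
  rw [← Fintype.sum_prod_type']
  exact (Fintype.sum_equiv (Fin.consEquiv fun _ => X) _ _ (fun _ => rfl)).symm

set_option linter.unusedSectionVars false in
theorem Game.sum_trans (G : Game S₁ S₂ A B) (h : ℕ) (s : S₁ × S₂) (a : A) (b : B) :
    ∑ s', G.trans h s a b s' = 1 := by
  simp only [Game.trans, Fintype.sum_prod_type, ← Finset.mul_sum, G.P₂.sum_eq_one, mul_one,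
    G.P₁.sum_eq_one]

/-- Splitting off the first step of a trajectory. -/
theorem Game.sum_pathProb_mul (G : Game S₁ S₂ A B) (μ : Policy S₁ A) (ν : Policy S₂ B) {n : ℕ}
    (h : ℕ) (s : S₁ × S₂)
    (f : (Fin (n + 2) → S₁ × S₂) → (Fin (n + 1) → A × B) → ℝ) :
    ∑ σ, ∑ α, G.pathProb μ ν h s σ α * f σ α =
      ∑ a, ∑ b, μ.prob h s.1 a * ν.prob h s.2 b * ∑ s', G.trans h s a b s' *
        ∑ σ : Fin (n + 1) → S₁ × S₂, ∑ α : Fin n → A × B,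
          G.pathProb μ ν (h + 1) s' σ α * f (Fin.cons s σ) (Fin.cons (a, b) α) := by
  classical
  have key : ∀ (y : A × B) (σ : Fin (n + 1) → S₁ × S₂) (α : Fin n → A × B),
      ∑ s', G.trans h s y.1 y.2 s' * (G.pathProb μ ν (h + 1) s' σ α *
        f (Fin.cons s σ) (Fin.cons y α)) =
      G.trans h s y.1 y.2 (σ 0) * (G.pathProb μ ν (h + 1) (σ 0) σ α *
        f (Fin.cons s σ) (Fin.cons y α)) := by
    intro y σ α
    refine Finset.sum_eq_single (σ 0) (fun b _ hb => ?_) (by simp)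
    simp [Game.pathProb, hb.symm]
  rw [sum_fin_cons, Finset.sum_eq_single s]
  · simp only [sum_fin_cons (X := A × B), Game.pathProb_cons]
    rw [Finset.sum_comm, ← Fintype.sum_prod_type' (f := fun (a : A) (b : B) => μ.prob h s.1 a *
      ν.prob h s.2 b * ∑ s', G.trans h s a b s' *
        ∑ σ : Fin (n + 1) → S₁ × S₂, ∑ α : Fin n → A × B,
          G.pathProb μ ν (h + 1) s' σ α * f (Fin.cons s σ) (Fin.cons (a, b) α))]
    refine Finset.sum_congr rfl fun y _ => ?_
    simp only [Finset.mul_sum]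
    conv_rhs => rw [Finset.sum_comm]
    refine Finset.sum_congr rfl fun σ _ => ?_
    conv_rhs => rw [Finset.sum_comm]
    refine Finset.sum_congr rfl fun α _ => ?_
    rw [← Finset.mul_sum, key]
    simp
    ring
  · intro x _ hx
    simp [sum_fin_cons (X := A × B), Game.pathProb_cons, hx]
  · simp

theorem Game.sum_pathProb (G : Game S₁ S₂ A B) (μ : Policy S₁ A) (ν : Policy S₂ B) (n h : ℕ)
    (s : S₁ × S₂) :
    ∑ σ : Fin (n + 1) → S₁ × S₂, ∑ α : Fin n → A × B, G.pathProb μ ν h s σ α = 1 := by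
  classical
  induction n generalizing h s with
  | zero =>
    rw [sum_fin_cons, Finset.sum_eq_single s]
    · simp [Game.pathProb]
    · intro x _ hx
      simp [Game.pathProb, hx]
    · simp
  | succ n ih =>
    have := G.sum_pathProb_mul μ ν h s (n := n) (fun _ _ => 1)
    simp only [mul_one] at this
    rw [this]
    simp only [ih, mul_one, G.sum_trans]
    simp only [← Finset.mul_sum, ν.sum_eq_one, mul_one, μ.sum_eq_one]

/-- The Bellman equation: the value function satisfies
`V_h(s) = ⟨μ_h(· | s), (r_h + P_h V_{h+1})(s, ·, ·) ν_h(· | s)⟩`. -/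
theorem Game.value_eq (G : Game S₁ S₂ A B) {H h : ℕ} (hh : h < H) (μ : Policy S₁ A)
    (ν : Policy S₂ B) (s : S₁ × S₂) :
    G.value H μ ν h s = ∑ a, ∑ b, μ.prob h s.1 a * ν.prob h s.2 b *
      (G.r h s a b + ∑ s', G.trans h s a b s' * G.value H μ ν (h + 1) s') := by
  obtain ⟨n, hn⟩ : ∃ n, H - h = n + 1 := ⟨H - h - 1, by omega⟩
  have hn' : H - (h + 1) = n := by omega
  have e : ∀ i : Fin n, h + ((i : ℕ) + 1) = h + 1 + i := fun i => by omega
  simp only [Game.value, hn, hn']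
  rw [Game.expReward, Game.sum_pathProb_mul]
  refine Finset.sum_congr rfl fun a _ => Finset.sum_congr rfl fun b _ => ?_
  congr 1
  have : ∀ s', ∑ σ : Fin (n + 1) → S₁ × S₂, ∑ α : Fin n → A × B,
      G.pathProb μ ν (h + 1) s' σ α *
        ∑ i : Fin (n + 1), G.r (h + i) ((Fin.cons s σ : Fin (n + 2) → S₁ × S₂) i.castSucc)
          ((Fin.cons (a, b) α : Fin (n + 1) → A × B) i).1
          ((Fin.cons (a, b) α : Fin (n + 1) → A × B) i).2 =
      G.r h s a b + G.expReward μ ν n (h + 1) s' := by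
    intro s'
    simp only [Fin.sum_univ_succ, mul_add, Finset.sum_add_distrib, Game.expReward,
      Fin.castSucc_zero, Fin.cons_zero, ← Finset.sum_mul, G.sum_pathProb, Fin.val_zero,
      Fin.val_succ, Fin.cons_succ, ← Fin.succ_castSucc, e, add_zero, one_mul]
  simp only [this, mul_add, Finset.sum_add_distrib, ← Finset.sum_mul, G.sum_trans, one_mul]

theorem Game.value_self (G : Game S₁ S₂ A B) (H : ℕ) (μ : Policy S₁ A) (ν : Policy S₂ B)
    (s : S₁ × S₂) : G.value H μ ν H s = 0 := by
  rw [Game.value, Nat.sub_self]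
  simp [Game.expReward]

/-- The regret of Player 2 over the episodes `1, …, K` for the policies `μ k`, `ν k`: the
accumulated value minus the accumulated value of the best fixed policy of Player 2 in hindsight. -/
def Game.regret₂ (G : Game S₁ S₂ A B) (H K : ℕ) (μ : ℕ → Policy S₁ A) (ν : ℕ → Policy S₂ B) : ℝ :=
  ∑ k ∈ Finset.Icc 1 K, G.value H (μ k) (ν k) 0 G.init -
    ⨅ ν' : Policy S₂ B, ∑ k ∈ Finset.Icc 1 K, G.value H (μ k) ν' 0 G.init

end Value

section Estimates

variable {S₁ S₂ A B : Type*}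

open scoped Classical in
/-- `N_h^k(s, a, b)`. -/
def PlayLog.count (D : PlayLog S₁ S₂ A B) (k h : ℕ) (s : S₁ × S₂) (a : A) (b : B) : ℕ :=
  {t ∈ Finset.Icc 1 k | D.state t h = s ∧ D.act₁ t h = a ∧ D.act₂ t h = b}.card

open scoped Classical in
/-- `N_h^k(s¹, a)`. -/
def PlayLog.count₁ (D : PlayLog S₁ S₂ A B) (k h : ℕ) (s : S₁) (a : A) : ℕ :=
  {t ∈ Finset.Icc 1 k | (D.state t h).1 = s ∧ D.act₁ t h = a}.card

open scoped Classical in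
/-- `N_h^k(s², b)`. -/
def PlayLog.count₂ (D : PlayLog S₁ S₂ A B) (k h : ℕ) (s : S₂) (b : B) : ℕ :=
  {t ∈ Finset.Icc 1 k | (D.state t h).2 = s ∧ D.act₂ t h = b}.card

open scoped Classical in
/-- The empirical reward after `k` episodes (it is `0` for `k = 0`). -/
def PlayLog.rHat (D : PlayLog S₁ S₂ A B) (k h : ℕ) (s : S₁ × S₂) (a : A) (b : B) : ℝ :=
  (∑ t ∈ Finset.Icc 1 k with D.state t h = s ∧ D.act₁ t h = a ∧ D.act₂ t h = b, D.rew t h) /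
    max (D.count k h s a b : ℝ) 1

open scoped Classical in
/-- The empirical transition of Player 1's state after `k` episodes; uniform for `k = 0`. -/
def PlayLog.PHat₁ [Fintype S₁] (D : PlayLog S₁ S₂ A B) (k h : ℕ) (s : S₁) (a : A) (s' : S₁) : ℝ :=
  if k = 0 then 1 / (Fintype.card S₁ : ℝ)
  else ({t ∈ Finset.Icc 1 k | (D.state t h).1 = s ∧ D.act₁ t h = a ∧
    (D.state t (h + 1)).1 = s'}.card : ℝ) / max (D.count₁ k h s a : ℝ) 1

open scoped Classical in
/-- The empirical transition of Player 2's state after `k` episodes; uniform for `k = 0`. -/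
def PlayLog.PHat₂ [Fintype S₂] (D : PlayLog S₁ S₂ A B) (k h : ℕ) (s : S₂) (b : B) (s' : S₂) : ℝ :=
  if k = 0 then 1 / (Fintype.card S₂ : ℝ)
  else ({t ∈ Finset.Icc 1 k | (D.state t h).2 = s ∧ D.act₂ t h = b ∧
    (D.state t (h + 1)).2 = s'}.card : ℝ) / max (D.count₂ k h s b : ℝ) 1

variable [Fintype S₁] [Fintype S₂] [Fintype A] [Fintype B]

/-- The reward bonus. -/
def PlayLog.bonusR (D : PlayLog S₁ S₂ A B) (H K : ℕ) (δ : ℝ) (k h : ℕ) (s : S₁ × S₂) (a : A)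
    (b : B) : ℝ :=
  √(4 * Real.log ((Fintype.card S₁ : ℝ) * Fintype.card S₂ * Fintype.card A * Fintype.card B *
    H * K / δ) / max (D.count k h s a b : ℝ) 1)

/-- The transition bonus. -/
def PlayLog.bonusP (D : PlayLog S₁ S₂ A B) (H K : ℕ) (δ : ℝ) (k h : ℕ) (s : S₁ × S₂) (a : A)
    (b : B) : ℝ :=
  √(2 * (H : ℝ) ^ 2 * Fintype.card S₁ *
      Real.log (2 * Fintype.card S₁ * Fintype.card A * H * K / δ) /
        max (D.count₁ k h s.1 a : ℝ) 1) +
    √(2 * (H : ℝ) ^ 2 * Fintype.card S₂ *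
      Real.log (2 * Fintype.card S₂ * Fintype.card B * H * K / δ) /
        max (D.count₂ k h s.2 b : ℝ) 1)

/-- The bonus `β_h^k(s, a, b)`; it is `0` for `k = 0`. -/
def PlayLog.bonus (D : PlayLog S₁ S₂ A B) (H K : ℕ) (δ : ℝ) (k h : ℕ) (s : S₁ × S₂) (a : A)
    (b : B) : ℝ :=
  if k = 0 then 0 else D.bonusR H K δ k h s a b + D.bonusP H K δ k h s a b

/-- One optimistic backup for the minimizing player at step `h`, from the estimate `V` of the value
at the next step: `min {r̂ + P̂ V - β, number of remaining steps}⁺`. -/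
def PlayLog.backup (D : PlayLog S₁ S₂ A B) (H K : ℕ) (δ : ℝ) (k h : ℕ) (V : S₁ × S₂ → ℝ)
    (s : S₁ × S₂) (a : A) (b : B) : ℝ :=
  max (min (D.rHat k h s a b +
    ∑ s' : S₁ × S₂, D.PHat₁ k h s.1 a s'.1 * D.PHat₂ k h s.2 b s'.2 * V s' -
    D.bonus H K δ k h s a b) ((H : ℝ) - h)) 0

/-- The estimated value function for the policies `μ`, `ν` after `k` episodes, with `n` steps to
go, that is at step `H - n`. -/
def PlayLog.vLowAux (D : PlayLog S₁ S₂ A B) (H K : ℕ) (δ : ℝ) (μ : Policy S₁ A) (ν : Policy S₂ B)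
    (k : ℕ) : ℕ → S₁ × S₂ → ℝ
  | 0, _ => 0
  | n + 1, s => ∑ a, ∑ b, μ.prob (H - (n + 1)) s.1 a *
      D.backup H K δ k (H - (n + 1)) (D.vLowAux H K δ μ ν k n) s a b * ν.prob (H - (n + 1)) s.2 b

/-- The estimated value function at step `h`. -/
def PlayLog.vLow (D : PlayLog S₁ S₂ A B) (H K : ℕ) (δ : ℝ) (μ : Policy S₁ A) (ν : Policy S₂ B)
    (k h : ℕ) : S₁ × S₂ → ℝ :=
  D.vLowAux H K δ μ ν k (H - h)

/-- The estimated action-value function at step `h`. -/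
def PlayLog.qLow (D : PlayLog S₁ S₂ A B) (H K : ℕ) (δ : ℝ) (μ : Policy S₁ A) (ν : Policy S₂ B)
    (k h : ℕ) : S₁ × S₂ → A → B → ℝ :=
  D.backup H K δ k h (D.vLow H K δ μ ν k (h + 1))

open scoped Classical in
/-- The empirical state reaching probability of Player 1 for policy `μ` after `k` episodes, when
started in `s₀`. -/
def PlayLog.reach₁ (D : PlayLog S₁ S₂ A B) (s₀ : S₁) (μ : Policy S₁ A) (k : ℕ) : ℕ → S₁ → ℝ
  | 0, s => if s = s₀ then 1 else 0
  | h + 1, s => ∑ s' : S₁, ∑ a : A, D.reach₁ s₀ μ k h s' * μ.prob h s' a * D.PHat₁ k h s' a s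

/-- The linear loss `∑_{s¹} ⟨Q_h(s¹, s², ·, b), μ_h(· | s¹)⟩ d_h(s¹)` of the policy improvement. -/
def PlayLog.loss₂ (D : PlayLog S₁ S₂ A B) (H K : ℕ) (δ : ℝ) (s₀ : S₁) (μ : Policy S₁ A)
    (ν : Policy S₂ B) (k h : ℕ) (s₂ : S₂) (b : B) : ℝ :=
  ∑ s₁ : S₁, (∑ a : A, D.qLow H K δ μ ν k h (s₁, s₂) a b * μ.prob h s₁ a) * D.reach₁ s₀ μ k h s₁

/-- The Kullback-Leibler divergence of two finite distributions, where `q` has full support. -/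
def kl {X : Type*} [Fintype X] (p q : X → ℝ) : ℝ := ∑ x, p x * Real.log (p x / q x)

/-- The objective that the mirror descent step after `k` episodes minimizes, at the state `s₂`. -/
def PlayLog.descentObjective₂ (D : PlayLog S₁ S₂ A B) (H K : ℕ) (δ γ : ℝ) (s₀ : S₁)
    (μ : Policy S₁ A) (ν : Policy S₂ B) (k : ℕ) (s₂ : S₂) (ν' : Policy S₂ B) : ℝ :=
  ∑ h ∈ Finset.range H,
    (∑ b, (ν'.prob h s₂ b - ν.prob h s₂ b) * D.loss₂ H K δ s₀ μ ν k h s₂ b +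
      γ⁻¹ * kl (ν'.prob h s₂) (ν.prob h s₂))

/-- Optimistic policy optimization for Player 2 with confidence parameter `δ` and step size `γ`:
the policies `ν 1, …, ν K` are the ones that the algorithm computes from the observed
data `D` and the opponent's past policies `μ`. -/
structure RunsOptimisticPO₂ (H K : ℕ) (δ γ : ℝ) (s₀ : S₁) (D : PlayLog S₁ S₂ A B)
    (μ : ℕ → Policy S₁ A) (ν : ℕ → Policy S₂ B) : Prop where
  init : ∀ h < H, ∀ s₂ b, (ν 0).prob h s₂ b = 1 / (Fintype.card B : ℝ)
  step : ∀ k < K, ∀ s₂, ∀ ν' : Policy S₂ B,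
    D.descentObjective₂ H K δ γ s₀ (μ k) (ν k) k s₂ (ν (k + 1)) ≤
      D.descentObjective₂ H K δ γ s₀ (μ k) (ν k) k s₂ ν'

end Estimates

section Interaction

variable {S₁ S₂ A B Ω : Type*} {mΩ : MeasurableSpace Ω}

/-- The information available when the actions at step `h` of episode `k` are drawn: everything
before episode `k`, the steps before `h` of episode `k`, and the current state. -/
abbrev preAction (𝓕 : Filtration ℕ mΩ) (D : Ω → PlayLog S₁ S₂ A B) (k h : ℕ) : MeasurableSpace Ω :=
  𝓕 (k - 1) ⊔
    (⨆ j ∈ Finset.range h,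
      MeasurableSpace.comap (fun ω => ((D ω).state k j, (D ω).act₁ k j, (D ω).act₂ k j)) ⊤ ⊔
      MeasurableSpace.comap (fun ω => (D ω).rew k j) (borel ℝ)) ⊔
    MeasurableSpace.comap (fun ω => (D ω).state k h) ⊤

/-- The same, with the two actions at step `h` of episode `k`. -/
abbrev postAction (𝓕 : Filtration ℕ mΩ) (D : Ω → PlayLog S₁ S₂ A B) (k h : ℕ) : MeasurableSpace Ω :=
  preAction 𝓕 D k h ⊔
    MeasurableSpace.comap (fun ω => ((D ω).act₁ k h, (D ω).act₂ k h)) ⊤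

variable [Fintype S₁] [Fintype S₂] [Fintype A] [Fintype B]

/-- The random data `D` of the episodes `1, …, K` arise when the two players play the game `G` of
horizon `H` with the policies `μ k` and `ν k` in episode `k`. The σ-algebra `𝓕 k` holds the
information available after episode `k`. The policies of an episode may depend on all of the past
in an arbitrary way (and on private randomness), in an episode the two players draw their actions
independently, the next state follows the transition model, and the
observed rewards lie in `[0, 1]` and have conditional mean `r_h(s, a, b)`. -/
structure Plays (Pr : Measure Ω) (G : Game S₁ S₂ A B) (H K : ℕ) (𝓕 : Filtration ℕ mΩ)
    (D : Ω → PlayLog S₁ S₂ A B) (μ : ℕ → Ω → Policy S₁ A) (ν : ℕ → Ω → Policy S₂ B) : Prop where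
  policy₁_meas : ∀ k ∈ Finset.Icc 1 K, ∀ h < H, ∀ s a,
    Measurable[𝓕 (k - 1)] fun ω => (μ k ω).prob h s a
  policy₂_meas : ∀ k ∈ Finset.Icc 1 K, ∀ h < H, ∀ s b,
    Measurable[𝓕 (k - 1)] fun ω => (ν k ω).prob h s b
  state_meas : ∀ k ∈ Finset.Icc 1 K, ∀ h ≤ H, ∀ s, MeasurableSet[𝓕 k] {ω | (D ω).state k h = s}
  act₁_meas : ∀ k ∈ Finset.Icc 1 K, ∀ h < H, ∀ a, MeasurableSet[𝓕 k] {ω | (D ω).act₁ k h = a}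
  act₂_meas : ∀ k ∈ Finset.Icc 1 K, ∀ h < H, ∀ b, MeasurableSet[𝓕 k] {ω | (D ω).act₂ k h = b}
  rew_meas : ∀ k ∈ Finset.Icc 1 K, ∀ h < H, Measurable[𝓕 k] fun ω => (D ω).rew k h
  rew_mem : ∀ k ∈ Finset.Icc 1 K, ∀ h < H, ∀ ω, (D ω).rew k h ∈ Set.Icc (0 : ℝ) 1
  state_init : ∀ k ∈ Finset.Icc 1 K, ∀ ω, (D ω).state k 0 = G.init
  action_law : ∀ k ∈ Finset.Icc 1 K, ∀ h < H, ∀ a b,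
    Pr[Set.indicator {ω | (D ω).act₁ k h = a ∧ (D ω).act₂ k h = b} (fun _ => (1 : ℝ)) |
        preAction 𝓕 D k h] =ᵐ[Pr]
      fun ω => (μ k ω).prob h ((D ω).state k h).1 a * (ν k ω).prob h ((D ω).state k h).2 b
  state_law : ∀ k ∈ Finset.Icc 1 K, ∀ h < H, ∀ s',
    Pr[Set.indicator {ω | (D ω).state k (h + 1) = s'} (fun _ => (1 : ℝ)) |
        postAction 𝓕 D k h] =ᵐ[Pr]
      fun ω => G.trans h ((D ω).state k h) ((D ω).act₁ k h) ((D ω).act₂ k h) s'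
  rew_mean : ∀ k ∈ Finset.Icc 1 K, ∀ h < H,
    Pr[fun ω => (D ω).rew k h | postAction 𝓕 D k h] =ᵐ[Pr]
      fun ω => G.r h ((D ω).state k h) ((D ω).act₁ k h) ((D ω).act₂ k h)

end Interaction

/-- The constant `C` of the regret bound, in terms of `|S₁|, |S₂|, |A|, |B|, H`. -/
def regretConst (n₁ n₂ nA nB H : ℝ) : ℝ :=
  √((n₁ ^ 2 * nA + n₂ ^ 2 * nB) * H ^ 3) + √(n₁ * n₂ * nA * nB * H)

end

end FactoredGame

open FactoredGame

/-!
Fix a comparison policy `ν'` of Player 2. In episode `k` let `V` be the value in the game, `V̲` the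
algorithm's estimate after that episode, and `Ṽ` the value in the mixed model in which Player 1's
state follows the *estimated* transition while Player 2's transition and the rewards are the true
ones. Then
`V^{μ,ν} - V^{μ,ν'} = (V^{μ,ν} - V̲^{μ,ν}) + (V̲^{μ,ν} - Ṽ^{μ,ν'}) + (Ṽ^{μ,ν'} - V^{μ,ν'})`,
and all three differences are instances of one performance difference principle
(`le_sum_occ_mul`).

* The first is at most twice the expected bonus along an episode
  (`Game.EstimatesOK.value_sub_vLow_le`).
* For the second, the bonus is large enough to make `V̲` optimistic in the mixed model too
  (`Game.EstimatesOK.qLow_le`). Since the occupancy of the mixed model is the product of the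
  empirical reaching probabilities of Player 1 and the occupancy of `ν'`, the difference is at most
  the linear regret against the losses that the algorithm itself uses
  (`Game.EstimatesOK.vLow_sub_modelValue_le`). The mirror descent steps are exponential weights
  updates (`RunsOptimisticPO₂.prob_succ`), with the usual regret bound (`hedge_regret_le`).
* The third is at most `H` times the `ℓ¹` error of Player 1's estimated transition along Player 1's
  true trajectory (`Game.EstimatesOK.modelValue_sub_value_le`), which does not depend on Player 2's
  policy. Comparing values, rather than first replacing the empirical reaching probabilities by the
  true ones in the losses, is what keeps the power of `H` at `3 / 2`: the latter would pay the
  accumulated transition error once for every step.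

What remains is the expected width of the confidence sets. The counts that include the current
episode are bounded below by the counts up to the previous one, which the past determines, so that
the Azuma–Hoeffding inequality replaces the expectation by the realized widths
(`Plays.measureReal_widths_le`); these sum up to `3 √(|X| K)` by `sum_one_div_sqrt_count_le`.

All concentration statements are instances of one exponential supermartingale for `[0, 1]`-valued
observations whose mean is determined by the past (`ObservedMean.integral_exp_le_one`). The
confidence sets of the rewards and of the transitions (`measureReal_l1_le`, by a union bound over
subsets) hold at all episodes by a union bound over the episode and the number of visits. Only
`δ < 1 / 4` matters, which makes the logarithm at least `1` and absorbs the numerical constants of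
the union bounds.
-/

namespace FactoredGame

set_option linter.unusedSectionVars false

/-! ### Scalar inequalities and exponential weights -/

/-- The moment generating function bound of Hoeffding's lemma for a Bernoulli variable. By
convexity, `1 + p * (exp t - 1)` also bounds `𝔼 exp (t X)` for every `[0, 1]`-valued `X` of
mean `p`. -/
theorem one_add_mul_exp_sub_one_le {p : ℝ} (hp0 : 0 ≤ p) (hp1 : p ≤ 1) (t : ℝ) :
    1 + p * (Real.exp t - 1) ≤ Real.exp (t * p + t ^ 2 / 8) := by
  let ρ : Measure ℝ := ENNReal.ofReal (1 - p) • Measure.dirac 0 + ENNReal.ofReal p • Measure.dirac 1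
  have hint : ∀ f : ℝ → ℝ, ∫ x, f x ∂ρ = (1 - p) * f 0 + p * f 1 := by
    intro f
    rw [integral_add_measure, integral_smul_measure, integral_smul_measure, integral_dirac,
      integral_dirac, ENNReal.toReal_ofReal (by linarith), ENNReal.toReal_ofReal hp0]
    · rfl
    · exact (integrable_dirac (by simp)).smul_measure ENNReal.ofReal_ne_top
    · exact (integrable_dirac (by simp)).smul_measure ENNReal.ofReal_ne_top
  have hρ : IsProbabilityMeasure ρ := ⟨by
    simp only [ρ, Measure.coe_add, Measure.coe_smul, Pi.add_apply, Pi.smul_apply,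
      measure_univ, smul_eq_mul, mul_one]
    rw [← ENNReal.ofReal_add (by linarith) hp0]
    simp⟩
  have hmem : ∀ᵐ x ∂ρ, id x ∈ Set.Icc (0 : ℝ) 1 := by
    refine ae_add_measure_iff.2 ⟨?_, ?_⟩ <;>
    · refine Measure.ae_smul_measure ?_ _
      rw [ae_dirac_eq]
      simp
  have hsub := (hasSubgaussianMGF_of_mem_Icc aemeasurable_id hmem).mgf_le t
  simp only [mgf, hint, id] at hsub
  norm_num at hsub
  calc 1 + p * (Real.exp t - 1)
      = Real.exp (t * p) * ((1 - p) * Real.exp (-(t * p)) + p * Real.exp (t * (1 - p))) := by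
        rw [mul_add, mul_left_comm, ← Real.exp_add, mul_left_comm, ← Real.exp_add]
        ring_nf
        simp
        ring
    _ ≤ Real.exp (t * p) * Real.exp (1 / 4 * t ^ 2 / 2) := by gcongr
    _ = _ := by rw [← Real.exp_add]; ring_nf

/-- The chord of `exp (t * ·)` over `[0, 1]` lies above the graph. -/
theorem exp_mul_le_one_add {x : ℝ} (hx0 : 0 ≤ x) (hx1 : x ≤ 1) (t : ℝ) :
    Real.exp (t * x) ≤ 1 + x * (Real.exp t - 1) := by
  have := convexOn_exp.2 (Set.mem_univ 0) (Set.mem_univ t) (sub_nonneg.2 hx1) hx0 (by ring)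
  simp only [smul_eq_mul, mul_zero, zero_add, Real.exp_zero, mul_one] at this
  rw [mul_comm t x]
  linarith

theorem exp_neg_le_quadratic {x : ℝ} (hx : 0 ≤ x) : Real.exp (-x) ≤ 1 - x + x ^ 2 / 2 := by
  have h := Real.quadratic_le_exp_of_nonneg hx
  rw [Real.exp_neg]
  refine inv_le_of_inv_le₀ ?_ (le_trans ?_ h)
  · nlinarith [sq_nonneg (x - 1)]
  · rw [inv_le_iff_one_le_mul₀ (by nlinarith [sq_nonneg (x - 1)])]
    nlinarith [sq_nonneg (x ^ 2)]

theorem one_div_sqrt_max_le (n : ℕ) :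
    1 / √(max (n : ℝ) 1) ≤ 3 * (√((n : ℝ) + 1) - √n) := by
  rcases Nat.eq_zero_or_pos n with rfl | hn
  · norm_num
  · have h1 : (1 : ℝ) ≤ n := by exact_mod_cast hn
    rw [max_eq_left h1]
    have hs : 0 < √(n : ℝ) := Real.sqrt_pos.2 (by linarith)
    have ht : √((n : ℝ) + 1) ≤ 2 * √n := by
      rw [Real.sqrt_le_iff]
      refine ⟨by positivity, ?_⟩
      rw [mul_pow, Real.sq_sqrt (by linarith)]
      linarith
    have h2 : √((n : ℝ) + 1) ^ 2 = n + 1 := Real.sq_sqrt (by linarith)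
    have h3 : √(n : ℝ) ^ 2 = n := Real.sq_sqrt (by linarith)
    have h4 : √(n : ℝ) ≤ √((n : ℝ) + 1) := Real.sqrt_le_sqrt (by linarith)
    rw [div_le_iff₀ hs]
    nlinarith

/-- If `N k x` counts the visits of `x` by the sequence `y` up to time `k`, the sum of the inverse
square roots of the visit counts along `y` is of the order of `√(|X| n)`. -/
theorem sum_one_div_sqrt_count_le {X : Type*} [Fintype X] [DecidableEq X] (y : ℕ → X)
    (N : ℕ → X → ℕ) (h0 : ∀ x, N 0 x = 0)
    (hN : ∀ k x, N (k + 1) x = N k x + if y (k + 1) = x then 1 else 0) (n : ℕ) :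
    ∑ k ∈ Finset.Icc 1 n, 1 / √(max (N (k - 1) (y k) : ℝ) 1) ≤ 3 * √(Fintype.card X * n) := by
  have h1 : ∀ n : ℕ, ∑ k ∈ Finset.Icc 1 n, 1 / √(max (N (k - 1) (y k) : ℝ) 1) ≤
      3 * ∑ x, √(N n x : ℝ) := by
    intro n
    induction n with
    | zero => simp [h0]
    | succ n ih =>
      rw [Finset.sum_Icc_succ_top (by omega), Nat.add_sub_cancel]
      have h2 : ∑ x, √(N (n + 1) x : ℝ) = ∑ x, √(N n x : ℝ) +
          (√((N n (y (n + 1)) : ℝ) + 1) - √(N n (y (n + 1)))) := by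
        rw [← sub_eq_iff_eq_add', ← Finset.sum_sub_distrib,
          Finset.sum_eq_single (y (n + 1))]
        · simp [hN]
        · intro x _ hx
          simp [hN, hx.symm]
        · simp
      have := one_div_sqrt_max_le (N n (y (n + 1)))
      rw [h2]
      linarith
  have h3 : ∀ n : ℕ, ∑ x, (N n x : ℝ) = n := by
    intro n
    induction n with
    | zero => simp [h0]
    | succ n ih => simp [hN, Finset.sum_add_distrib, ih]
  refine (h1 n).trans ?_
  gcongr
  refine Real.le_sqrt_of_sq_le ?_
  refine sq_sum_le_card_mul_sum_sq.trans ?_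
  simp [Real.sq_sqrt, h3]

/-- Regret bound of exponential weights started from the uniform distribution. -/
theorem hedge_regret_le {X : Type*} [Fintype X] [Nonempty X] {η L : ℝ} (hη : 0 < η) (n : ℕ)
    (p ℓ : ℕ → X → ℝ) (q : X → ℝ) (hp0 : ∀ x, p 0 x = 1 / (Fintype.card X : ℝ))
    (hp : ∀ k, k + 1 < n → ∀ x, p (k + 1) x =
      p k x * Real.exp (-(η * ℓ k x)) / ∑ y, p k y * Real.exp (-(η * ℓ k y)))
    (hℓ0 : ∀ k < n, ∀ x, 0 ≤ ℓ k x) (hℓ1 : ∀ k < n, ∀ x, ℓ k x ≤ L)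
    (hq0 : ∀ x, 0 ≤ q x) (hq1 : ∑ x, q x = 1) :
    ∑ k ∈ Finset.range n, ∑ x, (p k x - q x) * ℓ k x ≤
      Real.log (Fintype.card X) / η + η * n * L ^ 2 / 2 := by
  let w : ℕ → X → ℝ := fun k x => Real.exp (-(η * ∑ j ∈ Finset.range k, ℓ j x))
  have hw : ∀ k x, 0 < w k x := fun k x => Real.exp_pos _
  have hW : ∀ k, 0 < ∑ x, w k x := fun k => Finset.sum_pos (fun x _ => hw k x) (by simp)
  have hws : ∀ k x, w (k + 1) x = w k x * Real.exp (-(η * ℓ k x)) := by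
    intro k x
    simp only [w, Finset.sum_range_succ, ← Real.exp_add]
    ring_nf
  have hpw : ∀ k < n, ∀ x, p k x = w k x / ∑ y, w k y := by
    intro k
    induction k with
    | zero => intro _ x; simp [hp0, w]
    | succ k ih =>
      intro hk x
      have ih' := ih (by omega)
      rw [hp k hk x]
      simp only [ih', hws, div_mul_eq_mul_div, ← Finset.sum_div]
      rw [div_div_div_cancel_right₀ (hW k).ne']
  have hlog : ∀ k ≤ n, Real.log (∑ x, w k x) ≤ Real.log (Fintype.card X) -
      η * ∑ j ∈ Finset.range k, ∑ x, p j x * ℓ j x + k * (η ^ 2 * L ^ 2 / 2) := by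
    intro k
    induction k with
    | zero => intro _; simp [w]
    | succ k ih =>
      intro hk
      have hk' : k < n := by omega
      have hpp : ∀ x, 0 ≤ p k x := fun x => by
        rw [hpw k hk']; exact div_nonneg (hw k x).le (hW k).le
      have hp1 : ∑ x, p k x = 1 := by
        simp only [hpw k hk', ← Finset.sum_div]
        exact div_self (hW k).ne'
      have h1 : ∑ x, w (k + 1) x = (∑ x, w k x) * ∑ x, p k x * Real.exp (-(η * ℓ k x)) := by
        rw [Finset.mul_sum]
        refine Finset.sum_congr rfl fun x _ => ?_
        rw [hws, hpw k hk']
        field_simp [(hW k).ne']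
      have h2 : 0 < ∑ x, p k x * Real.exp (-(η * ℓ k x)) := by
        have := hW (k + 1)
        rw [h1] at this
        exact (pos_iff_pos_of_mul_pos this).1 (hW k)
      have h3 : ∑ x, p k x * Real.exp (-(η * ℓ k x)) ≤
          1 - η * ∑ x, p k x * ℓ k x + η ^ 2 * L ^ 2 / 2 := by
        calc ∑ x, p k x * Real.exp (-(η * ℓ k x))
            ≤ ∑ x, p k x * (1 - η * ℓ k x + η ^ 2 * L ^ 2 / 2) := by
              refine Finset.sum_le_sum fun x _ => mul_le_mul_of_nonneg_left ?_ (hpp x)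
              refine (exp_neg_le_quadratic (mul_nonneg hη.le (hℓ0 k hk' x))).trans ?_
              rw [mul_pow]
              have := hℓ0 k hk' x
              have := hℓ1 k hk' x
              gcongr
          _ = _ := by
              simp only [mul_add, mul_sub, mul_one, Finset.sum_add_distrib, Finset.sum_sub_distrib,
                hp1, ← Finset.sum_mul, one_mul, Finset.mul_sum]
              congr 2
              exact Finset.sum_congr rfl fun x _ => by ring
      rw [h1, Real.log_mul (hW k).ne' h2.ne', Finset.sum_range_succ]
      have h4 := Real.log_le_sub_one_of_pos h2
      have h5 := ih (by omega)
      push_cast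
      linarith
  have hge : ∀ x, -(η * ∑ j ∈ Finset.range n, ℓ j x) ≤ Real.log (∑ x, w n x) := by
    intro x
    rw [← Real.log_exp (-(η * ∑ j ∈ Finset.range n, ℓ j x))]
    exact Real.log_le_log (Real.exp_pos _)
      (Finset.single_le_sum (f := w n) (fun y _ => (hw n y).le) (Finset.mem_univ x))
  have havg : -(η * ∑ j ∈ Finset.range n, ∑ x, q x * ℓ j x) ≤ Real.log (∑ x, w n x) := by
    calc -(η * ∑ j ∈ Finset.range n, ∑ x, q x * ℓ j x)
        = ∑ x, q x * -(η * ∑ j ∈ Finset.range n, ℓ j x) := by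
          rw [Finset.sum_comm, Finset.mul_sum, ← Finset.sum_neg_distrib]
          refine Finset.sum_congr rfl fun x _ => ?_
          rw [← Finset.mul_sum]
          ring
      _ ≤ ∑ x, q x * Real.log (∑ x, w n x) :=
          Finset.sum_le_sum fun x _ => mul_le_mul_of_nonneg_left (hge x) (hq0 x)
      _ = _ := by rw [← Finset.sum_mul, hq1, one_mul]
  have hfin := havg.trans (hlog n le_rfl)
  have hsplit : ∑ k ∈ Finset.range n, ∑ x, (p k x - q x) * ℓ k x =
      ∑ k ∈ Finset.range n, ∑ x, p k x * ℓ k x - ∑ k ∈ Finset.range n, ∑ x, q x * ℓ k x := by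
    simp only [sub_mul, Finset.sum_sub_distrib]
  rw [hsplit]
  have : Real.log (Fintype.card X) / η + η * n * L ^ 2 / 2 =
      (Real.log (Fintype.card X) + n * (η ^ 2 * L ^ 2 / 2)) / η := by
    field_simp
  rw [this, le_div_iff₀ hη]
  linarith

theorem sub_le_mul_log_div {a b : ℝ} (ha : 0 ≤ a) (hb : 0 < b) : a - b ≤ a * Real.log (a / b) := by
  rcases ha.eq_or_lt with rfl | ha
  · simp [hb.le]
  · have := Real.log_le_sub_one_of_pos (div_pos hb ha)
    rw [← inv_div b a, Real.log_inv]
    have h2 : a * (b / a - 1) = b - a := by field_simp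
    nlinarith [mul_le_mul_of_nonneg_left this ha.le]

theorem eq_of_mul_log_div_le {a b : ℝ} (ha : 0 ≤ a) (hb : 0 < b)
    (h : a * Real.log (a / b) ≤ a - b) : a = b := by
  rcases ha.eq_or_lt with rfl | ha
  · simp at h; linarith
  · by_contra hne
    have hne' : b / a ≠ 1 := fun h' => hne ((div_eq_one_iff_eq ha.ne').1 h').symm
    have := Real.log_lt_sub_one_of_pos (div_pos hb ha) hne'
    rw [← inv_div b a, Real.log_inv] at h
    have h2 : a * (b / a - 1) = b - a := by field_simp
    nlinarith [mul_lt_mul_of_pos_left this ha]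

theorem kl_nonneg {X : Type*} [Fintype X] {p q : X → ℝ} (hp : ∀ x, 0 ≤ p x) (hq : ∀ x, 0 < q x)
    (hp1 : ∑ x, p x = 1) (hq1 : ∑ x, q x = 1) : 0 ≤ kl p q := by
  have : ∑ x, (p x - q x) ≤ kl p q :=
    Finset.sum_le_sum fun x _ => sub_le_mul_log_div (hp x) (hq x)
  rwa [Finset.sum_sub_distrib, hp1, hq1, sub_self] at this

theorem eq_of_kl_nonpos {X : Type*} [Fintype X] {p q : X → ℝ} (hp : ∀ x, 0 ≤ p x)
    (hq : ∀ x, 0 < q x) (hp1 : ∑ x, p x = 1) (hq1 : ∑ x, q x = 1) (h : kl p q ≤ 0) : p = q := by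
  have h0 : ∀ x ∈ Finset.univ, 0 ≤ p x * Real.log (p x / q x) - (p x - q x) := fun x _ =>
    sub_nonneg.2 (sub_le_mul_log_div (hp x) (hq x))
  have h1 : ∑ x, (p x * Real.log (p x / q x) - (p x - q x)) ≤ 0 := by
    rw [Finset.sum_sub_distrib, Finset.sum_sub_distrib, hp1, hq1, sub_self, sub_zero]
    exact h
  have h2 := (Finset.sum_eq_zero_iff_of_nonneg h0).1 (le_antisymm h1 (Finset.sum_nonneg h0))
  ext x
  exact eq_of_mul_log_div_le (hp x) (hq x) (sub_eq_zero.1 (h2 x (Finset.mem_univ x))).le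

/-- The regularized linear objective of a mirror descent step is, up to a constant, the divergence
from the exponential weights update. -/
theorem linear_add_kl_eq {X : Type*} [Fintype X] {η : ℝ} (hη : 0 < η) (p q ℓ : X → ℝ)
    (hp : ∀ x, 0 < p x) (hq : ∀ x, 0 ≤ q x) (hq1 : ∑ x, q x = 1) (Z : ℝ) (hZ : 0 < Z) :
    ∑ x, (q x - p x) * ℓ x + η⁻¹ * kl q p =
      η⁻¹ * kl q (fun x => p x * Real.exp (-(η * ℓ x)) / Z) -
        (η⁻¹ * Real.log Z + ∑ x, p x * ℓ x) := by
  have h : ∀ x, q x * Real.log (q x / (p x * Real.exp (-(η * ℓ x)) / Z)) =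
      q x * Real.log (q x / p x) + q x * (η * ℓ x) + q x * Real.log Z := by
    intro x
    rcases (hq x).eq_or_lt with h0 | h0
    · simp [← h0]
    · rw [Real.log_div h0.ne' (by have := hp x; positivity),
        Real.log_div (by have := hp x; positivity) hZ.ne',
        Real.log_mul (hp x).ne' (Real.exp_pos _).ne', Real.log_exp,
        Real.log_div h0.ne' (hp x).ne']
      ring
  simp only [kl, h, Finset.sum_add_distrib, ← Finset.sum_mul, hq1, one_mul, sub_mul,
    Finset.sum_sub_distrib]
  have h2 : ∑ x, q x * (η * ℓ x) = η * ∑ x, q x * ℓ x := by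
    rw [Finset.mul_sum]
    exact Finset.sum_congr rfl fun x _ => by ring
  rw [h2]
  field_simp
  ring

/-! ### Occupancies and the decomposition of the regret of an episode -/

section Occupancy

variable {S S₁ S₂ A B : Type*} [Fintype S] [Fintype S₁] [Fintype S₂] [Fintype A] [Fintype B]

open scoped Classical in
/-- The state occupancy at step `h` of one player who starts in `s₀` and follows `π` in the
(possibly sub-stochastic) transition model `P`. -/
noncomputable def occ (P : ℕ → S → A → S → ℝ) (π : Policy S A) (s₀ : S) : ℕ → S → ℝ
  | 0, s => if s = s₀ then 1 else 0
  | h + 1, s => ∑ s' : S, ∑ a : A, occ P π s₀ h s' * π.prob h s' a * P h s' a s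

theorem occ_nonneg {P : ℕ → S → A → S → ℝ} (hP : ∀ h s a s', 0 ≤ P h s a s') (π : Policy S A)
    (s₀ : S) (h : ℕ) (s : S) : 0 ≤ occ P π s₀ h s := by
  induction h generalizing s with
  | zero => rw [occ]; split_ifs <;> simp
  | succ h ih =>
    rw [occ]
    exact Finset.sum_nonneg fun s' _ => Finset.sum_nonneg fun a _ =>
      mul_nonneg (mul_nonneg (ih s') (π.nonneg _ _ _)) (hP _ _ _ _)

theorem sum_occ_zero (P : ℕ → S → A → S → ℝ) (π : Policy S A) (s₀ : S) :
    ∑ s, occ P π s₀ 0 s = 1 := by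
  rw [Finset.sum_eq_single s₀]
  · simp [occ]
  · intro s _ hs
    simp [occ, hs]
  · simp

theorem sum_occ_succ (P : ℕ → S → A → S → ℝ) (π : Policy S A) (s₀ : S) (h : ℕ) :
    ∑ s, occ P π s₀ (h + 1) s = ∑ s, ∑ a, occ P π s₀ h s * π.prob h s a * ∑ s', P h s a s' := by
  simp only [occ, Finset.mul_sum]
  rw [Finset.sum_comm]
  exact Finset.sum_congr rfl fun _ _ => Finset.sum_comm

theorem sum_occ_le_one {P : ℕ → S → A → S → ℝ} (hP : ∀ h s a s', 0 ≤ P h s a s')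
    (hP1 : ∀ h s a, ∑ s', P h s a s' ≤ 1) (π : Policy S A) (s₀ : S) (h : ℕ) :
    ∑ s, occ P π s₀ h s ≤ 1 := by
  induction h with
  | zero => exact (sum_occ_zero P π s₀).le
  | succ h ih =>
    rw [sum_occ_succ]
    refine le_trans (Finset.sum_le_sum fun s _ => ?_) ih
    calc ∑ a, occ P π s₀ h s * π.prob h s a * ∑ s', P h s a s'
        ≤ ∑ a, occ P π s₀ h s * π.prob h s a := Finset.sum_le_sum fun a _ =>
          mul_le_of_le_one_right (mul_nonneg (occ_nonneg hP _ _ _ _) (π.nonneg _ _ _)) (hP1 _ _ _)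
      _ = _ := by rw [← Finset.mul_sum, π.sum_eq_one, mul_one]

theorem sum_occ_eq_one (P : Transition S A) (π : Policy S A) (s₀ : S) (h : ℕ) :
    ∑ s, occ P.prob π s₀ h s = 1 := by
  induction h with
  | zero => exact sum_occ_zero P.prob π s₀
  | succ h ih =>
    rw [sum_occ_succ, ← ih]
    refine Finset.sum_congr rfl fun s _ => ?_
    simp only [P.sum_eq_one, mul_one, ← Finset.mul_sum, π.sum_eq_one]

/-- Factored transitions make the joint occupancy the product of the occupancies of the players. -/
theorem sum_occ_mul_occ_succ (P₁ : ℕ → S₁ → A → S₁ → ℝ) (P₂ : ℕ → S₂ → B → S₂ → ℝ)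
    (μ : Policy S₁ A) (ν : Policy S₂ B) (s₀ : S₁ × S₂) (h : ℕ) (f : S₁ × S₂ → ℝ) :
    ∑ s : S₁ × S₂, occ P₁ μ s₀.1 (h + 1) s.1 * occ P₂ ν s₀.2 (h + 1) s.2 * f s =
      ∑ s : S₁ × S₂, occ P₁ μ s₀.1 h s.1 * occ P₂ ν s₀.2 h s.2 *
        ∑ a, ∑ b, μ.prob h s.1 a * ν.prob h s.2 b *
          ∑ s' : S₁ × S₂, P₁ h s.1 a s'.1 * P₂ h s.2 b s'.2 * f s' := by
  have h1 : ∀ s : S₁ × S₂, occ P₁ μ s₀.1 (h + 1) s.1 * occ P₂ ν s₀.2 (h + 1) s.2 * f s =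
      ∑ t : S₁ × S₂, ∑ a, ∑ b, occ P₁ μ s₀.1 h t.1 * occ P₂ ν s₀.2 h t.2 *
        (μ.prob h t.1 a * ν.prob h t.2 b * (P₁ h t.1 a s.1 * P₂ h t.2 b s.2 * f s)) := by
    intro s
    rw [occ, occ, Finset.sum_mul_sum, Fintype.sum_prod_type, Finset.sum_mul]
    refine Finset.sum_congr rfl fun t₁ _ => ?_
    rw [Finset.sum_mul]
    refine Finset.sum_congr rfl fun t₂ _ => ?_
    rw [Finset.sum_mul_sum, Finset.sum_mul]
    refine Finset.sum_congr rfl fun a _ => ?_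
    rw [Finset.sum_mul]
    exact Finset.sum_congr rfl fun b _ => by ring
  simp only [h1]
  rw [Finset.sum_comm]
  refine Finset.sum_congr rfl fun t _ => ?_
  simp only [Finset.mul_sum]
  rw [Finset.sum_comm]
  refine Finset.sum_congr rfl fun a _ => ?_
  rw [Finset.sum_comm]

/-- The performance difference principle: a function that satisfies a Bellman inequality with
surplus `g` is at most the expected total surplus. -/
theorem le_sum_occ_mul {P₁ : ℕ → S₁ → A → S₁ → ℝ} {P₂ : ℕ → S₂ → B → S₂ → ℝ}
    (hP₁ : ∀ h s a s', 0 ≤ P₁ h s a s') (hP₂ : ∀ h s a s', 0 ≤ P₂ h s a s')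
    (μ : Policy S₁ A) (ν : Policy S₂ B) (s₀ : S₁ × S₂) (H : ℕ) (F g : ℕ → S₁ × S₂ → ℝ)
    (hF : ∀ h < H, ∀ s, F h s ≤ g h s + ∑ a, ∑ b, μ.prob h s.1 a * ν.prob h s.2 b *
      ∑ s' : S₁ × S₂, P₁ h s.1 a s'.1 * P₂ h s.2 b s'.2 * F (h + 1) s')
    (hH : ∀ s, F H s ≤ 0) :
    F 0 s₀ ≤ ∑ h ∈ Finset.range H, ∑ s : S₁ × S₂,
      occ P₁ μ s₀.1 h s.1 * occ P₂ ν s₀.2 h s.2 * g h s := by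
  have h1 : ∀ n ≤ H, F 0 s₀ ≤ ∑ h ∈ Finset.range n, ∑ s : S₁ × S₂,
      occ P₁ μ s₀.1 h s.1 * occ P₂ ν s₀.2 h s.2 * g h s +
      ∑ s : S₁ × S₂, occ P₁ μ s₀.1 n s.1 * occ P₂ ν s₀.2 n s.2 * F n s := by
    intro n
    induction n with
    | zero =>
      intro _
      rw [Finset.sum_eq_single s₀]
      · simp [occ]
      · intro s _ hs
        have : ¬(s.1 = s₀.1 ∧ s.2 = s₀.2) := fun h => hs (Prod.ext h.1 h.2)
        by_cases h : s.1 = s₀.1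
        · simp [occ, h, show ¬ s.2 = s₀.2 from fun h' => this ⟨h, h'⟩]
        · simp [occ, h]
      · simp
    | succ n ih =>
      intro hn
      refine (ih (by omega)).trans ?_
      rw [Finset.sum_range_succ, add_assoc, sum_occ_mul_occ_succ, ← Finset.sum_add_distrib]
      gcongr with s
      rw [← mul_add]
      exact mul_le_mul_of_nonneg_left (hF n (by omega) s)
        (mul_nonneg (occ_nonneg hP₁ _ _ _ _) (occ_nonneg hP₂ _ _ _ _))
  refine (h1 H le_rfl).trans (add_le_of_nonpos_right (Finset.sum_nonpos fun s _ => ?_))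
  exact mul_nonpos_of_nonneg_of_nonpos
    (mul_nonneg (occ_nonneg hP₁ _ _ _ _) (occ_nonneg hP₂ _ _ _ _)) (hH s)

theorem sum_mul_mul_sub_le_left {p q : S₁ → ℝ} {m : S₂ → ℝ} {V : S₁ × S₂ → ℝ} {M : ℝ}
    (hm : ∀ x, 0 ≤ m x) (hm1 : ∑ x, m x ≤ 1) (hM : 0 ≤ M) (hV : ∀ s, 0 ≤ V s) (hVM : ∀ s, V s ≤ M) :
    ∑ s : S₁ × S₂, p s.1 * m s.2 * V s ≤
      ∑ s : S₁ × S₂, q s.1 * m s.2 * V s + M * ∑ x, |p x - q x| := by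
  rw [← sub_le_iff_le_add', ← Finset.sum_sub_distrib]
  calc ∑ s : S₁ × S₂, (p s.1 * m s.2 * V s - q s.1 * m s.2 * V s)
      ≤ ∑ s : S₁ × S₂, |p s.1 - q s.1| * m s.2 * M := by
        refine Finset.sum_le_sum fun s _ => ?_
        rw [← sub_mul, ← sub_mul]
        have := hm s.2
        have := hV s
        exact mul_le_mul (mul_le_mul_of_nonneg_right (le_abs_self _) (hm _)) (hVM s) (hV s)
          (by positivity)
    _ = M * ∑ x, |p x - q x| * ∑ y, m y := by
        rw [Fintype.sum_prod_type, Finset.mul_sum]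
        refine Finset.sum_congr rfl fun x _ => ?_
        rw [Finset.mul_sum, Finset.mul_sum]
        exact Finset.sum_congr rfl fun y _ => by ring
    _ ≤ M * ∑ x, |p x - q x| := by
        gcongr with x
        exact mul_le_of_le_one_right (abs_nonneg _) hm1

theorem sum_mul_mul_sub_le_right {p q : S₂ → ℝ} {m : S₁ → ℝ} {V : S₁ × S₂ → ℝ} {M : ℝ}
    (hm : ∀ x, 0 ≤ m x) (hm1 : ∑ x, m x ≤ 1) (hM : 0 ≤ M) (hV : ∀ s, 0 ≤ V s) (hVM : ∀ s, V s ≤ M) :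
    ∑ s : S₁ × S₂, m s.1 * p s.2 * V s ≤
      ∑ s : S₁ × S₂, m s.1 * q s.2 * V s + M * ∑ x, |p x - q x| := by
  have h : ∀ f : S₂ → ℝ, ∑ s : S₁ × S₂, m s.1 * f s.2 * V s =
      ∑ s : S₂ × S₁, f s.1 * m s.2 * V s.swap := fun f =>
    Fintype.sum_equiv (Equiv.prodComm _ _) _ _ fun s => by simp [mul_comm (f s.2)]
  rw [h, h]
  exact sum_mul_mul_sub_le_left hm hm1 hM (fun s => hV _) (fun s => hVM _)

theorem sum_mul_mul_le {p : S₁ → ℝ} {q : S₂ → ℝ} {V : S₁ × S₂ → ℝ} {M : ℝ}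
    (hp : ∀ x, 0 ≤ p x) (hp1 : ∑ x, p x ≤ 1) (hq : ∀ x, 0 ≤ q x) (hq1 : ∑ x, q x ≤ 1)
    (hM : 0 ≤ M) (hVM : ∀ s, V s ≤ M) :
    ∑ s : S₁ × S₂, p s.1 * q s.2 * V s ≤ M := by
  calc ∑ s : S₁ × S₂, p s.1 * q s.2 * V s ≤ ∑ s : S₁ × S₂, p s.1 * q s.2 * M :=
        Finset.sum_le_sum fun s _ => mul_le_mul_of_nonneg_left (hVM s) (mul_nonneg (hp _) (hq _))
    _ = (∑ x, p x) * (∑ y, q y) * M := by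
        rw [← Finset.sum_mul, Fintype.sum_prod_type, Finset.sum_mul_sum]
    _ ≤ M := mul_le_of_le_one_left hM
        (mul_le_one₀ hp1 (Finset.sum_nonneg fun x _ => hq x) hq1)

theorem Policy.sum_sum_mul (μ : Policy S₁ A) (ν : Policy S₂ B) (h : ℕ) (s : S₁ × S₂) (c : ℝ) :
    ∑ a, ∑ b, μ.prob h s.1 a * ν.prob h s.2 b * c = c := by
  simp only [← Finset.sum_mul, ← Finset.mul_sum, ν.sum_eq_one, mul_one, μ.sum_eq_one, one_mul]

theorem Policy.sum_sum_mul_le (μ : Policy S₁ A) (ν : Policy S₂ B) (h : ℕ) (s : S₁ × S₂)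
    {f g : A → B → ℝ} (hfg : ∀ a b, f a b ≤ g a b) :
    ∑ a, ∑ b, μ.prob h s.1 a * ν.prob h s.2 b * f a b ≤
      ∑ a, ∑ b, μ.prob h s.1 a * ν.prob h s.2 b * g a b := by
  refine Finset.sum_le_sum fun a _ => Finset.sum_le_sum fun b _ => ?_
  exact mul_le_mul_of_nonneg_left (hfg a b) (mul_nonneg (μ.nonneg _ _ _) (ν.nonneg _ _ _))

/-- The value with `n` steps to go in the game of horizon `H` with mean rewards `r`, when the
components of the state follow the (possibly sub-stochastic) models `P₁` and `P₂`. -/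
noncomputable def modelValueAux (P₁ : ℕ → S₁ → A → S₁ → ℝ) (P₂ : ℕ → S₂ → B → S₂ → ℝ)
    (r : ℕ → S₁ × S₂ → A → B → ℝ) (H : ℕ) (μ : Policy S₁ A) (ν : Policy S₂ B) :
    ℕ → S₁ × S₂ → ℝ
  | 0, _ => 0
  | n + 1, s => ∑ a, ∑ b, μ.prob (H - (n + 1)) s.1 a * ν.prob (H - (n + 1)) s.2 b *
      (r (H - (n + 1)) s a b + ∑ s' : S₁ × S₂, P₁ (H - (n + 1)) s.1 a s'.1 *
        P₂ (H - (n + 1)) s.2 b s'.2 * modelValueAux P₁ P₂ r H μ ν n s')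

/-- The value at step `h` in the models `P₁` and `P₂`. -/
noncomputable def modelValue (P₁ : ℕ → S₁ → A → S₁ → ℝ) (P₂ : ℕ → S₂ → B → S₂ → ℝ)
    (r : ℕ → S₁ × S₂ → A → B → ℝ) (H : ℕ) (μ : Policy S₁ A) (ν : Policy S₂ B) (h : ℕ) :
    S₁ × S₂ → ℝ :=
  modelValueAux P₁ P₂ r H μ ν (H - h)

theorem modelValue_eq (P₁ : ℕ → S₁ → A → S₁ → ℝ) (P₂ : ℕ → S₂ → B → S₂ → ℝ)
    (r : ℕ → S₁ × S₂ → A → B → ℝ) {H h : ℕ} (hh : h < H) (μ : Policy S₁ A) (ν : Policy S₂ B)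
    (s : S₁ × S₂) :
    modelValue P₁ P₂ r H μ ν h s = ∑ a, ∑ b, μ.prob h s.1 a * ν.prob h s.2 b *
      (r h s a b + ∑ s' : S₁ × S₂, P₁ h s.1 a s'.1 * P₂ h s.2 b s'.2 *
        modelValue P₁ P₂ r H μ ν (h + 1) s') := by
  obtain ⟨n, rfl⟩ : ∃ n, H = h + n + 1 := ⟨H - h - 1, by omega⟩
  have e1 : h + n + 1 - h = n + 1 := by omega
  have e2 : h + n + 1 - (h + 1) = n := by omega
  have e3 : h + n + 1 - (n + 1) = h := by omega
  simp only [modelValue, e1, e2, modelValueAux, e3]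

theorem modelValue_self (P₁ : ℕ → S₁ → A → S₁ → ℝ) (P₂ : ℕ → S₂ → B → S₂ → ℝ)
    (r : ℕ → S₁ × S₂ → A → B → ℝ) (H : ℕ) (μ : Policy S₁ A) (ν : Policy S₂ B)
    (s : S₁ × S₂) : modelValue P₁ P₂ r H μ ν H s = 0 := by
  simp [modelValue, modelValueAux]

theorem modelValue_mem {P₁ : ℕ → S₁ → A → S₁ → ℝ} {P₂ : ℕ → S₂ → B → S₂ → ℝ}
    {r : ℕ → S₁ × S₂ → A → B → ℝ} (hP₁ : ∀ h s a s', 0 ≤ P₁ h s a s')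
    (hP₁' : ∀ h s a, ∑ s', P₁ h s a s' ≤ 1) (hP₂ : ∀ h s a s', 0 ≤ P₂ h s a s')
    (hP₂' : ∀ h s a, ∑ s', P₂ h s a s' ≤ 1) (hr : ∀ h s a b, 0 ≤ r h s a b)
    (hr' : ∀ h s a b, r h s a b ≤ 1) (H : ℕ) (μ : Policy S₁ A) (ν : Policy S₂ B) (h : ℕ)
    (s : S₁ × S₂) :
    modelValue P₁ P₂ r H μ ν h s ∈ Set.Icc (0 : ℝ) H := by
  have key : ∀ n : ℕ, ∀ s, modelValueAux P₁ P₂ r H μ ν n s ∈ Set.Icc (0 : ℝ) n := by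
    intro n
    induction n with
    | zero => intro s; simp [modelValueAux]
    | succ n ih =>
      intro s
      rw [modelValueAux]
      constructor
      · refine Finset.sum_nonneg fun a _ => Finset.sum_nonneg fun b _ => mul_nonneg
          (mul_nonneg (μ.nonneg _ _ _) (ν.nonneg _ _ _)) (add_nonneg (hr _ _ _ _) ?_)
        exact Finset.sum_nonneg fun s' _ => mul_nonneg (mul_nonneg (hP₁ _ _ _ _) (hP₂ _ _ _ _))
          (ih s').1
      · refine (Policy.sum_sum_mul_le μ ν _ s (g := fun _ _ => ((n + 1 : ℕ) : ℝ))
          fun a b => ?_).trans_eq (Policy.sum_sum_mul μ ν _ s _)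
        have := sum_mul_mul_le (hP₁ (H - (n + 1)) s.1 a) (hP₁' _ _ _) (hP₂ (H - (n + 1)) s.2 b)
          (hP₂' _ _ _) (Nat.cast_nonneg n) (fun s' => (ih s').2)
        have := hr' (H - (n + 1)) s a b
        push_cast
        linarith
  refine ⟨(key _ s).1, (key _ s).2.trans ?_⟩
  exact_mod_cast Nat.sub_le H h

end Occupancy

section Estimates

variable {S₁ S₂ A B : Type*}

open scoped Classical in
theorem sum_card_filter_and_eq {X Y : Type*} [Fintype Y] (s : Finset X) (P : X → Prop) (f : X → Y) :
    ∑ y, ({x ∈ s | P x ∧ f x = y}.card) = {x ∈ s | P x}.card := by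
  rw [Finset.card_eq_sum_card_fiberwise (f := f) (t := Finset.univ) (by simp)]
  simp only [Finset.filter_filter]

variable [Fintype S₁] [Fintype S₂]

theorem PlayLog.PHat₁_nonneg (D : PlayLog S₁ S₂ A B) (k h : ℕ) (s : S₁) (a : A) (s' : S₁) :
    0 ≤ D.PHat₁ k h s a s' := by
  rw [PlayLog.PHat₁]; split_ifs <;> positivity

theorem PlayLog.sum_PHat₁ (D : PlayLog S₁ S₂ A B) {k : ℕ} (hk : k ≠ 0) (h : ℕ) (s : S₁) (a : A) :
    ∑ s', D.PHat₁ k h s a s' = D.count₁ k h s a / max (D.count₁ k h s a : ℝ) 1 := by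
  classical
  simp only [PlayLog.PHat₁, if_neg hk, ← Finset.sum_div, ← Nat.cast_sum]
  congr 2
  convert sum_card_filter_and_eq (Finset.Icc 1 k) (fun t => (D.state t h).1 = s ∧ D.act₁ t h = a)
    (fun t => (D.state t (h + 1)).1) using 4
  · simp only [and_assoc]
  · rw [PlayLog.count₁]
    congr!

theorem natCast_div_max_le_one (n : ℕ) : (n : ℝ) / max (n : ℝ) 1 ≤ 1 :=
  div_le_one_of_le₀ (le_max_left _ _) (by positivity)

theorem PlayLog.sum_PHat₁_le (D : PlayLog S₁ S₂ A B) (k h : ℕ) (s : S₁) (a : A) :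
    ∑ s', D.PHat₁ k h s a s' ≤ 1 := by
  by_cases hk : k = 0
  · have : Nonempty S₁ := ⟨s⟩
    simp [PlayLog.PHat₁, hk]
  · rw [D.sum_PHat₁ hk]
    exact natCast_div_max_le_one _

variable [Fintype A] [Fintype B]

/-- The radius of the `ℓ¹` confidence set for Player 1's transition probabilities. -/
noncomputable def PlayLog.radius₁ (D : PlayLog S₁ S₂ A B) (H K : ℕ) (δ : ℝ) (k h : ℕ) (s : S₁)
    (a : A) : ℝ :=
  √(2 * Fintype.card S₁ * Real.log (2 * Fintype.card S₁ * Fintype.card A * H * K / δ) /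
    max (D.count₁ k h s a : ℝ) 1)

/-- The radius of the `ℓ¹` confidence set for Player 2's transition probabilities. -/
noncomputable def PlayLog.radius₂ (D : PlayLog S₁ S₂ A B) (H K : ℕ) (δ : ℝ) (k h : ℕ) (s : S₂)
    (b : B) : ℝ :=
  √(2 * Fintype.card S₂ * Real.log (2 * Fintype.card S₂ * Fintype.card B * H * K / δ) /
    max (D.count₂ k h s b : ℝ) 1)

theorem sqrt_two_mul_sq_mul_div (H n l m : ℝ) (hH : 0 ≤ H) :
    √(2 * H ^ 2 * n * l / m) = H * √(2 * n * l / m) := by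
  rw [show 2 * H ^ 2 * n * l / m = H ^ 2 * (2 * n * l / m) by ring,
    Real.sqrt_mul (by positivity), Real.sqrt_sq hH]

theorem PlayLog.bonusP_eq (D : PlayLog S₁ S₂ A B) (H K : ℕ) (δ : ℝ) (k h : ℕ) (s : S₁ × S₂) (a : A)
    (b : B) :
    D.bonusP H K δ k h s a b = H * D.radius₁ H K δ k h s.1 a + H * D.radius₂ H K δ k h s.2 b := by
  rw [PlayLog.bonusP, sqrt_two_mul_sq_mul_div _ _ _ _ (Nat.cast_nonneg H),
    sqrt_two_mul_sq_mul_div _ _ _ _ (Nat.cast_nonneg H)]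
  rfl

theorem PlayLog.vLow_self (D : PlayLog S₁ S₂ A B) (H K : ℕ) (δ : ℝ) (μ : Policy S₁ A)
    (ν : Policy S₂ B) (k : ℕ) (s : S₁ × S₂) : D.vLow H K δ μ ν k H s = 0 := by
  simp [PlayLog.vLow, PlayLog.vLowAux]

theorem PlayLog.vLow_eq (D : PlayLog S₁ S₂ A B) {H h : ℕ} (hh : h < H) (K : ℕ) (δ : ℝ)
    (μ : Policy S₁ A) (ν : Policy S₂ B) (k : ℕ) (s : S₁ × S₂) :
    D.vLow H K δ μ ν k h s = ∑ a, ∑ b, μ.prob h s.1 a * ν.prob h s.2 b *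
      D.qLow H K δ μ ν k h s a b := by
  obtain ⟨n, rfl⟩ : ∃ n, H = h + n + 1 := ⟨H - h - 1, by omega⟩
  have e1 : h + n + 1 - h = n + 1 := by omega
  have e2 : h + n + 1 - (h + 1) = n := by omega
  have e3 : h + n + 1 - (n + 1) = h := by omega
  simp only [PlayLog.qLow, PlayLog.vLow, e1, e2, PlayLog.vLowAux]
  simp only [e3]
  exact Finset.sum_congr rfl fun a _ => Finset.sum_congr rfl fun b _ => by ring

theorem PlayLog.qLow_nonneg (D : PlayLog S₁ S₂ A B) (H K : ℕ) (δ : ℝ)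
    (μ : Policy S₁ A) (ν : Policy S₂ B) (k h : ℕ) (s : S₁ × S₂) (a : A) (b : B) :
    0 ≤ D.qLow H K δ μ ν k h s a b := le_max_right _ _

theorem PlayLog.qLow_le (D : PlayLog S₁ S₂ A B) {H h : ℕ} (hh : h ≤ H) (K : ℕ) (δ : ℝ)
    (μ : Policy S₁ A) (ν : Policy S₂ B) (k : ℕ) (s : S₁ × S₂) (a : A) (b : B) :
    D.qLow H K δ μ ν k h s a b ≤ (H : ℝ) - h := by
  have : (h : ℝ) ≤ H := by exact_mod_cast hh
  exact max_le (min_le_right _ _) (by linarith)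

theorem PlayLog.vLow_nonneg (D : PlayLog S₁ S₂ A B) {H h : ℕ} (hh : h ≤ H) (K : ℕ) (δ : ℝ)
    (μ : Policy S₁ A) (ν : Policy S₂ B) (k : ℕ) (s : S₁ × S₂) :
    0 ≤ D.vLow H K δ μ ν k h s := by
  rcases hh.eq_or_lt with rfl | hh
  · rw [D.vLow_self]
  · rw [D.vLow_eq hh]
    exact Finset.sum_nonneg fun a _ => Finset.sum_nonneg fun b _ =>
      mul_nonneg (mul_nonneg (μ.nonneg _ _ _) (ν.nonneg _ _ _)) (D.qLow_nonneg _ _ _ _ _ _ _ _ _ _)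

theorem PlayLog.vLow_le (D : PlayLog S₁ S₂ A B) {H h : ℕ} (hh : h ≤ H) (K : ℕ) (δ : ℝ)
    (μ : Policy S₁ A) (ν : Policy S₂ B) (k : ℕ) (s : S₁ × S₂) :
    D.vLow H K δ μ ν k h s ≤ (H : ℝ) - h := by
  rcases hh.eq_or_lt with rfl | hh
  · rw [D.vLow_self]; simp
  · rw [D.vLow_eq hh]
    exact (Policy.sum_sum_mul_le μ ν h s fun a b => D.qLow_le hh.le K δ μ ν k s a b).trans_eq
      (Policy.sum_sum_mul μ ν h s _)

theorem PlayLog.reach₁_eq_occ (D : PlayLog S₁ S₂ A B) (s₀ : S₁) (μ : Policy S₁ A) (k h : ℕ) :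
    D.reach₁ s₀ μ k h = occ (D.PHat₁ k) μ s₀ h := by
  induction h with
  | zero => rfl
  | succ h ih => funext s; simp only [PlayLog.reach₁, occ, ih]

/-- The estimates after `k` episodes lie in the confidence sets that the bonus encodes. -/
structure Game.EstimatesOK (G : Game S₁ S₂ A B) (D : PlayLog S₁ S₂ A B) (H K : ℕ) (δ : ℝ)
    (k : ℕ) : Prop where
  reward : ∀ h < H, ∀ s a b, |D.rHat k h s a b - G.r h s a b| ≤ D.bonusR H K δ k h s a b
  trans₁ : ∀ h < H, ∀ s a, ∑ s', |D.PHat₁ k h s a s' - G.P₁.prob h s a s'| ≤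
    D.radius₁ H K δ k h s a
  trans₂ : ∀ h < H, ∀ s b, ∑ s', |D.PHat₂ k h s b s' - G.P₂.prob h s b s'| ≤
    D.radius₂ H K δ k h s b

variable {G : Game S₁ S₂ A B} {D : PlayLog S₁ S₂ A B} {H K k : ℕ} {δ : ℝ}

/-- Optimism in the model that combines the estimated transition of Player 1 with the true
transition of Player 2: the bonus is large enough already for the other estimates. -/
theorem Game.EstimatesOK.qLow_le (hG : G.EstimatesOK D H K δ k) (hk : k ≠ 0) {h : ℕ} (hh : h < H)
    (μ : Policy S₁ A) (ν : Policy S₂ B) (s : S₁ × S₂) (a : A) (b : B) :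
    D.qLow H K δ μ ν k h s a b ≤ G.r h s a b + ∑ s' : S₁ × S₂, D.PHat₁ k h s.1 a s'.1 *
      G.P₂.prob h s.2 b s'.2 * D.vLow H K δ μ ν k (h + 1) s' := by
  have hV0 := fun s => D.vLow_nonneg (show h + 1 ≤ H from hh) K δ μ ν k s
  refine max_le ((min_le_left _ _).trans ?_) (add_nonneg (G.r_nonneg _ _ _ _)
    (Finset.sum_nonneg fun s' _ => mul_nonneg (mul_nonneg (D.PHat₁_nonneg _ _ _ _ _)
      (G.P₂.nonneg _ _ _ _)) (hV0 s')))
  have hV1 : ∀ s, D.vLow H K δ μ ν k (h + 1) s ≤ H := fun s =>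
    (D.vLow_le (show h + 1 ≤ H from hh) K δ μ ν k s).trans (sub_le_self _ (Nat.cast_nonneg _))
  have h1 := sum_mul_mul_sub_le_right (p := D.PHat₂ k h s.2 b) (q := G.P₂.prob h s.2 b)
    (D.PHat₁_nonneg k h s.1 a) (D.sum_PHat₁_le k h s.1 a) (Nat.cast_nonneg H) hV0 hV1
  have h2 := mul_le_mul_of_nonneg_left (hG.trans₂ h hh s.2 b) (Nat.cast_nonneg (α := ℝ) H)
  have h3 := (abs_le.1 (hG.reward h hh s a b)).2
  have h4 : (0 : ℝ) ≤ H * D.radius₁ H K δ k h s.1 a :=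
    mul_nonneg (Nat.cast_nonneg _) (Real.sqrt_nonneg _)
  rw [PlayLog.bonus, if_neg hk, PlayLog.bonusP_eq]
  linarith

/-- The estimates miss a Bellman backup by at most twice the bonus. Where the estimate is truncated
at the number of remaining steps, the backup is not larger than that number. -/
theorem Game.EstimatesOK.le_qLow_add (hG : G.EstimatesOK D H K δ k) (hk : k ≠ 0) {h : ℕ}
    (hh : h < H) (μ : Policy S₁ A) (ν : Policy S₂ B) (s : S₁ × S₂) (a : A) (b : B) :
    G.r h s a b + ∑ s' : S₁ × S₂, G.P₁.prob h s.1 a s'.1 *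
      G.P₂.prob h s.2 b s'.2 * D.vLow H K δ μ ν k (h + 1) s' ≤
      D.qLow H K δ μ ν k h s a b + 2 * D.bonus H K δ k h s a b := by
  have hV0 := fun s => D.vLow_nonneg (show h + 1 ≤ H from hh) K δ μ ν k s
  have hV1' := fun s => D.vLow_le (show h + 1 ≤ H from hh) K δ μ ν k s
  have hV1 : ∀ s, D.vLow H K δ μ ν k (h + 1) s ≤ H := fun s =>
    (hV1' s).trans (sub_le_self _ (Nat.cast_nonneg _))
  have hb : 0 ≤ D.bonusR H K δ k h s a b := Real.sqrt_nonneg _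
  have hr1 : 0 ≤ D.radius₁ H K δ k h s.1 a := Real.sqrt_nonneg _
  have hr2 : 0 ≤ D.radius₂ H K δ k h s.2 b := Real.sqrt_nonneg _
  have h1 := sum_mul_mul_sub_le_right (p := G.P₂.prob h s.2 b) (q := D.PHat₂ k h s.2 b)
    (D.PHat₁_nonneg k h s.1 a) (D.sum_PHat₁_le k h s.1 a) (Nat.cast_nonneg H) hV0 hV1
  have h1' := sum_mul_mul_sub_le_left (p := G.P₁.prob h s.1 a) (q := D.PHat₁ k h s.1 a)
    (G.P₂.nonneg h s.2 b) (G.P₂.sum_eq_one h s.2 b).le (Nat.cast_nonneg H) hV0 hV1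
  simp only [abs_sub_comm (G.P₂.prob _ _ _ _)] at h1
  simp only [abs_sub_comm (G.P₁.prob _ _ _ _)] at h1'
  have h2 := mul_le_mul_of_nonneg_left (hG.trans₂ h hh s.2 b) (Nat.cast_nonneg (α := ℝ) H)
  have h2' := mul_le_mul_of_nonneg_left (hG.trans₁ h hh s.1 a) (Nat.cast_nonneg (α := ℝ) H)
  have h3 := (abs_le.1 (hG.reward h hh s a b)).1
  rw [← sub_le_iff_le_add]
  have hbon : 0 ≤ D.bonus H K δ k h s a b := by
    rw [PlayLog.bonus, if_neg hk, PlayLog.bonusP_eq]; positivity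
  refine le_trans (le_min ?_ ?_) (le_max_left _ _)
  · rw [PlayLog.bonus, if_neg hk, PlayLog.bonusP_eq]
    linarith
  · have h5 : (h : ℝ) + 1 ≤ H := by exact_mod_cast hh
    have h6 := sum_mul_mul_le (M := (H : ℝ) - (h + 1 : ℕ)) (G.P₁.nonneg h s.1 a)
      (G.P₁.sum_eq_one h s.1 a).le (G.P₂.nonneg h s.2 b) (G.P₂.sum_eq_one h s.2 b).le
      (by push_cast; linarith) hV1'
    have h7 := G.r_le_one h s a b
    push_cast at h6
    linarith

/-- The expectation of a function of the states and actions at step `h` when the game `G` is played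
with the policies `μ` and `ν`. -/
noncomputable def Game.expect (G : Game S₁ S₂ A B) (μ : Policy S₁ A) (ν : Policy S₂ B) (h : ℕ)
    (f : S₁ × S₂ → A → B → ℝ) : ℝ :=
  ∑ s : S₁ × S₂, occ G.P₁.prob μ G.init.1 h s.1 * occ G.P₂.prob ν G.init.2 h s.2 *
    ∑ a, ∑ b, μ.prob h s.1 a * ν.prob h s.2 b * f s a b

theorem Game.expect_mono (G : Game S₁ S₂ A B) (μ : Policy S₁ A) (ν : Policy S₂ B) (h : ℕ)
    {f g : S₁ × S₂ → A → B → ℝ} (hfg : ∀ s a b, f s a b ≤ g s a b) :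
    G.expect μ ν h f ≤ G.expect μ ν h g :=
  Finset.sum_le_sum fun s _ => mul_le_mul_of_nonneg_left
    (Policy.sum_sum_mul_le μ ν h s (hfg s))
    (mul_nonneg (occ_nonneg G.P₁.nonneg _ _ _ _) (occ_nonneg G.P₂.nonneg _ _ _ _))

theorem Game.expect_add (G : Game S₁ S₂ A B) (μ : Policy S₁ A) (ν : Policy S₂ B) (h : ℕ)
    (f g : S₁ × S₂ → A → B → ℝ) :
    G.expect μ ν h (fun s a b => f s a b + g s a b) = G.expect μ ν h f + G.expect μ ν h g := by
  simp only [Game.expect, mul_add, Finset.sum_add_distrib]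

theorem Game.expect_const_mul (G : Game S₁ S₂ A B) (μ : Policy S₁ A) (ν : Policy S₂ B) (h : ℕ)
    (c : ℝ) (f : S₁ × S₂ → A → B → ℝ) :
    G.expect μ ν h (fun s a b => c * f s a b) = c * G.expect μ ν h f := by
  simp only [Game.expect, Finset.mul_sum]
  refine Finset.sum_congr rfl fun s _ => Finset.sum_congr rfl fun a _ =>
    Finset.sum_congr rfl fun b _ => by ring

/-- The law of Player 1's state and action does not depend on Player 2. -/
theorem Game.expect_fst (G : Game S₁ S₂ A B) (μ : Policy S₁ A) (ν : Policy S₂ B) (h : ℕ)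
    (f : S₁ → A → ℝ) :
    G.expect μ ν h (fun s a _ => f s.1 a) =
      ∑ s, occ G.P₁.prob μ G.init.1 h s * ∑ a, μ.prob h s a * f s a := by
  rw [Game.expect, Fintype.sum_prod_type]
  refine Finset.sum_congr rfl fun s _ => ?_
  have : ∀ t : S₂, ∑ a, ∑ b, μ.prob h s a * ν.prob h t b * f s a = ∑ a, μ.prob h s a * f s a := by
    intro t
    refine Finset.sum_congr rfl fun a _ => ?_
    rw [← Finset.sum_mul, ← Finset.mul_sum, ν.sum_eq_one, mul_one]
  simp only [this]
  rw [← Finset.sum_mul, ← Finset.mul_sum, sum_occ_eq_one, mul_one]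

theorem Game.EstimatesOK.value_sub_vLow_le (hG : G.EstimatesOK D H K δ k) (hk : k ≠ 0)
    (μ : Policy S₁ A) (ν : Policy S₂ B) :
    G.value H μ ν 0 G.init - D.vLow H K δ μ ν k 0 G.init ≤
      ∑ h ∈ Finset.range H, G.expect μ ν h (fun s a b => 2 * D.bonus H K δ k h s a b) := by
  refine le_sum_occ_mul G.P₁.nonneg G.P₂.nonneg μ ν G.init H
    (fun h s => G.value H μ ν h s - D.vLow H K δ μ ν k h s)
    (fun h s => ∑ a, ∑ b, μ.prob h s.1 a * ν.prob h s.2 b * (2 * D.bonus H K δ k h s a b))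
    (fun h hh s => ?_) (fun s => by rw [G.value_self, D.vLow_self, sub_self])
  rw [G.value_eq hh, D.vLow_eq hh, sub_le_iff_le_add, ← Finset.sum_add_distrib,
    ← Finset.sum_add_distrib]
  simp only [← Finset.sum_add_distrib, ← mul_add]
  refine Policy.sum_sum_mul_le μ ν h s fun a b => ?_
  have := hG.le_qLow_add hk hh μ ν s a b
  simp only [mul_sub, Finset.sum_sub_distrib]
  simp only [Game.trans]
  linarith

/-- Replacing Player 1's transition by its estimate changes the value by at most the accumulated
estimation error along Player 1's true trajectory. -/
theorem Game.EstimatesOK.modelValue_sub_value_le (hG : G.EstimatesOK D H K δ k)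
    (μ : Policy S₁ A) (ν ν' : Policy S₂ B) :
    modelValue (D.PHat₁ k) G.P₂.prob G.r H μ ν' 0 G.init - G.value H μ ν' 0 G.init ≤
      ∑ h ∈ Finset.range H,
        G.expect μ ν h (fun s a _ => H * D.radius₁ H K δ k h s.1 a) := by
  -- the error only involves Player 1, so that `ν'` may be exchanged for `ν`
  have e : ∀ h, G.expect μ ν h (fun s a _ => H * D.radius₁ H K δ k h s.1 a) =
      G.expect μ ν' h (fun s a _ => H * D.radius₁ H K δ k h s.1 a) := fun h => by
    rw [G.expect_fst μ ν h (fun s a => H * D.radius₁ H K δ k h s a),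
      G.expect_fst μ ν' h (fun s a => H * D.radius₁ H K δ k h s a)]
  simp only [e]
  refine le_sum_occ_mul G.P₁.nonneg G.P₂.nonneg μ ν' G.init H
    (fun h s => modelValue (D.PHat₁ k) G.P₂.prob G.r H μ ν' h s - G.value H μ ν' h s)
    (fun h s => ∑ a, ∑ b, μ.prob h s.1 a * ν'.prob h s.2 b * (H * D.radius₁ H K δ k h s.1 a))
    (fun h hh s => ?_) (fun s => by rw [G.value_self, modelValue_self, sub_self])
  rw [G.value_eq hh, modelValue_eq _ _ _ hh, sub_le_iff_le_add, ← Finset.sum_add_distrib,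
    ← Finset.sum_add_distrib]
  simp only [← Finset.sum_add_distrib, ← mul_add]
  refine Policy.sum_sum_mul_le μ ν' h s fun a b => ?_
  have hV := fun s' => modelValue_mem (D.PHat₁_nonneg k) (D.sum_PHat₁_le k) G.P₂.nonneg
    (fun h s a => (G.P₂.sum_eq_one h s a).le) G.r_nonneg G.r_le_one H μ ν' (h + 1) s'
  have h1 := sum_mul_mul_sub_le_left (p := D.PHat₁ k h s.1 a) (q := G.P₁.prob h s.1 a)
    (G.P₂.nonneg h s.2 b) (G.P₂.sum_eq_one h s.2 b).le (Nat.cast_nonneg H)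
    (fun s' => (hV s').1) (fun s' => (hV s').2)
  have h2 := mul_le_mul_of_nonneg_left (hG.trans₁ h hh s.1 a) (Nat.cast_nonneg (α := ℝ) H)
  simp only [mul_sub, Finset.sum_sub_distrib]
  simp only [Game.trans]
  linarith

/-- In the model with Player 1's estimated transition, the comparison of the estimated value with
the value of another policy of Player 2 is the linear regret against the losses of the algorithm. -/
theorem Game.EstimatesOK.vLow_sub_modelValue_le (hG : G.EstimatesOK D H K δ k) (hk : k ≠ 0)
    (μ : Policy S₁ A) (ν ν' : Policy S₂ B) :
    D.vLow H K δ μ ν k 0 G.init - modelValue (D.PHat₁ k) G.P₂.prob G.r H μ ν' 0 G.init ≤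
      ∑ h ∈ Finset.range H, ∑ s₂, occ G.P₂.prob ν' G.init.2 h s₂ *
        ∑ b, (ν.prob h s₂ b - ν'.prob h s₂ b) * D.loss₂ H K δ G.init.1 μ ν k h s₂ b := by
  have e : ∀ h, ∑ s₂, occ G.P₂.prob ν' G.init.2 h s₂ *
        ∑ b, (ν.prob h s₂ b - ν'.prob h s₂ b) * D.loss₂ H K δ G.init.1 μ ν k h s₂ b =
      ∑ s : S₁ × S₂, occ (D.PHat₁ k) μ G.init.1 h s.1 * occ G.P₂.prob ν' G.init.2 h s.2 *
        ∑ a, ∑ b, μ.prob h s.1 a * (ν.prob h s.2 b - ν'.prob h s.2 b) *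
          D.qLow H K δ μ ν k h s a b := by
    intro h
    rw [Fintype.sum_prod_type_right]
    refine Finset.sum_congr rfl fun s₂ _ => ?_
    simp only [PlayLog.loss₂, PlayLog.reach₁_eq_occ, Finset.mul_sum, Finset.sum_mul]
    rw [Finset.sum_comm]
    refine Finset.sum_congr rfl fun s₁ _ => ?_
    rw [Finset.sum_comm]
    exact Finset.sum_congr rfl fun a _ => Finset.sum_congr rfl fun b _ => by ring
  simp only [e]
  refine le_sum_occ_mul (D.PHat₁_nonneg k) G.P₂.nonneg μ ν' G.init H
    (fun h s => D.vLow H K δ μ ν k h s - modelValue (D.PHat₁ k) G.P₂.prob G.r H μ ν' h s)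
    (fun h s => ∑ a, ∑ b, μ.prob h s.1 a * (ν.prob h s.2 b - ν'.prob h s.2 b) *
          D.qLow H K δ μ ν k h s a b)
    (fun h hh s => ?_) (fun s => by rw [D.vLow_self, modelValue_self, sub_self])
  rw [D.vLow_eq hh, modelValue_eq _ _ _ hh, sub_le_iff_le_add]
  simp only [← Finset.sum_add_distrib]
  refine Finset.sum_le_sum fun a _ => Finset.sum_le_sum fun b _ => ?_
  have h1 := mul_le_mul_of_nonneg_left (hG.qLow_le hk hh μ ν s a b)
    (mul_nonneg (μ.nonneg h s.1 a) (ν'.nonneg h s.2 b))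
  simp only [mul_sub, Finset.sum_sub_distrib]
  linarith

/-- The regret of one episode. -/
theorem Game.EstimatesOK.value_sub_value_le (hG : G.EstimatesOK D H K δ k) (hk : k ≠ 0)
    (μ : Policy S₁ A) (ν ν' : Policy S₂ B) :
    G.value H μ ν 0 G.init - G.value H μ ν' 0 G.init ≤
      ∑ h ∈ Finset.range H, G.expect μ ν h (fun s a b => 2 * D.bonusR H K δ k h s a b +
        (3 * H * D.radius₁ H K δ k h s.1 a + 2 * H * D.radius₂ H K δ k h s.2 b)) +
      ∑ h ∈ Finset.range H, ∑ s₂, occ G.P₂.prob ν' G.init.2 h s₂ *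
        ∑ b, (ν.prob h s₂ b - ν'.prob h s₂ b) * D.loss₂ H K δ G.init.1 μ ν k h s₂ b := by
  have h1 := hG.value_sub_vLow_le hk μ ν
  have h2 := hG.modelValue_sub_value_le μ ν ν'
  have h3 := hG.vLow_sub_modelValue_le hk μ ν ν'
  have e : ∀ h, G.expect μ ν h (fun s a b => 2 * D.bonusR H K δ k h s a b +
        (3 * H * D.radius₁ H K δ k h s.1 a + 2 * H * D.radius₂ H K δ k h s.2 b)) =
      G.expect μ ν h (fun s a b => 2 * D.bonus H K δ k h s a b) +
      G.expect μ ν h (fun s a _ => H * D.radius₁ H K δ k h s.1 a) := by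
    intro h
    rw [← G.expect_add]
    congr 1
    funext s a b
    rw [PlayLog.bonus, if_neg hk, PlayLog.bonusP_eq]
    ring
  simp only [e, Finset.sum_add_distrib]
  linarith

theorem PlayLog.loss₂_nonneg (D : PlayLog S₁ S₂ A B) (H K : ℕ) (δ : ℝ) (s₀ : S₁)
    (μ : Policy S₁ A) (ν : Policy S₂ B) (k h : ℕ) (s₂ : S₂) (b : B) :
    0 ≤ D.loss₂ H K δ s₀ μ ν k h s₂ b := by
  refine Finset.sum_nonneg fun s _ => mul_nonneg (Finset.sum_nonneg fun a _ =>
    mul_nonneg (D.qLow_nonneg _ _ _ _ _ _ _ _ _ _) (μ.nonneg _ _ _)) ?_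
  rw [D.reach₁_eq_occ]
  exact occ_nonneg (D.PHat₁_nonneg k) _ _ _ _

theorem PlayLog.loss₂_le (D : PlayLog S₁ S₂ A B) {H h : ℕ} (hh : h ≤ H) (K : ℕ) (δ : ℝ) (s₀ : S₁)
    (μ : Policy S₁ A) (ν : Policy S₂ B) (k : ℕ) (s₂ : S₂) (b : B) :
    D.loss₂ H K δ s₀ μ ν k h s₂ b ≤ H := by
  calc D.loss₂ H K δ s₀ μ ν k h s₂ b
      ≤ ∑ s, (∑ a, (H : ℝ) * μ.prob h s a) * D.reach₁ s₀ μ k h s := by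
        refine Finset.sum_le_sum fun s _ => mul_le_mul_of_nonneg_right (Finset.sum_le_sum fun a _ =>
          mul_le_mul_of_nonneg_right ((D.qLow_le hh K δ μ ν k _ a b).trans
            (sub_le_self _ (Nat.cast_nonneg _))) (μ.nonneg _ _ _)) ?_
        rw [D.reach₁_eq_occ]
        exact occ_nonneg (D.PHat₁_nonneg k) _ _ _ _
    _ = H * ∑ s, D.reach₁ s₀ μ k h s := by
        simp only [← Finset.mul_sum, μ.sum_eq_one, mul_one]
    _ ≤ H := by
        rw [D.reach₁_eq_occ]
        exact mul_le_of_le_one_right (Nat.cast_nonneg _)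
          (sum_occ_le_one (D.PHat₁_nonneg k) (D.sum_PHat₁_le k) _ _ _)

/-- Without data the estimated action values vanish, so that the first step of the algorithm does
not move the policy. -/
theorem PlayLog.loss₂_zero (D : PlayLog S₁ S₂ A B) {H h : ℕ} (hh : h < H) (K : ℕ) (δ : ℝ) (s₀ : S₁)
    (μ : Policy S₁ A) (ν : Policy S₂ B) (s₂ : S₂) (b : B) :
    D.loss₂ H K δ s₀ μ ν 0 h s₂ b = 0 := by
  have hv : ∀ h ≤ H, ∀ s, D.vLow H K δ μ ν 0 h s = 0 := by
    intro h hh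
    induction hh using Nat.decreasingInduction with
    | self => exact fun s => D.vLow_self ..
    | of_succ h hh ih =>
      intro s
      rw [D.vLow_eq hh]
      have h1 : (0 : ℝ) ≤ H - h := sub_nonneg.2 (by exact_mod_cast hh.le)
      simp [PlayLog.qLow, PlayLog.backup, PlayLog.bonus, PlayLog.rHat, ih, h1]
  have h1 : (0 : ℝ) ≤ H - h := sub_nonneg.2 (by exact_mod_cast hh.le)
  simp [PlayLog.loss₂, PlayLog.qLow, PlayLog.backup, PlayLog.bonus, PlayLog.rHat, hv (h + 1) hh, h1]

end Estimates

/-! ### Concentration for bounded observations of a process -/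

section Concentration

variable {Ω : Type*} {mΩ : MeasurableSpace Ω} {Pr : Measure Ω} [IsProbabilityMeasure Pr]

theorem integrable_of_measurable_of_abs_le {f : Ω → ℝ} (hf : Measurable f)
    (hb : ∃ C, ∀ ω, |f ω| ≤ C) : Integrable f Pr := by
  obtain ⟨C, hC⟩ := hb
  exact Integrable.of_bound hf.aestronglyMeasurable C (Filter.Eventually.of_forall hC)

theorem exists_abs_mul_le {f g : Ω → ℝ} (hf : ∃ C, ∀ ω, |f ω| ≤ C) (hg : ∃ C, ∀ ω, |g ω| ≤ C) :
    ∃ C, ∀ ω, |f ω * g ω| ≤ C := by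
  obtain ⟨C, hC⟩ := hf
  obtain ⟨E, hE⟩ := hg
  refine ⟨C * E, fun ω => ?_⟩
  rw [abs_mul]
  exact mul_le_mul (hC ω) (hE ω) (abs_nonneg _) ((abs_nonneg _).trans (hC ω))

theorem exists_abs_le_of_mem_Icc {f : Ω → ℝ} (hf : ∀ ω, f ω ∈ Set.Icc (0 : ℝ) 1) :
    ∃ C, ∀ ω, |f ω| ≤ C :=
  ⟨1, fun ω => abs_le.2 ⟨by linarith [(hf ω).1], (hf ω).2⟩⟩

theorem integral_mul_eq_of_condExp {m : MeasurableSpace Ω} (hm : m ≤ mΩ) {W f g : Ω → ℝ}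
    (hW : Measurable[m] W) (hWb : ∃ C, ∀ ω, |W ω| ≤ C) (hf : Integrable f Pr)
    (h : Pr[f | m] =ᵐ[Pr] g) : ∫ ω, W ω * f ω ∂Pr = ∫ ω, W ω * g ω ∂Pr := by
  obtain ⟨C, hC⟩ := hWb
  calc ∫ ω, W ω * f ω ∂Pr = ∫ ω, (Pr[W * f | m]) ω ∂Pr := (integral_condExp hm).symm
    _ = ∫ ω, W ω * g ω ∂Pr := integral_congr_ae <|
        (condExp_stronglyMeasurable_mul_of_bound hm hW.stronglyMeasurable hf C
          (Filter.Eventually.of_forall hC)).trans (Filter.EventuallyEq.rfl.mul h)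

/-- A process `X` with values in `[0, 1]`, observed at the times `k` with `I k = 1`, that has mean
`m k` given the past when it is observed. -/
structure ObservedMean (Pr : Measure Ω) (𝓕 : Filtration ℕ mΩ) (K : ℕ) (I X m : ℕ → Ω → ℝ) :
    Prop where
  zero_or_one : ∀ k ∈ Finset.Icc 1 K, ∀ ω, I k ω = 0 ∨ I k ω = 1
  mem_Icc : ∀ k ∈ Finset.Icc 1 K, ∀ ω, X k ω ∈ Set.Icc (0 : ℝ) 1
  mean_mem_Icc : ∀ k ∈ Finset.Icc 1 K, ∀ ω, m k ω ∈ Set.Icc (0 : ℝ) 1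
  measurable_ind : ∀ k ∈ Finset.Icc 1 K, Measurable[𝓕 k] (I k)
  measurable_val : ∀ k ∈ Finset.Icc 1 K, Measurable[𝓕 k] (X k)
  measurable_mean : ∀ k ∈ Finset.Icc 1 K, Measurable[𝓕 (k - 1)] (m k)
  integral_eq : ∀ k ∈ Finset.Icc 1 K, ∀ W : Ω → ℝ, Measurable[𝓕 (k - 1)] W →
    (∃ C, ∀ ω, |W ω| ≤ C) → ∫ ω, W ω * (I k ω * X k ω) ∂Pr = ∫ ω, W ω * (I k ω * m k ω) ∂Pr

variable {𝓕 : Filtration ℕ mΩ} {K : ℕ} {I X m : ℕ → Ω → ℝ}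

theorem ObservedMean.one_sub (h : ObservedMean Pr 𝓕 K I X m) :
    ObservedMean Pr 𝓕 K I (fun k ω => 1 - X k ω) (fun k ω => 1 - m k ω) where
  zero_or_one := h.zero_or_one
  mem_Icc k hk ω := ⟨by linarith [(h.mem_Icc k hk ω).2], by linarith [(h.mem_Icc k hk ω).1]⟩
  mean_mem_Icc k hk ω :=
    ⟨by linarith [(h.mean_mem_Icc k hk ω).2], by linarith [(h.mean_mem_Icc k hk ω).1]⟩
  measurable_ind := h.measurable_ind
  measurable_val k hk := (h.measurable_val k hk).const_sub 1
  measurable_mean k hk := (h.measurable_mean k hk).const_sub 1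
  integral_eq k hk W hW hWb := by
    have hI : ∀ ω, I k ω ∈ Set.Icc (0 : ℝ) 1 := fun ω => by
      rcases h.zero_or_one k hk ω with h | h <;> simp [h]
    have hIm := (h.measurable_ind k hk).mono (𝓕.le k) le_rfl
    have hXm := (h.measurable_val k hk).mono (𝓕.le k) le_rfl
    have hmm := (h.measurable_mean k hk).mono (𝓕.le (k - 1)) le_rfl
    have hWm := hW.mono (𝓕.le (k - 1)) le_rfl
    have hIb := exists_abs_le_of_mem_Icc hI
    have i1 : Integrable (fun ω => W ω * I k ω) Pr :=
      integrable_of_measurable_of_abs_le (hWm.mul hIm) (exists_abs_mul_le hWb hIb)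
    have i2 : Integrable (fun ω => W ω * (I k ω * X k ω)) Pr :=
      integrable_of_measurable_of_abs_le (hWm.mul (hIm.mul hXm))
        (exists_abs_mul_le hWb (exists_abs_mul_le hIb (exists_abs_le_of_mem_Icc (h.mem_Icc k hk))))
    have i3 : Integrable (fun ω => W ω * (I k ω * m k ω)) Pr :=
      integrable_of_measurable_of_abs_le (hWm.mul (hIm.mul hmm)) (exists_abs_mul_le hWb
        (exists_abs_mul_le hIb (exists_abs_le_of_mem_Icc (h.mean_mem_Icc k hk))))
    simp only [mul_sub, mul_one]
    rw [integral_sub i1 i2, integral_sub i1 i3, h.integral_eq k hk W hW hWb]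

theorem ObservedMean.measurable_exp (h : ObservedMean Pr 𝓕 K I X m) (t : ℝ) {n : ℕ}
    (hn : n ≤ K) : Measurable[𝓕 n] fun ω =>
      Real.exp (∑ k ∈ Finset.Icc 1 n, I k ω * (t * (X k ω - m k ω) - t ^ 2 / 8)) := by
  refine Real.measurable_exp.comp (Finset.measurable_sum _ fun k hk => ?_)
  have hk' : k ∈ Finset.Icc 1 K := by simp only [Finset.mem_Icc] at hk ⊢; omega
  have hkn : 𝓕 k ≤ 𝓕 n := 𝓕.mono (Finset.mem_Icc.1 hk).2
  have h1 := (h.measurable_ind k hk').mono hkn le_rfl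
  have h2 := (h.measurable_val k hk').mono hkn le_rfl
  have h3 := (h.measurable_mean k hk').mono ((𝓕.mono (Nat.sub_le k 1)).trans hkn) le_rfl
  exact h1.mul (((h2.sub h3).const_mul t).sub_const _)

theorem ObservedMean.exists_abs_exp_le (h : ObservedMean Pr 𝓕 K I X m) (t : ℝ) {n : ℕ}
    (hn : n ≤ K) : ∃ C, ∀ ω,
      |Real.exp (∑ k ∈ Finset.Icc 1 n, I k ω * (t * (X k ω - m k ω) - t ^ 2 / 8))| ≤ C := by
  refine ⟨Real.exp (∑ k ∈ Finset.Icc 1 n, |t|), fun ω => ?_⟩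
  rw [abs_of_pos (Real.exp_pos _)]
  refine Real.exp_le_exp.2 (Finset.sum_le_sum fun k hk => ?_)
  have hk' : k ∈ Finset.Icc 1 K := by simp only [Finset.mem_Icc] at hk ⊢; omega
  have h2 := h.mem_Icc k hk' ω
  have h3 := h.mean_mem_Icc k hk' ω
  have h4 : t * (X k ω - m k ω) ≤ |t| := by
    refine (le_abs_self _).trans ?_
    rw [abs_mul]
    exact mul_le_of_le_one_right (abs_nonneg _)
      (abs_le.2 ⟨by linarith [h2.1, h3.2], by linarith [h2.2, h3.1]⟩)
  rcases h.zero_or_one k hk' ω with h1 | h1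
  · simp [h1]
  · rw [h1]; nlinarith [sq_nonneg t]

/-- The exponential supermartingale behind the Azuma–Hoeffding inequality. -/
theorem ObservedMean.integral_exp_le_one (h : ObservedMean Pr 𝓕 K I X m) (t : ℝ) {n : ℕ}
    (hn : n ≤ K) :
    ∫ ω, Real.exp (∑ k ∈ Finset.Icc 1 n, I k ω * (t * (X k ω - m k ω) - t ^ 2 / 8)) ∂Pr ≤ 1 := by
  let Z : ℕ → Ω → ℝ := fun n ω =>
    Real.exp (∑ k ∈ Finset.Icc 1 n, I k ω * (t * (X k ω - m k ω) - t ^ 2 / 8))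
  have hZm : ∀ n ≤ K, Measurable[𝓕 n] (Z n) := fun n hn => h.measurable_exp t hn
  have hZb : ∀ n ≤ K, ∃ C, ∀ ω, |Z n ω| ≤ C := fun n hn => h.exists_abs_exp_le t hn
  have hI : ∀ k ∈ Finset.Icc 1 K, ∀ ω, I k ω ∈ Set.Icc (0 : ℝ) 1 := fun k hk ω => by
    rcases h.zero_or_one k hk ω with h | h <;> simp [h]
  have hZ0 : ∀ n ω, 0 ≤ Z n ω := fun n ω => (Real.exp_pos _).le
  change ∫ ω, Z n ω ∂Pr ≤ 1
  induction n with
  | zero => simp [Z]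
  | succ n ih =>
    have hn' : n ≤ K := by omega
    refine le_trans ?_ (ih hn')
    have hk : n + 1 ∈ Finset.Icc 1 K := by simp only [Finset.mem_Icc]; omega
    have hZm' : Measurable (Z n) := (hZm n hn').mono (𝓕.le n) le_rfl
    have hIm := (h.measurable_ind _ hk).mono (𝓕.le _) le_rfl
    have hXm := (h.measurable_val _ hk).mono (𝓕.le _) le_rfl
    have hmF : Measurable[𝓕 n] (m (n + 1)) := h.measurable_mean _ hk
    have hmm := hmF.mono (𝓕.le _) le_rfl
    let W : Ω → ℝ := fun ω => Z n ω * Real.exp (-(t * m (n + 1) ω) - t ^ 2 / 8)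
    have hWF : Measurable[𝓕 n] W :=
      (hZm n hn').mul (Real.measurable_exp.comp ((hmF.const_mul t).neg.sub_const _))
    have hWm : Measurable W := hWF.mono (𝓕.le _) le_rfl
    have hWb : ∃ C, ∀ ω, |W ω| ≤ C := by
      refine exists_abs_mul_le (hZb n hn') ⟨Real.exp |t|, fun ω => ?_⟩
      rw [abs_of_pos (Real.exp_pos _)]
      refine Real.exp_le_exp.2 ?_
      have h3 := h.mean_mem_Icc _ hk ω
      have h4 : -(t * m (n + 1) ω) ≤ |t| := by
        refine (neg_le_abs _).trans ?_
        rw [abs_mul]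
        exact mul_le_of_le_one_right (abs_nonneg _) (abs_le.2 ⟨by linarith [h3.1], h3.2⟩)
      nlinarith [sq_nonneg t]
    have hIb := exists_abs_le_of_mem_Icc (hI _ hk)
    have hXb := exists_abs_le_of_mem_Icc (h.mem_Icc _ hk)
    have hmb := exists_abs_le_of_mem_Icc (h.mean_mem_Icc _ hk)
    have iZ : Integrable (Z n) Pr := integrable_of_measurable_of_abs_le hZm' (hZb n hn')
    have iZI : Integrable (fun ω => Z n ω * I (n + 1) ω) Pr :=
      integrable_of_measurable_of_abs_le (hZm'.mul hIm) (exists_abs_mul_le (hZb n hn') hIb)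
    have iWI : Integrable (fun ω => W ω * I (n + 1) ω) Pr :=
      integrable_of_measurable_of_abs_le (hWm.mul hIm) (exists_abs_mul_le hWb hIb)
    have iWX : Integrable (fun ω => W ω * (I (n + 1) ω * X (n + 1) ω)) Pr :=
      integrable_of_measurable_of_abs_le (hWm.mul (hIm.mul hXm))
        (exists_abs_mul_le hWb (exists_abs_mul_le hIb hXb))
    have iWm : Integrable (fun ω => W ω * (I (n + 1) ω * m (n + 1) ω)) Pr :=
      integrable_of_measurable_of_abs_le (hWm.mul (hIm.mul hmm))
        (exists_abs_mul_le hWb (exists_abs_mul_le hIb hmb))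
    have hmean := h.integral_eq _ hk W hWF hWb
    have iA : Integrable (fun ω => Z n ω - Z n ω * I (n + 1) ω + W ω * I (n + 1) ω) Pr :=
      (iZ.sub iZI).add iWI
    calc ∫ ω, Z (n + 1) ω ∂Pr
        ≤ ∫ ω, ((Z n ω - Z n ω * I (n + 1) ω + W ω * I (n + 1) ω) +
            (Real.exp t - 1) * (W ω * (I (n + 1) ω * X (n + 1) ω))) ∂Pr := by
          refine integral_mono (integrable_of_measurable_of_abs_le
            ((hZm _ hn).mono (𝓕.le _) le_rfl) (hZb _ hn)) (iA.add (iWX.const_mul _)) fun ω => ?_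
          simp only [Z, W]
          rw [Finset.sum_Icc_succ_top (by omega), Real.exp_add]
          rcases h.zero_or_one _ hk ω with h1 | h1
          · simp [h1]
          · have h2 := h.mem_Icc _ hk ω
            have h3 := exp_mul_le_one_add h2.1 h2.2 t
            have h4 := mul_le_mul_of_nonneg_left h3
              (mul_nonneg (hZ0 n ω) (Real.exp_pos (-(t * m (n + 1) ω) - t ^ 2 / 8)).le)
            rw [mul_assoc, ← Real.exp_add] at h4
            simp only [Z] at h4
            rw [h1, show 1 * (t * (X (n + 1) ω - m (n + 1) ω) - t ^ 2 / 8) =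
              -(t * m (n + 1) ω) - t ^ 2 / 8 + t * X (n + 1) ω by ring]
            linarith
      _ = ∫ ω, ((Z n ω - Z n ω * I (n + 1) ω + W ω * I (n + 1) ω) +
            (Real.exp t - 1) * (W ω * (I (n + 1) ω * m (n + 1) ω))) ∂Pr := by
          rw [integral_add iA (iWX.const_mul _), integral_add iA (iWm.const_mul _),
            integral_const_mul, integral_const_mul, hmean]
      _ ≤ ∫ ω, Z n ω ∂Pr := by
          refine integral_mono (iA.add (iWm.const_mul _)) iZ fun ω => ?_
          rcases h.zero_or_one _ hk ω with h1 | h1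
          · simp [h1]
          · have h2 := h.mean_mem_Icc _ hk ω
            have h3 := mul_le_mul_of_nonneg_left (one_add_mul_exp_sub_one_le h2.1 h2.2 t)
              (mul_nonneg (hZ0 n ω) (Real.exp_pos (-(t * m (n + 1) ω) - t ^ 2 / 8)).le)
            have he : Real.exp (-(t * m (n + 1) ω) - t ^ 2 / 8) *
                Real.exp (t * m (n + 1) ω + t ^ 2 / 8) = 1 := by
              rw [← Real.exp_add, ← Real.exp_zero]
              congr 1
              ring
            rw [mul_assoc (Z n ω) _ (Real.exp (t * _ + _)), he] at h3
            simp only [h1, W]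
            linarith

/-- The Azuma–Hoeffding inequality for the observations that are made up to time `k`, when their
number is `n`. -/
theorem ObservedMean.measureReal_le (h : ObservedMean Pr 𝓕 K I X m) {k n : ℕ} (hk : k ≤ K) {ε : ℝ}
    (hε : 0 ≤ ε) :
    Pr.real {ω | ∑ j ∈ Finset.Icc 1 k, I j ω = n ∧
      n * ε ≤ ∑ j ∈ Finset.Icc 1 k, I j ω * (X j ω - m j ω)} ≤ Real.exp (-(2 * n * ε ^ 2)) := by
  -- the optimal exponent is `4 * ε`
  let Z : Ω → ℝ := fun ω => Real.exp (∑ j ∈ Finset.Icc 1 k, I j ω *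
    (4 * ε * (X j ω - m j ω) - (4 * ε) ^ 2 / 8))
  have hsub : {ω | ∑ j ∈ Finset.Icc 1 k, I j ω = n ∧
      n * ε ≤ ∑ j ∈ Finset.Icc 1 k, I j ω * (X j ω - m j ω)} ⊆
      {ω | Real.exp (2 * n * ε ^ 2) ≤ Z ω} := by
    rintro ω ⟨h1, h2⟩
    refine Real.exp_le_exp.2 ?_
    have e : ∑ j ∈ Finset.Icc 1 k, I j ω * (4 * ε * (X j ω - m j ω) - (4 * ε) ^ 2 / 8) =
        4 * ε * ∑ j ∈ Finset.Icc 1 k, I j ω * (X j ω - m j ω) -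
          (∑ j ∈ Finset.Icc 1 k, I j ω) * ((4 * ε) ^ 2 / 8) := by
      rw [Finset.mul_sum, Finset.sum_mul, ← Finset.sum_sub_distrib]
      exact Finset.sum_congr rfl fun j _ => by ring
    rw [e, h1]
    nlinarith [mul_le_mul_of_nonneg_left h2 hε]
  have hint : Integrable Z Pr := integrable_of_measurable_of_abs_le
    ((h.measurable_exp (4 * ε) hk).mono (𝓕.le k) le_rfl) (h.exists_abs_exp_le (4 * ε) hk)
  have h1 := mul_meas_ge_le_integral_of_nonneg
    (Filter.Eventually.of_forall fun ω => (Real.exp_pos _).le : 0 ≤ᵐ[Pr] Z) hint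
    (Real.exp (2 * n * ε ^ 2))
  have h2 : ∫ ω, Z ω ∂Pr ≤ 1 := h.integral_exp_le_one (4 * ε) hk
  have h3 := measureReal_mono (μ := Pr) hsub
  have h4 := mul_le_mul_of_nonneg_left h3 (Real.exp_pos (2 * n * ε ^ 2)).le
  rw [Real.exp_neg, ← one_div, le_div_iff₀ (Real.exp_pos _), mul_comm]
  linarith

theorem measureReal_le_card_mul {ι : Type*} [Fintype ι] {E : ι → Set Ω} {S : Set Ω} {p : ℝ}
    (hS : S ⊆ ⋃ i, E i) (hE : ∀ i, Pr.real (E i) ≤ p) : Pr.real S ≤ Fintype.card ι * p := by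
  calc Pr.real S ≤ Pr.real (⋃ i, E i) := measureReal_mono hS
    _ ≤ ∑ i, Pr.real (E i) := measureReal_iUnion_fintype_le E
    _ ≤ ∑ _i : ι, p := Finset.sum_le_sum fun i _ => hE i
    _ = _ := by simp

end Concentration

/-! ### The law of an episode given the past -/

section Law

variable {S₁ S₂ A B Ω : Type*} {mΩ : MeasurableSpace Ω}
variable [Fintype S₁] [Fintype S₂] [Fintype A] [Fintype B]
variable {Pr : Measure Ω} [IsProbabilityMeasure Pr] {G : Game S₁ S₂ A B} {H K : ℕ}
  {𝓕 : Filtration ℕ mΩ} {D : Ω → PlayLog S₁ S₂ A B} {μ : ℕ → Ω → Policy S₁ A}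
  {ν : ℕ → Ω → Policy S₂ B}

theorem comap_top_le_of_finite {α : Type*} [Finite α] {m : MeasurableSpace Ω} {g : Ω → α}
    (hg : ∀ x, MeasurableSet[m] {ω | g ω = x}) : MeasurableSpace.comap g ⊤ ≤ m := by
  rintro _ ⟨U, _, rfl⟩
  have : g ⁻¹' U = ⋃ x ∈ U, {ω | g ω = x} := by ext ω; simp
  rw [this]
  exact MeasurableSet.biUnion (Set.to_countable U) fun x _ => hg x

theorem measurable_ite_one {m : MeasurableSpace Ω} {p : Ω → Prop} [DecidablePred p]
    (hp : MeasurableSet[m] {ω | p ω}) : Measurable[m] fun ω => if p ω then (1 : ℝ) else 0 :=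
  Measurable.ite hp measurable_const measurable_const

theorem ite_one_mem_Icc (p : Prop) [Decidable p] :
    (if p then (1 : ℝ) else 0) ∈ Set.Icc (0 : ℝ) 1 := by
  split_ifs <;> simp

theorem exists_abs_ite_one_le (p : Ω → Prop) [DecidablePred p] :
    ∃ C, ∀ ω, |if p ω then (1 : ℝ) else 0| ≤ C :=
  exists_abs_le_of_mem_Icc fun _ => ite_one_mem_Icc _

theorem integral_sum_sum_sum {X Y Z : Type*} [Fintype X] [Fintype Y] [Fintype Z]
    {f : X → Y → Z → Ω → ℝ} (hf : ∀ x y z, Integrable (f x y z) Pr) :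
    ∫ ω, ∑ x, ∑ y, ∑ z, f x y z ω ∂Pr = ∑ x, ∑ y, ∑ z, ∫ ω, f x y z ω ∂Pr := by
  rw [integral_finsetSum _ fun x _ => integrable_finsetSum _ fun y _ =>
    integrable_finsetSum _ fun z _ => hf x y z]
  refine Finset.sum_congr rfl fun x _ => ?_
  rw [integral_finsetSum _ fun y _ => integrable_finsetSum _ fun z _ => hf x y z]
  refine Finset.sum_congr rfl fun y _ => ?_
  rw [integral_finsetSum _ fun z _ => hf x y z]

theorem Policy.prob_mem_Icc {S A : Type*} [Fintype A] (π : Policy S A) (h : ℕ) (s : S) (a : A) :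
    π.prob h s a ∈ Set.Icc (0 : ℝ) 1 := by
  refine ⟨π.nonneg _ _ _, ?_⟩
  rw [← π.sum_eq_one h s]
  exact Finset.single_le_sum (f := π.prob h s) (fun a _ => π.nonneg _ _ _) (Finset.mem_univ a)

theorem Plays.measurableSet_visit (hP : Plays Pr G H K 𝓕 D μ ν) {k h : ℕ}
    (hk : k ∈ Finset.Icc 1 K) (hh : h < H) (s : S₁ × S₂) (a : A) (b : B) :
    MeasurableSet[𝓕 k] {ω | (D ω).state k h = s ∧ (D ω).act₁ k h = a ∧ (D ω).act₂ k h = b} :=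
  (hP.state_meas k hk h hh.le s).inter ((hP.act₁_meas k hk h hh a).inter
    (hP.act₂_meas k hk h hh b))

theorem Plays.preAction_le (hP : Plays Pr G H K 𝓕 D μ ν) {k h : ℕ} (hk : k ∈ Finset.Icc 1 K)
    (hh : h < H) : preAction 𝓕 D k h ≤ 𝓕 k := by
  refine sup_le (sup_le (𝓕.mono (Nat.sub_le k 1)) ?_) ?_
  · refine iSup₂_le fun j hj => sup_le (comap_top_le_of_finite fun x => ?_) ?_
    · have hj' : j < H := (Finset.mem_range.1 hj).trans hh
      obtain ⟨s, a, b⟩ := x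
      simp only [Prod.mk.injEq]
      exact hP.measurableSet_visit hk hj' s a b
    · exact (hP.rew_meas k hk j ((Finset.mem_range.1 hj).trans hh)).comap_le
  · exact comap_top_le_of_finite fun x => hP.state_meas k hk h hh.le x

theorem Plays.postAction_le (hP : Plays Pr G H K 𝓕 D μ ν) {k h : ℕ} (hk : k ∈ Finset.Icc 1 K)
    (hh : h < H) : postAction 𝓕 D k h ≤ 𝓕 k := by
  refine sup_le (hP.preAction_le hk hh) (comap_top_le_of_finite fun x => ?_)
  obtain ⟨a, b⟩ := x
  simp only [Prod.mk.injEq]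
  exact (hP.act₁_meas k hk h hh a).inter (hP.act₂_meas k hk h hh b)

theorem filtration_le_preAction (𝓕 : Filtration ℕ mΩ) (D : Ω → PlayLog S₁ S₂ A B) (k h : ℕ) :
    𝓕 (k - 1) ≤ preAction 𝓕 D k h :=
  le_sup_left.trans le_sup_left

theorem measurableSet_preAction_state (𝓕 : Filtration ℕ mΩ) (D : Ω → PlayLog S₁ S₂ A B) (k h : ℕ)
    (p : S₁ × S₂ → Prop) : MeasurableSet[preAction 𝓕 D k h] {ω | p ((D ω).state k h)} := by
  have h1 : MeasurableSet[MeasurableSpace.comap (fun ω => (D ω).state k h) ⊤]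
      {ω | p ((D ω).state k h)} := ⟨{s | p s}, trivial, rfl⟩
  exact (le_sup_right : _ ≤ preAction 𝓕 D k h) _ h1

theorem measurableSet_postAction_state (𝓕 : Filtration ℕ mΩ) (D : Ω → PlayLog S₁ S₂ A B) (k h : ℕ)
    (p : S₁ × S₂ → A → B → Prop) :
    MeasurableSet[postAction 𝓕 D k h]
      {ω | p ((D ω).state k h) ((D ω).act₁ k h) ((D ω).act₂ k h)} := by
  have h1 : ∀ x : S₁ × S₂, MeasurableSet[postAction 𝓕 D k h] {ω | (D ω).state k h = x} := fun x =>
    (le_sup_left : _ ≤ postAction 𝓕 D k h) _ (measurableSet_preAction_state 𝓕 D k h (· = x))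
  have h2 : ∀ x : S₁ × S₂, MeasurableSet[postAction 𝓕 D k h]
      {ω | p x ((D ω).act₁ k h) ((D ω).act₂ k h)} := fun x => by
    have h3 : MeasurableSet[MeasurableSpace.comap (fun ω => ((D ω).act₁ k h, (D ω).act₂ k h)) ⊤]
      {ω | p x ((D ω).act₁ k h) ((D ω).act₂ k h)} := ⟨{y | p x y.1 y.2}, trivial, rfl⟩
    exact (le_sup_right : _ ≤ postAction 𝓕 D k h) _ h3
  have h4 : {ω | p ((D ω).state k h) ((D ω).act₁ k h) ((D ω).act₂ k h)} =
      ⋃ x : S₁ × S₂, {ω | (D ω).state k h = x} ∩ {ω | p x ((D ω).act₁ k h) ((D ω).act₂ k h)} := by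
    ext ω; simp
  rw [h4]
  exact MeasurableSet.iUnion fun x => (h1 x).inter (h2 x)

theorem Plays.integral_mul_rew (hP : Plays Pr G H K 𝓕 D μ ν) {k h : ℕ} (hk : k ∈ Finset.Icc 1 K)
    (hh : h < H) {W : Ω → ℝ} (hW : Measurable[postAction 𝓕 D k h] W) (hWb : ∃ C, ∀ ω, |W ω| ≤ C) :
    ∫ ω, W ω * (D ω).rew k h ∂Pr = ∫ ω, W ω *
      G.r h ((D ω).state k h) ((D ω).act₁ k h) ((D ω).act₂ k h) ∂Pr :=
  integral_mul_eq_of_condExp ((hP.postAction_le hk hh).trans (𝓕.le k)) hW hWb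
    (integrable_of_measurable_of_abs_le ((hP.rew_meas k hk h hh).mono (𝓕.le k) le_rfl)
      (exists_abs_le_of_mem_Icc (hP.rew_mem k hk h hh))) (hP.rew_mean k hk h hh)

open scoped Classical in
theorem Plays.integral_mul_next (hP : Plays Pr G H K 𝓕 D μ ν) {k h : ℕ} (hk : k ∈ Finset.Icc 1 K)
    (hh : h < H) {W : Ω → ℝ} (hW : Measurable[postAction 𝓕 D k h] W) (hWb : ∃ C, ∀ ω, |W ω| ≤ C)
    (s' : S₁ × S₂) :
    ∫ ω, W ω * (if (D ω).state k (h + 1) = s' then 1 else 0) ∂Pr = ∫ ω, W ω *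
      G.trans h ((D ω).state k h) ((D ω).act₁ k h) ((D ω).act₂ k h) s' ∂Pr := by
  refine integral_mul_eq_of_condExp ((hP.postAction_le hk hh).trans (𝓕.le k)) hW hWb
    (integrable_of_measurable_of_abs_le (measurable_ite_one
      (𝓕.le k _ (hP.state_meas k hk (h + 1) hh s'))) (exists_abs_ite_one_le _)) ?_
  have := hP.state_law k hk h hh s'
  convert this using 2
  ext ω
  simp [Set.indicator_apply]

open scoped Classical in
theorem Plays.integral_mul_act (hP : Plays Pr G H K 𝓕 D μ ν) {k h : ℕ} (hk : k ∈ Finset.Icc 1 K)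
    (hh : h < H) {W : Ω → ℝ} (hW : Measurable[preAction 𝓕 D k h] W) (hWb : ∃ C, ∀ ω, |W ω| ≤ C)
    (a : A) (b : B) :
    ∫ ω, W ω * (if (D ω).act₁ k h = a ∧ (D ω).act₂ k h = b then 1 else 0) ∂Pr = ∫ ω, W ω *
      ((μ k ω).prob h ((D ω).state k h).1 a * (ν k ω).prob h ((D ω).state k h).2 b) ∂Pr := by
  refine integral_mul_eq_of_condExp ((hP.preAction_le hk hh).trans (𝓕.le k)) hW hWb
    (integrable_of_measurable_of_abs_le (measurable_ite_one
      (𝓕.le k _ ((hP.act₁_meas k hk h hh a).inter (hP.act₂_meas k hk h hh b))))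
      (exists_abs_ite_one_le _)) ?_
  have := hP.action_law k hk h hh a b
  convert this using 2
  ext ω
  simp [Set.indicator_apply]

theorem measurable_occ {S A : Type*} [Fintype S] [Fintype A] {m : MeasurableSpace Ω}
    (P : ℕ → S → A → S → ℝ) (π : Ω → Policy S A) (s₀ : S) {H : ℕ}
    (hπ : ∀ h < H, ∀ s a, Measurable[m] fun ω => (π ω).prob h s a) {h : ℕ} (hh : h ≤ H) (s : S) :
    Measurable[m] fun ω => occ P (π ω) s₀ h s := by
  induction h generalizing s with
  | zero => simp only [occ]; exact measurable_const
  | succ h ih =>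
    simp only [occ]
    exact Finset.measurable_sum _ fun s' _ => Finset.measurable_sum _ fun a _ =>
      ((ih (by omega) s').mul (hπ h (by omega) s' a)).mul_const _

theorem occ_mem_Icc {S A : Type*} [Fintype S] [Fintype A] (P : Transition S A) (π : Policy S A)
    (s₀ : S) (h : ℕ) (s : S) : occ P.prob π s₀ h s ∈ Set.Icc (0 : ℝ) 1 := by
  refine ⟨occ_nonneg P.nonneg _ _ _ _, ?_⟩
  rw [← sum_occ_eq_one P π s₀ h]
  exact Finset.single_le_sum (f := occ P.prob π s₀ h) (fun s _ => occ_nonneg P.nonneg _ _ _ _)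
    (Finset.mem_univ s)

open scoped Classical in
theorem Plays.integral_mul_visit_eq_state (hP : Plays Pr G H K 𝓕 D μ ν) {k h : ℕ}
    (hk : k ∈ Finset.Icc 1 K) (hh : h < H) {W : Ω → ℝ} (hW : Measurable[𝓕 (k - 1)] W)
    (hWb : ∃ C, ∀ ω, |W ω| ≤ C) (s : S₁ × S₂) (a : A) (b : B) :
    ∫ ω, W ω *
        (if (D ω).state k h = s ∧ (D ω).act₁ k h = a ∧ (D ω).act₂ k h = b then 1 else 0) ∂Pr =
      ∫ ω, W ω * ((μ k ω).prob h s.1 a * (ν k ω).prob h s.2 b) *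
        (if (D ω).state k h = s then 1 else 0) ∂Pr := by
  have h1 := hP.integral_mul_act hk hh
    (W := fun ω => W ω * (if (D ω).state k h = s then 1 else 0))
    ((hW.mono (filtration_le_preAction 𝓕 D k h) le_rfl).mul
      (measurable_ite_one (measurableSet_preAction_state 𝓕 D k h (· = s))))
    (exists_abs_mul_le hWb (exists_abs_ite_one_le _)) a b
  calc _ = _ := integral_congr_ae (Filter.Eventually.of_forall fun ω => ?_)
    _ = _ := h1
    _ = _ := integral_congr_ae (Filter.Eventually.of_forall fun ω => ?_)
  · by_cases h2 : (D ω).state k h = s <;> simp [h2]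
  · by_cases h2 : (D ω).state k h = s <;> simp [h2]

open scoped Classical in
/-- Given the past of the episode, the state at step `h` is distributed according to the occupancy
of the policies of the episode. -/
theorem Plays.integral_mul_state (hP : Plays Pr G H K 𝓕 D μ ν) {k h : ℕ} (hk : k ∈ Finset.Icc 1 K)
    (hh : h ≤ H) {W : Ω → ℝ} (hW : Measurable[𝓕 (k - 1)] W) (hWb : ∃ C, ∀ ω, |W ω| ≤ C)
    (s : S₁ × S₂) :
    ∫ ω, W ω * (if (D ω).state k h = s then 1 else 0) ∂Pr =
      ∫ ω, W ω * (occ G.P₁.prob (μ k ω) G.init.1 h s.1 *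
        occ G.P₂.prob (ν k ω) G.init.2 h s.2) ∂Pr := by
  induction h generalizing W s with
  | zero =>
    refine integral_congr_ae (Filter.Eventually.of_forall fun ω => ?_)
    simp only [hP.state_init k hk ω, occ, Prod.ext_iff, ← ite_and, mul_ite, mul_one, mul_zero,
      eq_comm (a := G.init.1), eq_comm (a := G.init.2)]
    by_cases h1 : s.1 = G.init.1 <;> by_cases h2 : s.2 = G.init.2 <;> simp [h1, h2]
  | succ h ih =>
    have hh' : h < H := hh
    have hWm := hW.mono (𝓕.le _) le_rfl
    have hpost : Measurable[postAction 𝓕 D k h] W :=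
      hW.mono ((filtration_le_preAction 𝓕 D k h).trans le_sup_left) le_rfl
    let v : S₁ × S₂ → A → B → Ω → ℝ := fun t a b ω =>
      if (D ω).state k h = t ∧ (D ω).act₁ k h = a ∧ (D ω).act₂ k h = b then 1 else 0
    have hvm : ∀ t a b, Measurable (v t a b) := fun t a b =>
      measurable_ite_one (𝓕.le k _ (hP.measurableSet_visit hk hh' t a b))
    have hvb : ∀ t a b, ∃ C, ∀ ω, |v t a b ω| ≤ C := fun t a b => exists_abs_ite_one_le _
    have hv1 : ∀ ω, ∑ t, ∑ a, ∑ b, v t a b ω = 1 := by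
      intro ω
      simp only [v, ite_and]
      rw [Finset.sum_eq_single ((D ω).state k h) (fun t _ ht => by simp [ht.symm]) (by simp)]
      rw [Finset.sum_eq_single ((D ω).act₁ k h) (fun t _ ht => by simp [ht.symm]) (by simp)]
      rw [Finset.sum_eq_single ((D ω).act₂ k h) (fun t _ ht => by simp [ht.symm]) (by simp)]
      simp
    let Y : Policy S₁ A → Policy S₂ B → S₁ × S₂ → A → B → ℝ := fun p q t a b =>
      p.prob h t.1 a * q.prob h t.2 b
    have hYm : ∀ t a b, Measurable[𝓕 (k - 1)] fun ω => Y (μ k ω) (ν k ω) t a b := fun t a b =>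
      (hP.policy₁_meas k hk h hh' t.1 a).mul (hP.policy₂_meas k hk h hh' t.2 b)
    have hYb : ∀ t a b, ∃ C, ∀ ω, |Y (μ k ω) (ν k ω) t a b| ≤ C := fun t a b =>
      exists_abs_mul_le (exists_abs_le_of_mem_Icc fun ω => (μ k ω).prob_mem_Icc _ _ _)
        (exists_abs_le_of_mem_Icc fun ω => (ν k ω).prob_mem_Icc _ _ _)
    have hOm : ∀ t : S₁ × S₂, Measurable fun ω => occ G.P₁.prob (μ k ω) G.init.1 h t.1 *
        occ G.P₂.prob (ν k ω) G.init.2 h t.2 := fun t =>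
      ((measurable_occ _ _ _ (fun h hh s a => hP.policy₁_meas k hk h hh s a) hh'.le _).mul
        (measurable_occ _ _ _ (fun h hh s a => hP.policy₂_meas k hk h hh s a) hh'.le _)).mono
        (𝓕.le _) le_rfl
    have hOb : ∀ t : S₁ × S₂, ∃ C, ∀ ω, |occ G.P₁.prob (μ k ω) G.init.1 h t.1 *
        occ G.P₂.prob (ν k ω) G.init.2 h t.2| ≤ C := fun t =>
      exists_abs_mul_le (exists_abs_le_of_mem_Icc fun ω => occ_mem_Icc _ _ _ _ _)
        (exists_abs_le_of_mem_Icc fun ω => occ_mem_Icc _ _ _ _ _)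
    have step : ∀ t a b, ∫ ω, W ω * v t a b ω * (if (D ω).state k (h + 1) = s then 1 else 0) ∂Pr =
        ∫ ω, W ω * Y (μ k ω) (ν k ω) t a b * (occ G.P₁.prob (μ k ω) G.init.1 h t.1 *
          occ G.P₂.prob (ν k ω) G.init.2 h t.2) * G.trans h t a b s ∂Pr := by
      intro t a b
      rw [hP.integral_mul_next hk hh' (W := fun ω => W ω * v t a b ω) (hpost.mul
        (measurable_ite_one (measurableSet_postAction_state 𝓕 D k h
          (fun t' a' b' => t' = t ∧ a' = a ∧ b' = b)))) (exists_abs_mul_le hWb (hvb t a b)) s,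
        integral_mul_const, ← ih hh'.le (W := fun ω => W ω * Y (μ k ω) (ν k ω) t a b)
          (hW.mul (hYm t a b)) (exists_abs_mul_le hWb (hYb t a b)) t,
        ← hP.integral_mul_visit_eq_state hk hh' hW hWb, ← integral_mul_const]
      refine integral_congr_ae (Filter.Eventually.of_forall fun ω => ?_)
      by_cases hc : (D ω).state k h = t ∧ (D ω).act₁ k h = a ∧ (D ω).act₂ k h = b
      · obtain ⟨rfl, rfl, rfl⟩ := hc
        rfl
      · simp [v, hc]
    calc ∫ ω, W ω * (if (D ω).state k (h + 1) = s then 1 else 0) ∂Pr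
        = ∫ ω, ∑ t, ∑ a, ∑ b, W ω * v t a b ω *
            (if (D ω).state k (h + 1) = s then 1 else 0) ∂Pr := by
          refine integral_congr_ae (Filter.Eventually.of_forall fun ω => ?_)
          simp only [← Finset.sum_mul, ← Finset.mul_sum, hv1, mul_one]
      _ = ∑ t, ∑ a, ∑ b, ∫ ω, W ω * v t a b ω *
            (if (D ω).state k (h + 1) = s then 1 else 0) ∂Pr := by
          have hi : ∀ t a b, Integrable (fun ω => W ω * v t a b ω *
              (if (D ω).state k (h + 1) = s then (1 : ℝ) else 0)) Pr := fun t a b =>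
            integrable_of_measurable_of_abs_le ((hWm.mul (hvm t a b)).mul (measurable_ite_one
              (𝓕.le k _ (hP.state_meas k hk (h + 1) hh s))))
              (exists_abs_mul_le (exists_abs_mul_le hWb (hvb t a b)) (exists_abs_ite_one_le _))
          exact integral_sum_sum_sum hi
      _ = ∑ t, ∑ a, ∑ b, ∫ ω, W ω * Y (μ k ω) (ν k ω) t a b *
            (occ G.P₁.prob (μ k ω) G.init.1 h t.1 * occ G.P₂.prob (ν k ω) G.init.2 h t.2) *
              G.trans h t a b s ∂Pr := by simp only [step]
      _ = ∫ ω, ∑ t, ∑ a, ∑ b, W ω * Y (μ k ω) (ν k ω) t a b *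
            (occ G.P₁.prob (μ k ω) G.init.1 h t.1 * occ G.P₂.prob (ν k ω) G.init.2 h t.2) *
              G.trans h t a b s ∂Pr := by
          have hi : ∀ t a b, Integrable (fun ω => W ω * Y (μ k ω) (ν k ω) t a b *
            (occ G.P₁.prob (μ k ω) G.init.1 h t.1 * occ G.P₂.prob (ν k ω) G.init.2 h t.2) *
              G.trans h t a b s) Pr := fun t a b =>
            (integrable_of_measurable_of_abs_le
              ((hWm.mul ((hYm t a b).mono (𝓕.le _) le_rfl)).mul (hOm t))
              (exists_abs_mul_le (exists_abs_mul_le hWb (hYb t a b)) (hOb t))).mul_const _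
          exact (integral_sum_sum_sum hi).symm
      _ = _ := by
          refine integral_congr_ae (Filter.Eventually.of_forall fun ω => ?_)
          have e := sum_occ_mul_occ_succ G.P₁.prob G.P₂.prob (μ k ω) (ν k ω) G.init h
            (fun x => if x = s then 1 else 0)
          simp only [mul_ite, mul_one, mul_zero, Finset.sum_ite_eq', Finset.mem_univ, if_true] at e
          simp only []
          rw [e, Finset.mul_sum]
          refine Finset.sum_congr rfl fun t _ => ?_
          simp only [Finset.mul_sum]
          refine Finset.sum_congr rfl fun a _ => Finset.sum_congr rfl fun b _ => ?_
          simp only [Y, Game.trans]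
          ring

open scoped Classical in
theorem Plays.integral_mul_visit (hP : Plays Pr G H K 𝓕 D μ ν) {k h : ℕ}
    (hk : k ∈ Finset.Icc 1 K) (hh : h < H) {W : Ω → ℝ} (hW : Measurable[𝓕 (k - 1)] W)
    (hWb : ∃ C, ∀ ω, |W ω| ≤ C) (s : S₁ × S₂) (a : A) (b : B) :
    ∫ ω, W ω *
        (if (D ω).state k h = s ∧ (D ω).act₁ k h = a ∧ (D ω).act₂ k h = b then 1 else 0) ∂Pr =
      ∫ ω, W ω * ((μ k ω).prob h s.1 a * (ν k ω).prob h s.2 b) *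
        (occ G.P₁.prob (μ k ω) G.init.1 h s.1 * occ G.P₂.prob (ν k ω) G.init.2 h s.2) ∂Pr := by
  rw [hP.integral_mul_visit_eq_state hk hh hW hWb]
  refine hP.integral_mul_state hk hh.le (W := fun ω => W ω *
    ((μ k ω).prob h s.1 a * (ν k ω).prob h s.2 b)) (hW.mul ((hP.policy₁_meas k hk h hh _ _).mul
      (hP.policy₂_meas k hk h hh _ _))) (exists_abs_mul_le hWb ?_) s
  exact exists_abs_mul_le (exists_abs_le_of_mem_Icc fun ω => (μ k ω).prob_mem_Icc _ _ _)
        (exists_abs_le_of_mem_Icc fun ω => (ν k ω).prob_mem_Icc _ _ _)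

end Law

/-! ### Empirical means and empirical distributions -/

section Deviation

variable {Ω : Type*} {mΩ : MeasurableSpace Ω} {Pr : Measure Ω} [IsProbabilityMeasure Pr]
variable {𝓕 : Filtration ℕ mΩ} {K : ℕ} {I X m : ℕ → Ω → ℝ}

theorem ObservedMean.exists_sum_eq_natCast (h : ObservedMean Pr 𝓕 K I X m) (ω : Ω) {k : ℕ}
    (hk : k ≤ K) : ∃ n : ℕ, n ≤ k ∧ ∑ j ∈ Finset.Icc 1 k, I j ω = n := by
  induction k with
  | zero => exact ⟨0, le_rfl, by simp⟩
  | succ k ih =>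
    obtain ⟨n, hn, he⟩ := ih (by omega)
    rw [Finset.sum_Icc_succ_top (by omega), he]
    rcases h.zero_or_one (k + 1) (by simp only [Finset.mem_Icc]; omega) ω with h1 | h1
    · exact ⟨n, by omega, by rw [h1, add_zero]⟩
    · exact ⟨n + 1, by omega, by rw [h1]; push_cast; rfl⟩

/-- Deviation of an empirical mean from the mean, uniformly over the times at which it is
formed. -/
theorem ObservedMean.measureReal_abs_le {p : ℝ} (h : ObservedMean Pr 𝓕 K I X fun _ _ => p)
    (hp : p ∈ Set.Icc (0 : ℝ) 1) {L : ℝ} (hL : 1 ≤ L) :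
    Pr.real {ω | ∃ k ∈ Finset.Icc 1 K, √(4 * L / max (∑ j ∈ Finset.Icc 1 k, I j ω) 1) <
      |(∑ j ∈ Finset.Icc 1 k, I j ω * X j ω) / max (∑ j ∈ Finset.Icc 1 k, I j ω) 1 - p|} ≤
      2 * K ^ 2 * Real.exp (-(8 * L)) := by
  let E : Fin K × Fin K × Bool → Set Ω := fun i =>
    {ω | ∑ j ∈ Finset.Icc 1 (i.1 + 1 : ℕ), I j ω = (i.2.1 + 1 : ℕ) ∧
      (i.2.1 + 1 : ℕ) * √(4 * L / (i.2.1 + 1 : ℕ)) ≤ ∑ j ∈ Finset.Icc 1 (i.1 + 1 : ℕ),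
        I j ω * (bif i.2.2 then X j ω - p else (1 - X j ω) - (1 - p))}
  refine (measureReal_le_card_mul (E := E) (p := Real.exp (-(8 * L))) ?_ ?_).trans_eq ?_
  · rintro ω ⟨k, hk, hlt⟩
    obtain ⟨hk1, hkK⟩ := Finset.mem_Icc.1 hk
    obtain ⟨n, hnk, hn⟩ := h.exists_sum_eq_natCast ω hkK
    rw [hn] at hlt
    rcases Nat.eq_zero_or_pos n with rfl | hn0
    -- without observations the width exceeds the largest possible deviation
    · exfalso
      have h0 : ∑ j ∈ Finset.Icc 1 k, I j ω * X j ω = 0 := by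
        refine Finset.sum_eq_zero fun j hj => ?_
        have hj' : ∀ j ∈ Finset.Icc 1 k, 0 ≤ I j ω := fun j hj => by
          rcases h.zero_or_one j (Finset.Icc_subset_Icc_right hkK hj) ω with h1 | h1 <;> simp [h1]
        rw [(Finset.sum_eq_zero_iff_of_nonneg hj').1 (by rw [hn]; simp) j hj, zero_mul]
      rw [h0] at hlt
      have h1 : (1 : ℝ) ≤ √(4 * L / max ((0 : ℕ) : ℝ) 1) := by
        refine Real.le_sqrt_of_sq_le ?_
        norm_num
        linarith
      have h2 : |(0 : ℝ) / max ((0 : ℕ) : ℝ) 1 - p| ≤ 1 := by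
        simp [abs_le, hp.2]
        linarith [hp.1]
      linarith
    · have hn1 : (1 : ℝ) ≤ n := by exact_mod_cast hn0
      have hn0' : (0 : ℝ) < n := by linarith
      rw [max_eq_left hn1] at hlt
      have e : ∑ j ∈ Finset.Icc 1 k, I j ω * (X j ω - p) =
          n * ((∑ j ∈ Finset.Icc 1 k, I j ω * X j ω) / n - p) := by
        simp only [mul_sub, Finset.sum_sub_distrib, ← Finset.sum_mul, hn]
        field_simp
      have ek : k - 1 + 1 = k := by omega
      have en : n - 1 + 1 = n := by omega
      refine Set.mem_iUnion.2 ?_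
      -- a negative deviation of `X` is a positive one of `1 - X`
      rcases lt_abs.1 hlt with h1 | h1
      · refine ⟨(⟨k - 1, by omega⟩, ⟨n - 1, by omega⟩, true), ?_⟩
        simp only [E, Set.mem_ofPred_eq, ek, en, cond_true]
        rw [e]
        exact ⟨hn, mul_le_mul_of_nonneg_left h1.le hn0'.le⟩
      · refine ⟨(⟨k - 1, by omega⟩, ⟨n - 1, by omega⟩, false), ?_⟩
        simp only [E, Set.mem_ofPred_eq, ek, en, cond_false]
        have e2 : ∑ j ∈ Finset.Icc 1 k, I j ω * (1 - X j ω - (1 - p)) =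
            n * -((∑ j ∈ Finset.Icc 1 k, I j ω * X j ω) / n - p) := by
          rw [mul_neg, ← e, ← Finset.sum_neg_distrib]
          exact Finset.sum_congr rfl fun j _ => by ring
        rw [e2]
        exact ⟨hn, mul_le_mul_of_nonneg_left h1.le hn0'.le⟩
  · rintro ⟨k, n, sgn⟩
    have hn0 : (0 : ℝ) < ((n : ℕ) + 1 : ℕ) := by positivity
    have e : 2 * (((n : ℕ) + 1 : ℕ) : ℝ) * √(4 * L / ((n : ℕ) + 1 : ℕ)) ^ 2 = 8 * L := by
      rw [Real.sq_sqrt (by positivity)]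
      field_simp
      norm_num
    rw [← e]
    cases sgn
    · exact h.one_sub.measureReal_le (k := (k : ℕ) + 1) (n := (n : ℕ) + 1) (by omega)
        (Real.sqrt_nonneg _)
    · exact h.measureReal_le (k := (k : ℕ) + 1) (n := (n : ℕ) + 1) (by omega)
        (Real.sqrt_nonneg _)
  · simp
    ring

theorem sum_abs_sub_eq {S : Type*} [Fintype S] [DecidableEq S] (p q : S → ℝ)
    (hpq : ∑ s, p s = ∑ s, q s) :
    ∑ s, |p s - q s| = 2 * ∑ s with q s ≤ p s, (p s - q s) := by
  have h1 : ∀ s, |p s - q s| = 2 * (if q s ≤ p s then p s - q s else 0) - (p s - q s) := by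
    intro s
    split_ifs with h
    · rw [abs_of_nonneg (by linarith)]; ring
    · rw [abs_of_neg (by linarith)]; ring
  rw [Finset.sum_filter, Finset.sum_congr rfl fun s _ => h1 s, Finset.sum_sub_distrib,
    Finset.sum_sub_distrib, hpq, sub_self, sub_zero, Finset.mul_sum]

open scoped Classical in
/-- Weissman's inequality: deviation of an empirical distribution in the `ℓ¹` distance, by a union
bound over the subsets `U`. A one-point space is exceptional, because there the deviation is zero
while the union bound is too weak. -/
theorem measureReal_l1_le {S : Type*} [Fintype S] [Nonempty S] {y : ℕ → Ω → S} {p : S → ℝ}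
    (hp0 : ∀ s, 0 ≤ p s) (hp1 : ∑ s, p s = 1)
    (h : ∀ U : Finset S, ObservedMean Pr 𝓕 K I (fun k ω => if y k ω ∈ U then 1 else 0)
      fun _ _ => ∑ s ∈ U, p s) {L : ℝ} (hL : Real.log 2 ≤ L) :
    Pr.real {ω | ∃ k ∈ Finset.Icc 1 K,
      √(2 * Fintype.card S * L / max (∑ j ∈ Finset.Icc 1 k, I j ω) 1) <
      ∑ s, |(∑ j ∈ Finset.Icc 1 k, I j ω * (if y j ω = s then 1 else 0)) /
        max (∑ j ∈ Finset.Icc 1 k, I j ω) 1 - p s|} ≤ K ^ 2 * (2 * Real.exp (-L)) ^ 2 := by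
  have hL0 : 0 < L := (Real.log_pos (by norm_num)).trans_le hL
  have hS : (1 : ℝ) ≤ Fintype.card S := by exact_mod_cast Fintype.card_pos
  let E : Fin K × Fin K × Finset S → Set Ω := fun i =>
    {ω | ∑ j ∈ Finset.Icc 1 (i.1 + 1 : ℕ), I j ω = (i.2.1 + 1 : ℕ) ∧
      (i.2.1 + 1 : ℕ) * (√(2 * Fintype.card S * L / (i.2.1 + 1 : ℕ)) / 2) ≤
        ∑ j ∈ Finset.Icc 1 (i.1 + 1 : ℕ),
          I j ω * ((if y j ω ∈ i.2.2 then 1 else 0) - ∑ s ∈ i.2.2, p s)}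
  have hsub : ∀ ω k n, k ∈ Finset.Icc 1 K → n ≤ k → ∑ j ∈ Finset.Icc 1 k, I j ω = (n : ℕ) →
      √(2 * Fintype.card S * L / max (∑ j ∈ Finset.Icc 1 k, I j ω) 1) <
      ∑ s, |(∑ j ∈ Finset.Icc 1 k, I j ω * (if y j ω = s then 1 else 0)) /
        max (∑ j ∈ Finset.Icc 1 k, I j ω) 1 - p s| → 2 ≤ Fintype.card S ∧ ω ∈ ⋃ i, E i := by
    intro ω k n hk hnk hn hlt
    obtain ⟨hk1, hkK⟩ := Finset.mem_Icc.1 hk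
    rw [hn] at hlt
    rcases Nat.eq_zero_or_pos n with rfl | hn0
    -- without observations the width exceeds the largest possible deviation
    · exfalso
      have h0 : ∀ s, ∑ j ∈ Finset.Icc 1 k, I j ω * (if y j ω = s then 1 else 0) = 0 := fun s => by
        refine Finset.sum_eq_zero fun j hj => ?_
        have hj' : ∀ j ∈ Finset.Icc 1 k, 0 ≤ I j ω := fun j hj => by
          rcases (h ∅).zero_or_one j (Finset.Icc_subset_Icc_right hkK hj) ω with h1 | h1 <;>
            simp [h1]
        rw [(Finset.sum_eq_zero_iff_of_nonneg hj').1 (by rw [hn]; simp) j hj, zero_mul]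
      have h1 : (1 : ℝ) ≤ √(2 * Fintype.card S * L / max ((0 : ℕ) : ℝ) 1) := by
        refine Real.le_sqrt_of_sq_le ?_
        have := Real.log_two_gt_d9
        norm_num
        nlinarith
      simp only [h0, zero_div, zero_sub, abs_neg, abs_of_nonneg (hp0 _), hp1] at hlt
      linarith
    · have hn1 : (1 : ℝ) ≤ n := by exact_mod_cast hn0
      have hn0' : (0 : ℝ) < n := by linarith
      rw [max_eq_left hn1] at hlt
      let q : S → ℝ := fun s => (∑ j ∈ Finset.Icc 1 k, I j ω * (if y j ω = s then 1 else 0)) / n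
      have hq1 : ∑ s, q s = 1 := by
        simp only [q, ← Finset.sum_div]
        rw [Finset.sum_comm]
        simp [hn, hn0'.ne']
      have hlt' : √(2 * Fintype.card S * L / n) < ∑ s, |q s - p s| := hlt
      have h0 : 0 ≤ √(2 * Fintype.card S * L / n) := Real.sqrt_nonneg _
      constructor
      · by_contra hc
        have : Subsingleton S := Fintype.card_le_one_iff_subsingleton.1 (by omega)
        obtain ⟨s⟩ := ‹Nonempty S›
        rw [Fintype.sum_subsingleton _ s] at hlt' hp1 hq1
        rw [hp1, hq1, sub_self, abs_zero] at hlt'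
        linarith
      · rw [sum_abs_sub_eq q p (hq1.trans hp1.symm)] at hlt'
        have ek : k - 1 + 1 = k := by omega
        have en : n - 1 + 1 = n := by omega
        let U : Finset S := {s | p s ≤ q s}
        refine Set.mem_iUnion.2 ⟨(⟨k - 1, by omega⟩, ⟨n - 1, by omega⟩, U), ?_⟩
        simp only [E, Set.mem_ofPred_eq, ek, en]
        have e : ∑ j ∈ Finset.Icc 1 k, I j ω * ((if y j ω ∈ U then 1 else 0) - ∑ s ∈ U, p s) =
            n * ∑ s ∈ U, (q s - p s) := by
          simp only [mul_sub, Finset.sum_sub_distrib, ← Finset.sum_mul, hn]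
          congr 1
          simp only [q, ← Finset.sum_div]
          rw [mul_div_cancel₀ _ hn0'.ne', Finset.sum_comm]
          simp only [← Finset.mul_sum]
          refine Finset.sum_congr rfl fun j _ => ?_
          rw [Finset.sum_ite_eq]
        rw [e]
        refine ⟨hn, mul_le_mul_of_nonneg_left ?_ hn0'.le⟩
        linarith
  have hsub' : ∀ ω, (∃ k ∈ Finset.Icc 1 K,
      √(2 * Fintype.card S * L / max (∑ j ∈ Finset.Icc 1 k, I j ω) 1) <
      ∑ s, |(∑ j ∈ Finset.Icc 1 k, I j ω * (if y j ω = s then 1 else 0)) /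
        max (∑ j ∈ Finset.Icc 1 k, I j ω) 1 - p s|) → 2 ≤ Fintype.card S ∧ ω ∈ ⋃ i, E i := by
    rintro ω ⟨k, hk, hlt⟩
    obtain ⟨n, hnk, hn⟩ := (h ∅).exists_sum_eq_natCast ω (Finset.mem_Icc.1 hk).2
    exact hsub ω k n hk hnk hn hlt
  by_cases hS2 : 2 ≤ Fintype.card S
  · refine (measureReal_le_card_mul (E := E) (p := Real.exp (-L) ^ Fintype.card S)
      (fun ω hω => (hsub' ω hω).2) ?_).trans ?_
    · rintro ⟨k, n, U⟩
      have hn0 : (0 : ℝ) < ((n : ℕ) + 1 : ℕ) := by positivity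
      have e : 2 * (((n : ℕ) + 1 : ℕ) : ℝ) *
          (√(2 * Fintype.card S * L / ((n : ℕ) + 1 : ℕ)) / 2) ^ 2 = Fintype.card S * L := by
        rw [div_pow, Real.sq_sqrt (by positivity)]
        field_simp
      rw [← Real.exp_nat_mul, mul_neg, ← e]
      exact (h U).measureReal_le (k := (k : ℕ) + 1) (n := (n : ℕ) + 1) (by omega) (by positivity)
    · have h1 : 2 * Real.exp (-L) ≤ 1 := by
        have : Real.exp (-L) ≤ Real.exp (-Real.log 2) := Real.exp_le_exp.2 (by linarith)
        rw [Real.exp_neg (Real.log 2), Real.exp_log (by norm_num)] at this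
        linarith
      have h2 := pow_le_pow_of_le_one (by positivity) h1 hS2
      simp only [Fintype.card_prod, Fintype.card_fin, Fintype.card_finset]
      push_cast
      calc (K : ℝ) * (K * 2 ^ Fintype.card S) * Real.exp (-L) ^ Fintype.card S
          = K ^ 2 * (2 * Real.exp (-L)) ^ Fintype.card S := by rw [mul_pow]; ring
        _ ≤ _ := by gcongr
  · have : {ω | ∃ k ∈ Finset.Icc 1 K,
      √(2 * Fintype.card S * L / max (∑ j ∈ Finset.Icc 1 k, I j ω) 1) <
      ∑ s, |(∑ j ∈ Finset.Icc 1 k, I j ω * (if y j ω = s then 1 else 0)) /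
        max (∑ j ∈ Finset.Icc 1 k, I j ω) 1 - p s|} = ∅ :=
      Set.eq_empty_of_forall_notMem fun ω hω => hS2 (hsub' ω hω).1
    rw [this, measureReal_empty]
    positivity

end Deviation

section Game

variable {S₁ S₂ A B Ω : Type*} {mΩ : MeasurableSpace Ω}
variable [Fintype S₁] [Fintype S₂] [Fintype A] [Fintype B]
variable {Pr : Measure Ω} [IsProbabilityMeasure Pr] {G : Game S₁ S₂ A B} {H K : ℕ}
  {𝓕 : Filtration ℕ mΩ} {D : Ω → PlayLog S₁ S₂ A B} {μ : ℕ → Ω → Policy S₁ A}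
  {ν : ℕ → Ω → Policy S₂ B}

theorem ite_one_eq_zero_or_one (p : Prop) [Decidable p] :
    (if p then (1 : ℝ) else 0) = 0 ∨ (if p then (1 : ℝ) else 0) = 1 := by
  split_ifs <;> simp

open scoped Classical in
theorem Plays.observedMean_rew (hP : Plays Pr G H K 𝓕 D μ ν) {h : ℕ} (hh : h < H) (s : S₁ × S₂)
    (a : A) (b : B) :
    ObservedMean Pr 𝓕 K
      (fun k ω => if (D ω).state k h = s ∧ (D ω).act₁ k h = a ∧ (D ω).act₂ k h = b then 1 else 0)
      (fun k ω => (D ω).rew k h) (fun _ _ => G.r h s a b) where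
  zero_or_one _ _ _ := ite_one_eq_zero_or_one _
  mem_Icc k hk := hP.rew_mem k hk h hh
  mean_mem_Icc _ _ _ := ⟨G.r_nonneg _ _ _ _, G.r_le_one _ _ _ _⟩
  measurable_ind k hk := measurable_ite_one (hP.measurableSet_visit hk hh s a b)
  measurable_val k hk := hP.rew_meas k hk h hh
  measurable_mean _ _ := measurable_const
  integral_eq k hk W hW hWb := by
    have h1 := hP.integral_mul_rew hk hh (W := fun ω => W ω *
      (if (D ω).state k h = s ∧ (D ω).act₁ k h = a ∧ (D ω).act₂ k h = b then 1 else 0))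
      ((hW.mono ((filtration_le_preAction 𝓕 D k h).trans le_sup_left) le_rfl).mul
        (measurable_ite_one (measurableSet_postAction_state 𝓕 D k h
          (fun t' a' b' => t' = s ∧ a' = a ∧ b' = b))))
      (exists_abs_mul_le hWb (exists_abs_ite_one_le _))
    simp only [mul_assoc] at h1
    rw [h1]
    refine integral_congr_ae (Filter.Eventually.of_forall fun ω => ?_)
    by_cases hc : (D ω).state k h = s ∧ (D ω).act₁ k h = a ∧ (D ω).act₂ k h = b
    · obtain ⟨rfl, rfl, rfl⟩ := hc
      rfl
    · simp [hc]

open scoped Classical in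
theorem Plays.integral_mul_next_mem (hP : Plays Pr G H K 𝓕 D μ ν) {k h : ℕ}
    (hk : k ∈ Finset.Icc 1 K) (hh : h < H) {W : Ω → ℝ} (hW : Measurable[postAction 𝓕 D k h] W)
    (hWb : ∃ C, ∀ ω, |W ω| ≤ C) (p : S₁ × S₂ → Prop) [DecidablePred p] :
    ∫ ω, W ω * (if p ((D ω).state k (h + 1)) then 1 else 0) ∂Pr = ∫ ω, W ω *
      ∑ s' with p s', G.trans h ((D ω).state k h) ((D ω).act₁ k h) ((D ω).act₂ k h) s' ∂Pr := by
  have hWm := hW.mono ((hP.postAction_le hk hh).trans (𝓕.le k)) le_rfl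
  have hi : ∀ s', Integrable (fun ω => W ω * (if (D ω).state k (h + 1) = s' then 1 else 0)) Pr :=
    fun s' => integrable_of_measurable_of_abs_le (hWm.mul (measurable_ite_one
      (𝓕.le k _ (hP.state_meas k hk (h + 1) hh s')))) (exists_abs_mul_le hWb
        (exists_abs_ite_one_le _))
  have hm : ∀ s', Measurable fun ω =>
      G.trans h ((D ω).state k h) ((D ω).act₁ k h) ((D ω).act₂ k h) s' := fun s' => by
    refine (Measurable.mono (ma := postAction 𝓕 D k h) (fun U _ => ?_)
      ((hP.postAction_le hk hh).trans (𝓕.le k)) le_rfl)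
    exact measurableSet_postAction_state 𝓕 D k h (fun t a b => G.trans h t a b s' ∈ U)
  have hb : ∀ s' : S₁ × S₂, ∃ C, ∀ ω,
      |G.trans h ((D ω).state k h) ((D ω).act₁ k h) ((D ω).act₂ k h) s'| ≤ C := fun s' =>
    exists_abs_le_of_mem_Icc fun ω => by
      have h0 : ∀ s', 0 ≤ G.trans h ((D ω).state k h) ((D ω).act₁ k h) ((D ω).act₂ k h) s' :=
        fun s' => mul_nonneg (G.P₁.nonneg _ _ _ _) (G.P₂.nonneg _ _ _ _)
      refine ⟨h0 s', ?_⟩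
      rw [← G.sum_trans h ((D ω).state k h) ((D ω).act₁ k h) ((D ω).act₂ k h)]
      exact Finset.single_le_sum (f := G.trans h ((D ω).state k h) ((D ω).act₁ k h)
        ((D ω).act₂ k h)) (fun s _ => h0 s) (Finset.mem_univ s')
  calc ∫ ω, W ω * (if p ((D ω).state k (h + 1)) then 1 else 0) ∂Pr
      = ∫ ω, ∑ s' with p s', W ω * (if (D ω).state k (h + 1) = s' then 1 else 0) ∂Pr := by
        refine integral_congr_ae (Filter.Eventually.of_forall fun ω => ?_)
        simp only [← Finset.mul_sum]
        rw [Finset.sum_ite_eq]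
        simp
    _ = ∑ s' with p s', ∫ ω, W ω * (if (D ω).state k (h + 1) = s' then 1 else 0) ∂Pr :=
        integral_finsetSum _ fun s' _ => hi s'
    _ = ∑ s' with p s', ∫ ω, W ω *
          G.trans h ((D ω).state k h) ((D ω).act₁ k h) ((D ω).act₂ k h) s' ∂Pr :=
        Finset.sum_congr rfl fun s' _ => hP.integral_mul_next hk hh hW hWb s'
    _ = ∫ ω, ∑ s' with p s', W ω *
          G.trans h ((D ω).state k h) ((D ω).act₁ k h) ((D ω).act₂ k h) s' ∂Pr :=
        (integral_finsetSum _ fun s' _ => integrable_of_measurable_of_abs_le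
          (hWm.mul (hm s')) (exists_abs_mul_le hWb (hb s'))).symm
    _ = _ := by simp only [Finset.mul_sum]

open scoped Classical in
theorem Plays.observedMean_trans₁ (hP : Plays Pr G H K 𝓕 D μ ν) {h : ℕ} (hh : h < H) (s : S₁)
    (a : A) (U : Finset S₁) :
    ObservedMean Pr 𝓕 K
      (fun k ω => if ((D ω).state k h).1 = s ∧ (D ω).act₁ k h = a then 1 else 0)
      (fun k ω => if ((D ω).state k (h + 1)).1 ∈ U then 1 else 0)
      (fun _ _ => ∑ s' ∈ U, G.P₁.prob h s a s') where
  zero_or_one _ _ _ := ite_one_eq_zero_or_one _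
  mem_Icc _ _ _ := ite_one_mem_Icc _
  mean_mem_Icc _ _ _ := ⟨Finset.sum_nonneg fun _ _ => G.P₁.nonneg _ _ _ _, by
    rw [← G.P₁.sum_eq_one h s a]
    exact Finset.sum_le_univ_sum_of_nonneg (G.P₁.nonneg h s a)⟩
  measurable_ind k hk := measurable_ite_one (hP.postAction_le hk hh _
    (measurableSet_postAction_state 𝓕 D k h (fun t a' _ => t.1 = s ∧ a' = a)))
  measurable_val k hk := measurable_ite_one (by
    have := comap_top_le_of_finite fun x => hP.state_meas k hk (h + 1) hh x
    exact this _ ⟨{t | t.1 ∈ U}, trivial, rfl⟩)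
  measurable_mean _ _ := measurable_const
  integral_eq k hk W hW hWb := by
    have h1 := hP.integral_mul_next_mem hk hh (W := fun ω => W ω *
      (if ((D ω).state k h).1 = s ∧ (D ω).act₁ k h = a then 1 else 0))
      ((hW.mono ((filtration_le_preAction 𝓕 D k h).trans le_sup_left) le_rfl).mul
        (measurable_ite_one (measurableSet_postAction_state 𝓕 D k h
          (fun t a' _ => t.1 = s ∧ a' = a))))
      (exists_abs_mul_le hWb (exists_abs_ite_one_le _)) (fun t => t.1 ∈ U)
    simp only [mul_assoc] at h1
    rw [h1]
    refine integral_congr_ae (Filter.Eventually.of_forall fun ω => ?_)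
    by_cases hc : ((D ω).state k h).1 = s ∧ (D ω).act₁ k h = a
    · obtain ⟨rfl, rfl⟩ := hc
      simp only [Game.trans]
      congr 2
      rw [Finset.sum_filter, Fintype.sum_prod_type]
      simp [← Finset.mul_sum, G.P₂.sum_eq_one]
    · simp [hc]

open scoped Classical in
theorem Plays.observedMean_trans₂ (hP : Plays Pr G H K 𝓕 D μ ν) {h : ℕ} (hh : h < H) (s : S₂)
    (b : B) (U : Finset S₂) :
    ObservedMean Pr 𝓕 K
      (fun k ω => if ((D ω).state k h).2 = s ∧ (D ω).act₂ k h = b then 1 else 0)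
      (fun k ω => if ((D ω).state k (h + 1)).2 ∈ U then 1 else 0)
      (fun _ _ => ∑ s' ∈ U, G.P₂.prob h s b s') where
  zero_or_one _ _ _ := ite_one_eq_zero_or_one _
  mem_Icc _ _ _ := ite_one_mem_Icc _
  mean_mem_Icc _ _ _ := ⟨Finset.sum_nonneg fun _ _ => G.P₂.nonneg _ _ _ _, by
    rw [← G.P₂.sum_eq_one h s b]
    exact Finset.sum_le_univ_sum_of_nonneg (G.P₂.nonneg h s b)⟩
  measurable_ind k hk := measurable_ite_one (hP.postAction_le hk hh _
    (measurableSet_postAction_state 𝓕 D k h (fun t _ b' => t.2 = s ∧ b' = b)))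
  measurable_val k hk := measurable_ite_one (by
    have := comap_top_le_of_finite fun x => hP.state_meas k hk (h + 1) hh x
    exact this _ ⟨{t | t.2 ∈ U}, trivial, rfl⟩)
  measurable_mean _ _ := measurable_const
  integral_eq k hk W hW hWb := by
    have h1 := hP.integral_mul_next_mem hk hh (W := fun ω => W ω *
      (if ((D ω).state k h).2 = s ∧ (D ω).act₂ k h = b then 1 else 0))
      ((hW.mono ((filtration_le_preAction 𝓕 D k h).trans le_sup_left) le_rfl).mul
        (measurable_ite_one (measurableSet_postAction_state 𝓕 D k h
          (fun t _ b' => t.2 = s ∧ b' = b))))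
      (exists_abs_mul_le hWb (exists_abs_ite_one_le _)) (fun t => t.2 ∈ U)
    simp only [mul_assoc] at h1
    rw [h1]
    refine integral_congr_ae (Filter.Eventually.of_forall fun ω => ?_)
    by_cases hc : ((D ω).state k h).2 = s ∧ (D ω).act₂ k h = b
    · obtain ⟨rfl, rfl⟩ := hc
      simp only [Game.trans]
      congr 2
      rw [Finset.sum_filter, Fintype.sum_prod_type_right]
      simp [← Finset.sum_mul, G.P₁.sum_eq_one]
    · simp [hc]

theorem Game.expect_const (G : Game S₁ S₂ A B) (μ : Policy S₁ A) (ν : Policy S₂ B) (h : ℕ)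
    (c : ℝ) : G.expect μ ν h (fun _ _ _ => c) = c := by
  simp only [Game.expect, Policy.sum_sum_mul]
  rw [Fintype.sum_prod_type]
  simp only [← Finset.sum_mul, ← Finset.mul_sum, sum_occ_eq_one, mul_one, one_mul]

open scoped Classical in
/-- Observing, at every episode, a function of the state and actions at step `h`, where the
function is determined by the past episodes. -/
theorem Plays.observedMean_expect (hP : Plays Pr G H K 𝓕 D μ ν) {h : ℕ} (hh : h < H)
    (f : ℕ → Ω → S₁ × S₂ → A → B → ℝ) (hf : ∀ k ω s a b, f k ω s a b ∈ Set.Icc (0 : ℝ) 1)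
    (hfm : ∀ k ∈ Finset.Icc 1 K, ∀ s a b, Measurable[𝓕 (k - 1)] fun ω => f k ω s a b) :
    ObservedMean Pr 𝓕 K (fun _ _ => 1)
      (fun k ω => f k ω ((D ω).state k h) ((D ω).act₁ k h) ((D ω).act₂ k h))
      (fun k ω => G.expect (μ k ω) (ν k ω) h (f k ω)) := by
  let v : ℕ → S₁ × S₂ → A → B → Ω → ℝ := fun k t a b ω =>
    if (D ω).state k h = t ∧ (D ω).act₁ k h = a ∧ (D ω).act₂ k h = b then 1 else 0
  have hfv : ∀ k ω, f k ω ((D ω).state k h) ((D ω).act₁ k h) ((D ω).act₂ k h) =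
      ∑ t, ∑ a, ∑ b, f k ω t a b * v k t a b ω := by
    intro k ω
    simp only [v, ite_and]
    rw [Finset.sum_eq_single ((D ω).state k h) (fun t _ ht => by simp [ht.symm]) (by simp)]
    rw [Finset.sum_eq_single ((D ω).act₁ k h) (fun t _ ht => by simp [ht.symm]) (by simp)]
    rw [Finset.sum_eq_single ((D ω).act₂ k h) (fun t _ ht => by simp [ht.symm]) (by simp)]
    simp
  have hvm : ∀ k ∈ Finset.Icc 1 K, ∀ t a b, Measurable[𝓕 k] (v k t a b) := fun k hk t a b =>
    measurable_ite_one (hP.measurableSet_visit hk hh t a b)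
  have hvb : ∀ k t a b, ∃ C, ∀ ω, |v k t a b ω| ≤ C := fun k t a b => exists_abs_ite_one_le _
  have hOm : ∀ k ∈ Finset.Icc 1 K, ∀ t : S₁ × S₂, Measurable[𝓕 (k - 1)] fun ω =>
      occ G.P₁.prob (μ k ω) G.init.1 h t.1 * occ G.P₂.prob (ν k ω) G.init.2 h t.2 := fun k hk t =>
    (measurable_occ _ _ _ (fun h hh s a => hP.policy₁_meas k hk h hh s a) hh.le _).mul
      (measurable_occ _ _ _ (fun h hh s a => hP.policy₂_meas k hk h hh s a) hh.le _)
  have hOb : ∀ (k : ℕ) (t : S₁ × S₂), ∃ C, ∀ ω, |occ G.P₁.prob (μ k ω) G.init.1 h t.1 *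
      occ G.P₂.prob (ν k ω) G.init.2 h t.2| ≤ C := fun k t =>
    exists_abs_mul_le (exists_abs_le_of_mem_Icc fun ω => occ_mem_Icc _ _ _ _ _)
      (exists_abs_le_of_mem_Icc fun ω => occ_mem_Icc _ _ _ _ _)
  have hYm : ∀ k ∈ Finset.Icc 1 K, ∀ (t : S₁ × S₂) a b, Measurable[𝓕 (k - 1)] fun ω =>
      (μ k ω).prob h t.1 a * (ν k ω).prob h t.2 b := fun k hk t a b =>
    (hP.policy₁_meas k hk h hh t.1 a).mul (hP.policy₂_meas k hk h hh t.2 b)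
  have hYb : ∀ (k : ℕ) (t : S₁ × S₂) a b, ∃ C, ∀ ω,
      |(μ k ω).prob h t.1 a * (ν k ω).prob h t.2 b| ≤ C := fun k t a b =>
    exists_abs_mul_le (exists_abs_le_of_mem_Icc fun ω => (μ k ω).prob_mem_Icc _ _ _)
      (exists_abs_le_of_mem_Icc fun ω => (ν k ω).prob_mem_Icc _ _ _)
  refine ⟨fun _ _ _ => Or.inr rfl, fun k _ ω => hf _ _ _ _ _, fun k _ ω => ⟨?_, ?_⟩,
    fun _ _ => measurable_const, fun k hk => ?_, fun k hk => ?_, fun k hk W hW hWb => ?_⟩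
  · exact (G.expect_const (μ k ω) (ν k ω) h 0).symm.trans_le
      (G.expect_mono _ _ _ fun s a b => (hf k ω s a b).1)
  · exact (G.expect_mono _ _ _ fun s a b => (hf k ω s a b).2).trans_eq
      (G.expect_const (μ k ω) (ν k ω) h 1)
  · simp only [hfv]
    exact Finset.measurable_sum _ fun t _ => Finset.measurable_sum _ fun a _ =>
      Finset.measurable_sum _ fun b _ =>
        ((hfm k hk t a b).mono (𝓕.mono (Nat.sub_le k 1)) le_rfl).mul (hvm k hk t a b)
  · exact Finset.measurable_sum _ fun t _ => (hOm k hk t).mul (Finset.measurable_sum _ fun a _ =>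
      Finset.measurable_sum _ fun b _ => (hYm k hk t a b).mul (hfm k hk t a b))
  · have hfb : ∀ t a b, ∃ C, ∀ ω, |f k ω t a b| ≤ C := fun t a b =>
      exists_abs_le_of_mem_Icc fun ω => hf k ω t a b
    simp only [one_mul]
    calc ∫ ω, W ω * f k ω ((D ω).state k h) ((D ω).act₁ k h) ((D ω).act₂ k h) ∂Pr
        = ∫ ω, ∑ t, ∑ a, ∑ b, W ω * f k ω t a b * v k t a b ω ∂Pr := by
          simp only [hfv, Finset.mul_sum, mul_assoc]
      _ = ∑ t, ∑ a, ∑ b, ∫ ω, W ω * f k ω t a b * v k t a b ω ∂Pr := by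
          refine integral_sum_sum_sum fun t a b => integrable_of_measurable_of_abs_le
            (((hW.mul (hfm k hk t a b)).mono (𝓕.le _) le_rfl).mul
              ((hvm k hk t a b).mono (𝓕.le _) le_rfl))
            (exists_abs_mul_le (exists_abs_mul_le hWb (hfb t a b)) (hvb k t a b))
      _ = ∑ t, ∑ a, ∑ b, ∫ ω, W ω * f k ω t a b *
            ((μ k ω).prob h t.1 a * (ν k ω).prob h t.2 b) *
            (occ G.P₁.prob (μ k ω) G.init.1 h t.1 * occ G.P₂.prob (ν k ω) G.init.2 h t.2) ∂Pr := by
          refine Finset.sum_congr rfl fun t _ => Finset.sum_congr rfl fun a _ =>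
            Finset.sum_congr rfl fun b _ => ?_
          exact hP.integral_mul_visit hk hh (W := fun ω => W ω * f k ω t a b)
            (hW.mul (hfm k hk t a b)) (exists_abs_mul_le hWb (hfb t a b)) t a b
      _ = ∫ ω, ∑ t, ∑ a, ∑ b, W ω * f k ω t a b *
            ((μ k ω).prob h t.1 a * (ν k ω).prob h t.2 b) *
            (occ G.P₁.prob (μ k ω) G.init.1 h t.1 *
              occ G.P₂.prob (ν k ω) G.init.2 h t.2) ∂Pr := by
          refine (integral_sum_sum_sum fun t a b => integrable_of_measurable_of_abs_le
            ((((hW.mul (hfm k hk t a b)).mul (hYm k hk t a b)).mul (hOm k hk t)).mono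
              (𝓕.le _) le_rfl) (exists_abs_mul_le (exists_abs_mul_le
                (exists_abs_mul_le hWb (hfb t a b)) (hYb k t a b)) (hOb k t))).symm
      _ = ∫ ω, W ω * G.expect (μ k ω) (ν k ω) h (f k ω) ∂Pr := by
          simp only [Game.expect, Finset.mul_sum]
          refine integral_congr_ae (Filter.Eventually.of_forall fun ω => ?_)
          exact Finset.sum_congr rfl fun t _ => Finset.sum_congr rfl fun a _ =>
            Finset.sum_congr rfl fun b _ => by ring

end Game

/-! ### The losses of the algorithm and the visit counts -/

section MirrorDescent

variable {S S₁ S₂ A B : Type*} [Fintype S₁] [Fintype S₂] [Fintype A] [Fintype B]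

theorem Policy.sum_mul_exp_pos (ν : Policy S B) (f : B → ℝ) (h : ℕ) (s : S) :
    0 < ∑ b, ν.prob h s b * Real.exp (f b) := by
  have h0 : ∀ b ∈ Finset.univ, 0 ≤ ν.prob h s b * Real.exp (f b) := fun b _ =>
    mul_nonneg (ν.nonneg _ _ _) (Real.exp_pos _).le
  refine (Finset.sum_nonneg h0).lt_of_ne' fun h1 => ?_
  have h2 := (Finset.sum_eq_zero_iff_of_nonneg h0).1 h1
  have h3 : ∑ b, ν.prob h s b = 0 := Finset.sum_eq_zero fun b hb =>
    (mul_eq_zero.1 (h2 b hb)).resolve_right (Real.exp_pos _).ne'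
  rw [ν.sum_eq_one] at h3
  exact one_ne_zero h3

/-- The exponential weights update of the policy `ν` with the losses `ℓ` and step size `γ`. -/
noncomputable def Policy.expWeights (ν : Policy S B) (γ : ℝ) (ℓ : ℕ → S → B → ℝ) : Policy S B where
  prob h s b := ν.prob h s b * Real.exp (-(γ * ℓ h s b)) /
    ∑ b', ν.prob h s b' * Real.exp (-(γ * ℓ h s b'))
  nonneg h s b := div_nonneg (mul_nonneg (ν.nonneg _ _ _) (Real.exp_pos _).le)
    (ν.sum_mul_exp_pos _ h s).le
  sum_eq_one h s := by
    rw [← Finset.sum_div]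
    exact div_self (ν.sum_mul_exp_pos _ h s).ne'

variable {H K : ℕ} {δ γ : ℝ} {s₀ : S₁} {D : PlayLog S₁ S₂ A B} {μ : ℕ → Policy S₁ A}
  {ν : ℕ → Policy S₂ B}

/-- The mirror descent step from a policy of full support is the exponential weights update. -/
theorem RunsOptimisticPO₂.prob_succ (hrun : RunsOptimisticPO₂ H K δ γ s₀ D μ ν) (hγ : 0 < γ)
    {k : ℕ} (hk : k < K) (hpos : ∀ h < H, ∀ s b, 0 < (ν k).prob h s b) {h : ℕ} (hh : h < H)
    (s : S₂) :
    (ν (k + 1)).prob h s =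
      ((ν k).expWeights γ (D.loss₂ H K δ s₀ (μ k) (ν k) k)).prob h s := by
  let e := (ν k).expWeights γ (D.loss₂ H K δ s₀ (μ k) (ν k) k)
  have hepos : ∀ h < H, ∀ b, 0 < e.prob h s b := fun h hh b =>
    div_pos (mul_pos (hpos h hh s b) (Real.exp_pos _)) ((ν k).sum_mul_exp_pos _ h s)
  let c : ℕ → ℝ := fun h => γ⁻¹ * Real.log (∑ b', (ν k).prob h s b' *
    Real.exp (-(γ * D.loss₂ H K δ s₀ (μ k) (ν k) k h s b'))) +
      ∑ b, (ν k).prob h s b * D.loss₂ H K δ s₀ (μ k) (ν k) k h s b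
  have hobj : ∀ ν' : Policy S₂ B, D.descentObjective₂ H K δ γ s₀ (μ k) (ν k) k s ν' =
      ∑ h ∈ Finset.range H, (γ⁻¹ * kl (ν'.prob h s) (e.prob h s) - c h) := fun ν' =>
    Finset.sum_congr rfl fun h hh => linear_add_kl_eq hγ _ _ _ (hpos h (Finset.mem_range.1 hh) s)
      (ν'.nonneg h s) (ν'.sum_eq_one h s) _ ((ν k).sum_mul_exp_pos _ h s)
  have h1 := hrun.step k hk s e
  rw [hobj, hobj, Finset.sum_sub_distrib, Finset.sum_sub_distrib, sub_le_sub_iff_right] at h1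
  have h2 : ∑ h ∈ Finset.range H, γ⁻¹ * kl (e.prob h s) (e.prob h s) = 0 :=
    Finset.sum_eq_zero fun h hh => by
      rw [kl]
      simp [div_self (hepos h (Finset.mem_range.1 hh) _).ne']
  rw [h2] at h1
  have h3 : ∀ h ∈ Finset.range H, 0 ≤ γ⁻¹ * kl ((ν (k + 1)).prob h s) (e.prob h s) :=
    fun h hh => mul_nonneg (inv_pos.2 hγ).le (kl_nonneg ((ν (k + 1)).nonneg h s)
      (hepos h (Finset.mem_range.1 hh)) ((ν (k + 1)).sum_eq_one h s) (e.sum_eq_one h s))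
  have h4 := (Finset.sum_eq_zero_iff_of_nonneg h3).1 (le_antisymm h1 (Finset.sum_nonneg h3)) h
    (Finset.mem_range.2 hh)
  exact eq_of_kl_nonpos ((ν (k + 1)).nonneg h s) (hepos h hh) ((ν (k + 1)).sum_eq_one h s)
    (e.sum_eq_one h s) ((mul_eq_zero.1 h4).resolve_left (inv_pos.2 hγ).ne').le

theorem RunsOptimisticPO₂.prob_pos (hrun : RunsOptimisticPO₂ H K δ γ s₀ D μ ν) (hγ : 0 < γ)
    {k : ℕ} (hk : k ≤ K) {h : ℕ} (hh : h < H) (s : S₂) (b : B) : 0 < (ν k).prob h s b := by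
  induction k generalizing h s b with
  | zero =>
    have : Nonempty B := ⟨b⟩
    rw [hrun.init h hh]
    positivity
  | succ k ih =>
    have ih' : ∀ h < H, ∀ s b, 0 < (ν k).prob h s b := fun h hh s b => ih (by omega) hh s b
    rw [hrun.prob_succ hγ (by omega) ih' hh]
    exact div_pos (mul_pos (ih' h hh s b) (Real.exp_pos _)) ((ν k).sum_mul_exp_pos _ h s)

/-- The regret of the policies of the algorithm against its own losses, at one state. -/
theorem RunsOptimisticPO₂.sum_loss_le [Nonempty B] (hK : 1 ≤ K) (hH : 1 ≤ H)
    (hrun : RunsOptimisticPO₂ H K δ (√(Real.log (Fintype.card B) / ((K : ℝ) * (H : ℝ) ^ 2)))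
      s₀ D μ ν)
    (ν' : Policy S₂ B) {h : ℕ} (hh : h < H) (s : S₂) :
    ∑ k ∈ Finset.Icc 1 K, ∑ b, ((ν k).prob h s b - ν'.prob h s b) *
      D.loss₂ H K δ s₀ (μ k) (ν k) k h s b ≤ 2 * √(Real.log (Fintype.card B) * (K * H ^ 2)) := by
  have hKr : (1 : ℝ) ≤ K := by exact_mod_cast hK
  have hHr : (1 : ℝ) ≤ H := by exact_mod_cast hH
  rcases (Nat.one_le_iff_ne_zero.2 (Fintype.card_ne_zero (α := B))).eq_or_lt with hB | hB
  -- with a single action the step size is zero, but all policies agree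
  · have h1 : ∀ (π : Policy S₂ B) b, π.prob h s b = 1 := by
      intro π b
      have : Subsingleton B := Fintype.card_le_one_iff_subsingleton.1 hB.ge
      rw [← π.sum_eq_one h s, Fintype.sum_subsingleton _ b]
    simp [h1]
  · set x := Real.log (Fintype.card B) with hx
    set y := (K : ℝ) * (H : ℝ) ^ 2 with hy
    have hx0 : 0 < x := Real.log_pos (by exact_mod_cast hB)
    have hy0 : 0 < y := by positivity
    have hγ : 0 < √(x / y) := Real.sqrt_pos.2 (by positivity)
    -- exponential weights start from the uniform policy of episode `0`, which has zero loss
    have h0 : ∑ k ∈ Finset.Icc 1 K, ∑ b, ((ν k).prob h s b - ν'.prob h s b) *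
        D.loss₂ H K δ s₀ (μ k) (ν k) k h s b =
        ∑ k ∈ Finset.range (K + 1), ∑ b, ((ν k).prob h s b - ν'.prob h s b) *
        D.loss₂ H K δ s₀ (μ k) (ν k) k h s b := by
      refine Finset.sum_subset (fun k hk => ?_) fun k hk hk' => ?_
      · simp only [Finset.mem_Icc, Finset.mem_range] at hk ⊢; omega
      · obtain rfl : k = 0 := by
          simp only [Finset.mem_Icc, Finset.mem_range] at hk hk'; omega
        simp [D.loss₂_zero hh]
    rw [h0]
    refine (hedge_regret_le hγ (K + 1) (fun k => (ν k).prob h s)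
      (fun k => D.loss₂ H K δ s₀ (μ k) (ν k) k h s) (ν'.prob h s) (L := H)
      (fun b => hrun.init h hh s b) (fun k hk b => ?_) (fun k _ b => D.loss₂_nonneg ..)
      (fun k _ b => D.loss₂_le hh.le ..) (ν'.nonneg h s) (ν'.sum_eq_one h s)).trans ?_
    · rw [hrun.prob_succ hγ (by omega) (fun h hh s b => hrun.prob_pos hγ (by omega) hh s b) hh]
      rfl
    · rw [← hx]
      have e1 : x / √(x / y) = √(x * y) := by
        rw [div_eq_iff hγ.ne', ← Real.sqrt_mul (by positivity),
          show x * y * (x / y) = x ^ 2 by field_simp, Real.sqrt_sq hx0.le]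
      have e2 : √(x / y) * y = √(x * y) := by
        rw [show x * y = (x / y) * y ^ 2 by field_simp, Real.sqrt_mul (by positivity),
          Real.sqrt_sq hy0.le]
      have e3 : √(x / y) * ((K + 1 : ℕ) : ℝ) * (H : ℝ) ^ 2 / 2 ≤ √(x / y) * y := by
        rw [hy, mul_assoc, mul_div_assoc]
        refine mul_le_mul_of_nonneg_left ?_ hγ.le
        push_cast
        nlinarith [sq_nonneg (H : ℝ)]
      linarith

theorem RunsOptimisticPO₂.sum_occ_loss_le [Nonempty B] (hK : 1 ≤ K) (hH : 1 ≤ H)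
    (hrun : RunsOptimisticPO₂ H K δ (√(Real.log (Fintype.card B) / ((K : ℝ) * (H : ℝ) ^ 2)))
      s₀ D μ ν)
    (ν' : Policy S₂ B) (P : Transition S₂ B) (s : S₂) :
    ∑ k ∈ Finset.Icc 1 K, ∑ h ∈ Finset.range H, ∑ s₂, occ P.prob ν' s h s₂ *
        ∑ b, ((ν k).prob h s₂ b - ν'.prob h s₂ b) * D.loss₂ H K δ s₀ (μ k) (ν k) k h s₂ b ≤
      H * (2 * √(Real.log (Fintype.card B) * (K * H ^ 2))) := by
  rw [Finset.sum_comm]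
  have : ∀ h ∈ Finset.range H, ∑ k ∈ Finset.Icc 1 K, ∑ s₂, occ P.prob ν' s h s₂ *
        ∑ b, ((ν k).prob h s₂ b - ν'.prob h s₂ b) * D.loss₂ H K δ s₀ (μ k) (ν k) k h s₂ b ≤
      2 * √(Real.log (Fintype.card B) * (K * H ^ 2)) := by
    intro h hh
    rw [Finset.sum_comm]
    simp only [← Finset.mul_sum]
    refine (Finset.sum_le_sum fun s₂ _ => mul_le_mul_of_nonneg_left
      (hrun.sum_loss_le hK hH ν' (Finset.mem_range.1 hh) s₂)
      (occ_nonneg P.nonneg ν' s h s₂)).trans_eq ?_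
    rw [← Finset.sum_mul, sum_occ_eq_one, one_mul]
  refine (Finset.sum_le_sum this).trans_eq ?_
  simp

end MirrorDescent

section Counts

variable {S₁ S₂ A B : Type*} [Fintype S₁] [Fintype S₂] [Fintype A] [Fintype B]

open scoped Classical in
theorem PlayLog.count_eq_sum (D : PlayLog S₁ S₂ A B) (k h : ℕ) (s : S₁ × S₂) (a : A) (b : B) :
    D.count k h s a b = ∑ t ∈ Finset.Icc 1 k,
      if D.state t h = s ∧ D.act₁ t h = a ∧ D.act₂ t h = b then 1 else 0 := by
  rw [PlayLog.count, Finset.card_filter]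

open scoped Classical in
theorem PlayLog.count₁_eq_sum (D : PlayLog S₁ S₂ A B) (k h : ℕ) (s : S₁) (a : A) :
    D.count₁ k h s a = ∑ t ∈ Finset.Icc 1 k,
      if (D.state t h).1 = s ∧ D.act₁ t h = a then 1 else 0 := by
  rw [PlayLog.count₁, Finset.card_filter]

open scoped Classical in
theorem PlayLog.count₂_eq_sum (D : PlayLog S₁ S₂ A B) (k h : ℕ) (s : S₂) (b : B) :
    D.count₂ k h s b = ∑ t ∈ Finset.Icc 1 k,
      if (D.state t h).2 = s ∧ D.act₂ t h = b then 1 else 0 := by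
  rw [PlayLog.count₂, Finset.card_filter]

theorem sum_Icc_one_mono (f : ℕ → ℕ) {j k : ℕ} (hjk : j ≤ k) :
    ∑ t ∈ Finset.Icc 1 j, f t ≤ ∑ t ∈ Finset.Icc 1 k, f t :=
  Finset.sum_le_sum_of_subset (Finset.Icc_subset_Icc_right hjk)

theorem sqrt_div_max_le {c : ℝ} (hc : 0 ≤ c) {j k : ℕ} (hjk : j ≤ k) :
    √(c / max (k : ℝ) 1) ≤ √c * (1 / √(max (j : ℝ) 1)) := by
  rw [mul_one_div, ← Real.sqrt_div hc]
  have : (j : ℝ) ≤ k := by exact_mod_cast hjk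
  gcongr

theorem one_div_sqrt_max_mem (n : ℕ) : 1 / √(max (n : ℝ) 1) ∈ Set.Icc (0 : ℝ) 1 := by
  refine ⟨by positivity, ?_⟩
  rw [div_le_one (Real.sqrt_pos.2 (by positivity))]
  exact Real.one_le_sqrt.2 (le_max_right _ _)

open scoped Classical in
theorem PlayLog.sum_one_div_sqrt_count (D : PlayLog S₁ S₂ A B) (h K : ℕ) :
    ∑ k ∈ Finset.Icc 1 K,
      1 / √(max (D.count (k - 1) h (D.state k h) (D.act₁ k h) (D.act₂ k h) : ℝ) 1) ≤
      3 * √(Fintype.card S₁ * Fintype.card S₂ * Fintype.card A * Fintype.card B * K) := by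
  refine (sum_one_div_sqrt_count_le (X := (S₁ × S₂) × A × B)
    (fun k => (D.state k h, D.act₁ k h, D.act₂ k h))
    (fun k x => D.count k h x.1 x.2.1 x.2.2) (fun x => by simp [PlayLog.count])
    (fun k x => ?_) K).trans_eq ?_
  · rw [D.count_eq_sum, Finset.sum_Icc_succ_top (by omega), ← D.count_eq_sum]
    obtain ⟨s, a, b⟩ := x
    simp only [Prod.mk.injEq]
  · simp only [Fintype.card_prod]
    push_cast
    ring_nf

open scoped Classical in
theorem PlayLog.sum_one_div_sqrt_count₁ (D : PlayLog S₁ S₂ A B) (h K : ℕ) :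
    ∑ k ∈ Finset.Icc 1 K,
      1 / √(max (D.count₁ (k - 1) h (D.state k h).1 (D.act₁ k h) : ℝ) 1) ≤
      3 * √(Fintype.card S₁ * Fintype.card A * K) := by
  refine (sum_one_div_sqrt_count_le (X := S₁ × A)
    (fun k => ((D.state k h).1, D.act₁ k h))
    (fun k x => D.count₁ k h x.1 x.2) (fun x => by simp [PlayLog.count₁])
    (fun k x => ?_) K).trans_eq ?_
  · rw [D.count₁_eq_sum, Finset.sum_Icc_succ_top (by omega), ← D.count₁_eq_sum]
    simp [Prod.ext_iff]
  · simp only [Fintype.card_prod]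
    push_cast
    rfl

open scoped Classical in
theorem PlayLog.sum_one_div_sqrt_count₂ (D : PlayLog S₁ S₂ A B) (h K : ℕ) :
    ∑ k ∈ Finset.Icc 1 K,
      1 / √(max (D.count₂ (k - 1) h (D.state k h).2 (D.act₂ k h) : ℝ) 1) ≤
      3 * √(Fintype.card S₂ * Fintype.card B * K) := by
  refine (sum_one_div_sqrt_count_le (X := S₂ × B)
    (fun k => ((D.state k h).2, D.act₂ k h))
    (fun k x => D.count₂ k h x.1 x.2) (fun x => by simp [PlayLog.count₂])
    (fun k x => ?_) K).trans_eq ?_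
  · rw [D.count₂_eq_sum, Finset.sum_Icc_succ_top (by omega), ← D.count₂_eq_sum]
    simp [Prod.ext_iff]
  · simp only [Fintype.card_prod]
    push_cast
    rfl

end Counts

/-! ### Probability that the estimates are accurate -/

section GoodEvent

variable {S₁ S₂ A B Ω : Type*} {mΩ : MeasurableSpace Ω}
variable [Fintype S₁] [Fintype S₂] [Fintype A] [Fintype B]

/-- For the logarithmic factor `L`, the expected confidence widths at step `h` are controlled by
the realized ones. -/
structure Game.WidthsOK (G : Game S₁ S₂ A B) (D : PlayLog S₁ S₂ A B) (K : ℕ) (L : ℝ)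
    (μ : ℕ → Policy S₁ A) (ν : ℕ → Policy S₂ B) (h : ℕ) : Prop where
  joint : ∑ k ∈ Finset.Icc 1 K, G.expect (μ k) (ν k) h
      (fun s a b => 1 / √(max (D.count (k - 1) h s a b : ℝ) 1)) ≤
    ∑ k ∈ Finset.Icc 1 K,
      1 / √(max (D.count (k - 1) h (D.state k h) (D.act₁ k h) (D.act₂ k h) : ℝ) 1) + √(K * L)
  fst : ∑ k ∈ Finset.Icc 1 K, G.expect (μ k) (ν k) h
      (fun s a _ => 1 / √(max (D.count₁ (k - 1) h s.1 a : ℝ) 1)) ≤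
    ∑ k ∈ Finset.Icc 1 K,
      1 / √(max (D.count₁ (k - 1) h (D.state k h).1 (D.act₁ k h) : ℝ) 1) + √(K * L)
  snd : ∑ k ∈ Finset.Icc 1 K, G.expect (μ k) (ν k) h
      (fun s _ b => 1 / √(max (D.count₂ (k - 1) h s.2 b : ℝ) 1)) ≤
    ∑ k ∈ Finset.Icc 1 K,
      1 / √(max (D.count₂ (k - 1) h (D.state k h).2 (D.act₂ k h) : ℝ) 1) + √(K * L)

variable {Pr : Measure Ω} [IsProbabilityMeasure Pr] {G : Game S₁ S₂ A B} {H K : ℕ}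
  {𝓕 : Filtration ℕ mΩ} {D : Ω → PlayLog S₁ S₂ A B} {μ : ℕ → Ω → Policy S₁ A}
  {ν : ℕ → Ω → Policy S₂ B}

theorem measureReal_le_of_subset_union {S E₁ E₂ E₃ : Set Ω} {p₁ p₂ p₃ : ℝ}
    (hS : S ⊆ E₁ ∪ (E₂ ∪ E₃)) (h₁ : Pr.real E₁ ≤ p₁) (h₂ : Pr.real E₂ ≤ p₂)
    (h₃ : Pr.real E₃ ≤ p₃) : Pr.real S ≤ p₁ + (p₂ + p₃) :=
  (measureReal_mono hS).trans ((measureReal_union_le _ _).trans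
    (add_le_add h₁ ((measureReal_union_le _ _).trans (add_le_add h₂ h₃))))

open scoped Classical in
theorem PlayLog.rHat_eq (D : PlayLog S₁ S₂ A B) (k h : ℕ) (s : S₁ × S₂) (a : A) (b : B) :
    D.rHat k h s a b = (∑ t ∈ Finset.Icc 1 k,
      (if D.state t h = s ∧ D.act₁ t h = a ∧ D.act₂ t h = b then (1 : ℝ) else 0) * D.rew t h) /
      max (∑ t ∈ Finset.Icc 1 k,
        (if D.state t h = s ∧ D.act₁ t h = a ∧ D.act₂ t h = b then (1 : ℝ) else 0)) 1 := by
  rw [PlayLog.rHat, D.count_eq_sum, Finset.sum_filter]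
  push_cast
  simp only [ite_mul, one_mul, zero_mul]

open scoped Classical in
theorem PlayLog.PHat₁_eq (D : PlayLog S₁ S₂ A B) {k : ℕ} (hk : k ≠ 0) (h : ℕ) (s : S₁) (a : A)
    (s' : S₁) :
    D.PHat₁ k h s a s' = (∑ t ∈ Finset.Icc 1 k,
      (if (D.state t h).1 = s ∧ D.act₁ t h = a then (1 : ℝ) else 0) *
        (if (D.state t (h + 1)).1 = s' then 1 else 0)) /
      max (∑ t ∈ Finset.Icc 1 k,
        (if (D.state t h).1 = s ∧ D.act₁ t h = a then (1 : ℝ) else 0)) 1 := by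
  rw [PlayLog.PHat₁, if_neg hk, D.count₁_eq_sum, Finset.card_filter]
  push_cast
  simp only [ite_mul, one_mul, zero_mul, ← ite_and, and_assoc]

open scoped Classical in
theorem PlayLog.PHat₂_eq (D : PlayLog S₁ S₂ A B) {k : ℕ} (hk : k ≠ 0) (h : ℕ) (s : S₂) (b : B)
    (s' : S₂) :
    D.PHat₂ k h s b s' = (∑ t ∈ Finset.Icc 1 k,
      (if (D.state t h).2 = s ∧ D.act₂ t h = b then (1 : ℝ) else 0) *
        (if (D.state t (h + 1)).2 = s' then 1 else 0)) /
      max (∑ t ∈ Finset.Icc 1 k,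
        (if (D.state t h).2 = s ∧ D.act₂ t h = b then (1 : ℝ) else 0)) 1 := by
  rw [PlayLog.PHat₂, if_neg hk, D.count₂_eq_sum, Finset.card_filter]
  push_cast
  simp only [ite_mul, one_mul, zero_mul, ← ite_and, and_assoc]

theorem Plays.measureReal_reward_le (hP : Plays Pr G H K 𝓕 D μ ν) {δ : ℝ}
    (hL : 1 ≤ Real.log ((Fintype.card S₁ : ℝ) * Fintype.card S₂ * Fintype.card A *
      Fintype.card B * H * K / δ)) :
    Pr.real {ω | ∃ h < H, ∃ s a b, ∃ k ∈ Finset.Icc 1 K,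
      (D ω).bonusR H K δ k h s a b < |(D ω).rHat k h s a b - G.r h s a b|} ≤
      (H * (Fintype.card S₁ * Fintype.card S₂ * (Fintype.card A * Fintype.card B))) *
        (2 * K ^ 2 * Real.exp (-(8 * Real.log ((Fintype.card S₁ : ℝ) * Fintype.card S₂ *
          Fintype.card A * Fintype.card B * H * K / δ)))) := by
  classical
  let E : Fin H × (S₁ × S₂) × A × B → Set Ω := fun i => {ω | ∃ k ∈ Finset.Icc 1 K,
    (D ω).bonusR H K δ k i.1 i.2.1 i.2.2.1 i.2.2.2 <
      |(D ω).rHat k i.1 i.2.1 i.2.2.1 i.2.2.2 - G.r i.1 i.2.1 i.2.2.1 i.2.2.2|}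
  refine (measureReal_le_card_mul (E := E) (p := 2 * K ^ 2 * Real.exp (-(8 * Real.log
    ((Fintype.card S₁ : ℝ) * Fintype.card S₂ * Fintype.card A * Fintype.card B * H * K / δ))))
    ?_ fun i => ?_).trans_eq ?_
  · rintro ω ⟨h, hh, s, a, b, hk⟩
    exact Set.mem_iUnion.2 ⟨(⟨h, hh⟩, s, a, b), hk⟩
  · obtain ⟨⟨h, hh⟩, s, a, b⟩ := i
    have := (hP.observedMean_rew hh s a b).measureReal_abs_le
      ⟨G.r_nonneg _ _ _ _, G.r_le_one _ _ _ _⟩ hL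
    refine le_trans (measureReal_mono ?_) this
    rintro ω ⟨k, hk, hlt⟩
    refine ⟨k, hk, ?_⟩
    rw [PlayLog.rHat_eq, PlayLog.bonusR, PlayLog.count_eq_sum] at hlt
    push_cast at hlt
    exact hlt
  · simp only [Fintype.card_prod, Fintype.card_fin]
    push_cast
    rfl

theorem Plays.measureReal_trans₁_le (hP : Plays Pr G H K 𝓕 D μ ν) {δ : ℝ}
    (hL : Real.log 2 ≤ Real.log (2 * Fintype.card S₁ * Fintype.card A * H * K / δ)) :
    Pr.real {ω | ∃ h < H, ∃ s a, ∃ k ∈ Finset.Icc 1 K,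
      (D ω).radius₁ H K δ k h s a < ∑ s', |(D ω).PHat₁ k h s a s' - G.P₁.prob h s a s'|} ≤
      (H * (Fintype.card S₁ * Fintype.card A)) * (K ^ 2 *
        (2 * Real.exp (-Real.log (2 * Fintype.card S₁ * Fintype.card A * H * K / δ))) ^ 2) := by
  classical
  let E : Fin H × S₁ × A → Set Ω := fun i => {ω | ∃ k ∈ Finset.Icc 1 K,
    (D ω).radius₁ H K δ k i.1 i.2.1 i.2.2 <
      ∑ s', |(D ω).PHat₁ k i.1 i.2.1 i.2.2 s' - G.P₁.prob i.1 i.2.1 i.2.2 s'|}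
  refine (measureReal_le_card_mul (E := E) (p := K ^ 2 * (2 * Real.exp (-Real.log
    (2 * Fintype.card S₁ * Fintype.card A * H * K / δ))) ^ 2) ?_ fun i => ?_).trans_eq ?_
  · rintro ω ⟨h, hh, s, a, hk⟩
    exact Set.mem_iUnion.2 ⟨(⟨h, hh⟩, s, a), hk⟩
  · obtain ⟨⟨h, hh⟩, s, a⟩ := i
    have : Nonempty S₁ := ⟨s⟩
    refine le_trans (measureReal_mono ?_) (measureReal_l1_le (G.P₁.nonneg h s a)
      (G.P₁.sum_eq_one h s a) (fun U => hP.observedMean_trans₁ hh s a U) hL)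
    rintro ω ⟨k, hk, hlt⟩
    refine ⟨k, hk, ?_⟩
    have hk0 : k ≠ 0 := (Nat.lt_of_lt_of_le Nat.zero_lt_one (Finset.mem_Icc.1 hk).1).ne'
    simp only [PlayLog.PHat₁_eq _ hk0, PlayLog.radius₁, PlayLog.count₁_eq_sum] at hlt
    push_cast at hlt
    exact hlt
  · simp only [Fintype.card_prod, Fintype.card_fin]
    push_cast
    rfl

theorem Plays.measureReal_trans₂_le (hP : Plays Pr G H K 𝓕 D μ ν) {δ : ℝ}
    (hL : Real.log 2 ≤ Real.log (2 * Fintype.card S₂ * Fintype.card B * H * K / δ)) :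
    Pr.real {ω | ∃ h < H, ∃ s b, ∃ k ∈ Finset.Icc 1 K,
      (D ω).radius₂ H K δ k h s b < ∑ s', |(D ω).PHat₂ k h s b s' - G.P₂.prob h s b s'|} ≤
      (H * (Fintype.card S₂ * Fintype.card B)) * (K ^ 2 *
        (2 * Real.exp (-Real.log (2 * Fintype.card S₂ * Fintype.card B * H * K / δ))) ^ 2) := by
  classical
  let E : Fin H × S₂ × B → Set Ω := fun i => {ω | ∃ k ∈ Finset.Icc 1 K,
    (D ω).radius₂ H K δ k i.1 i.2.1 i.2.2 <
      ∑ s', |(D ω).PHat₂ k i.1 i.2.1 i.2.2 s' - G.P₂.prob i.1 i.2.1 i.2.2 s'|}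
  refine (measureReal_le_card_mul (E := E) (p := K ^ 2 * (2 * Real.exp (-Real.log
    (2 * Fintype.card S₂ * Fintype.card B * H * K / δ))) ^ 2) ?_ fun i => ?_).trans_eq ?_
  · rintro ω ⟨h, hh, s, b, hk⟩
    exact Set.mem_iUnion.2 ⟨(⟨h, hh⟩, s, b), hk⟩
  · obtain ⟨⟨h, hh⟩, s, b⟩ := i
    have : Nonempty S₂ := ⟨s⟩
    refine le_trans (measureReal_mono ?_) (measureReal_l1_le (G.P₂.nonneg h s b)
      (G.P₂.sum_eq_one h s b) (fun U => hP.observedMean_trans₂ hh s b U) hL)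
    rintro ω ⟨k, hk, hlt⟩
    refine ⟨k, hk, ?_⟩
    have hk0 : k ≠ 0 := (Nat.lt_of_lt_of_le Nat.zero_lt_one (Finset.mem_Icc.1 hk).1).ne'
    simp only [PlayLog.PHat₂_eq _ hk0, PlayLog.radius₂, PlayLog.count₂_eq_sum] at hlt
    push_cast at hlt
    exact hlt
  · simp only [Fintype.card_prod, Fintype.card_fin]
    push_cast
    rfl

/-- Azuma–Hoeffding for a function of the state and actions at step `h` that is determined by the
past episodes. -/
theorem Plays.measureReal_expect_le (hP : Plays Pr G H K 𝓕 D μ ν) (hK : 1 ≤ K) {h : ℕ}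
    (hh : h < H) {L : ℝ} (hL : 0 ≤ L) (f : ℕ → Ω → S₁ × S₂ → A → B → ℝ)
    (hf : ∀ k ω s a b, f k ω s a b ∈ Set.Icc (0 : ℝ) 1)
    (hfm : ∀ k ∈ Finset.Icc 1 K, ∀ s a b, Measurable[𝓕 (k - 1)] fun ω => f k ω s a b) :
    Pr.real {ω | ∑ k ∈ Finset.Icc 1 K,
        f k ω ((D ω).state k h) ((D ω).act₁ k h) ((D ω).act₂ k h) + √(K * L) <
      ∑ k ∈ Finset.Icc 1 K, G.expect (μ k ω) (ν k ω) h (f k ω)} ≤ Real.exp (-(2 * L)) := by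
  have hK0 : (0 : ℝ) < K := by exact_mod_cast hK
  have h1 := (hP.observedMean_expect hh f hf hfm).one_sub.measureReal_le (n := K) le_rfl
    (Real.sqrt_nonneg (L / K))
  have e1 : 2 * (K : ℝ) * √(L / K) ^ 2 = 2 * L := by
    rw [Real.sq_sqrt (by positivity)]
    field_simp
  have e2 : (K : ℝ) * √(L / K) = √(K * L) := by
    rw [show (K : ℝ) * L = K ^ 2 * (L / K) by field_simp, Real.sqrt_mul (by positivity),
      Real.sqrt_sq hK0.le]
  rw [e1, e2] at h1
  refine le_trans (measureReal_mono ?_) h1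
  intro ω hω
  refine ⟨by simp, ?_⟩
  rw [Set.mem_ofPred_eq] at hω
  simp only [one_mul, Finset.sum_sub_distrib]
  linarith

open scoped Classical in
theorem Plays.measurable_count (hP : Plays Pr G H K 𝓕 D μ ν) {k h : ℕ} (hk : k ≤ K) (hh : h < H)
    (s : S₁ × S₂) (a : A) (b : B) :
    Measurable[𝓕 k] fun ω => 1 / √(max ((D ω).count k h s a b : ℝ) 1) := by
  simp only [PlayLog.count_eq_sum]
  push_cast
  refine (Measurable.max (Finset.measurable_sum _ fun t ht => ?_) measurable_const).sqrt.const_div _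
  have ht' : t ∈ Finset.Icc 1 K := Finset.Icc_subset_Icc_right hk ht
  exact (measurable_ite_one (hP.measurableSet_visit ht' hh s a b)).mono
    (𝓕.mono (Finset.mem_Icc.1 ht).2) le_rfl

open scoped Classical in
theorem Plays.measurable_count₁ (hP : Plays Pr G H K 𝓕 D μ ν) {k h : ℕ} (hk : k ≤ K) (hh : h < H)
    (s : S₁) (a : A) :
    Measurable[𝓕 k] fun ω => 1 / √(max ((D ω).count₁ k h s a : ℝ) 1) := by
  simp only [PlayLog.count₁_eq_sum]
  push_cast
  refine (Measurable.max (Finset.measurable_sum _ fun t ht => ?_) measurable_const).sqrt.const_div _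
  have ht' : t ∈ Finset.Icc 1 K := Finset.Icc_subset_Icc_right hk ht
  exact (measurable_ite_one (hP.postAction_le ht' hh _ (measurableSet_postAction_state 𝓕 D t h
    (fun s' a' _ => s'.1 = s ∧ a' = a)))).mono (𝓕.mono (Finset.mem_Icc.1 ht).2) le_rfl

open scoped Classical in
theorem Plays.measurable_count₂ (hP : Plays Pr G H K 𝓕 D μ ν) {k h : ℕ} (hk : k ≤ K) (hh : h < H)
    (s : S₂) (b : B) :
    Measurable[𝓕 k] fun ω => 1 / √(max ((D ω).count₂ k h s b : ℝ) 1) := by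
  simp only [PlayLog.count₂_eq_sum]
  push_cast
  refine (Measurable.max (Finset.measurable_sum _ fun t ht => ?_) measurable_const).sqrt.const_div _
  have ht' : t ∈ Finset.Icc 1 K := Finset.Icc_subset_Icc_right hk ht
  exact (measurable_ite_one (hP.postAction_le ht' hh _ (measurableSet_postAction_state 𝓕 D t h
    (fun s' _ b' => s'.2 = s ∧ b' = b)))).mono (𝓕.mono (Finset.mem_Icc.1 ht).2) le_rfl

theorem Plays.measureReal_widths_le (hP : Plays Pr G H K 𝓕 D μ ν) (hK : 1 ≤ K) {L : ℝ}
    (hL : 0 ≤ L) :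
    Pr.real {ω | ∃ h < H, ¬ G.WidthsOK (D ω) K L (fun k => μ k ω) (fun k => ν k ω) h} ≤
      H * (3 * Real.exp (-(2 * L))) := by
  refine (measureReal_le_card_mul (ι := Fin H) (E := fun h => {ω |
    ¬ G.WidthsOK (D ω) K L (fun k => μ k ω) (fun k => ν k ω) h}) ?_
    (p := 3 * Real.exp (-(2 * L))) fun h => ?_).trans_eq (by simp)
  · rintro ω ⟨h, hh, hω⟩
    exact Set.mem_iUnion.2 ⟨⟨h, hh⟩, hω⟩
  · have hle : ∀ k ∈ Finset.Icc 1 K, k - 1 ≤ K := fun k hk =>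
      (Nat.sub_le k 1).trans (Finset.mem_Icc.1 hk).2
    have h1 := hP.measureReal_expect_le hK h.2 hL
      (fun k ω s a b => 1 / √(max ((D ω).count (k - 1) h s a b : ℝ) 1))
      (fun _ _ _ _ _ => one_div_sqrt_max_mem _)
      (fun k hk s a b => hP.measurable_count (hle k hk) h.2 s a b)
    have h2 := hP.measureReal_expect_le hK h.2 hL
      (fun k ω s a _ => 1 / √(max ((D ω).count₁ (k - 1) h s.1 a : ℝ) 1))
      (fun _ _ _ _ _ => one_div_sqrt_max_mem _)
      (fun k hk s a _ => hP.measurable_count₁ (hle k hk) h.2 s.1 a)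
    have h3 := hP.measureReal_expect_le hK h.2 hL
      (fun k ω s _ b => 1 / √(max ((D ω).count₂ (k - 1) h s.2 b : ℝ) 1))
      (fun _ _ _ _ _ => one_div_sqrt_max_mem _)
      (fun k hk s _ b => hP.measurable_count₂ (hle k hk) h.2 s.2 b)
    refine (measureReal_le_of_subset_union ?_ h1 h2 h3).trans_eq (by ring)
    intro ω hω
    by_contra hc
    simp only [Set.mem_union, not_or, Set.mem_ofPred_eq, not_lt] at hc
    exact hω ⟨hc.1, hc.2.1, hc.2.2⟩

end GoodEvent

/-! ### The regret bound -/

section Regret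

variable {S₁ S₂ A B : Type*} [Fintype S₁] [Fintype S₂] [Fintype A] [Fintype B]

theorem three_mul_sqrt_add_sqrt_le {x l : ℝ} (K : ℕ) (hx : 1 ≤ x) (hl : 1 ≤ l) :
    3 * √(x * K) + √(K * l) ≤ 4 * √l * (√x * √K) := by
  have hx' := Real.one_le_sqrt.2 hx
  have hl' := Real.one_le_sqrt.2 hl
  have hK := Real.sqrt_nonneg (K : ℝ)
  rw [Real.sqrt_mul (by linarith), Real.sqrt_mul (Nat.cast_nonneg K)]
  have h1 : √x * √K ≤ √l * (√x * √K) := le_mul_of_one_le_left (by positivity) hl'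
  have h2 : √K * √l ≤ √l * (√x * √K) := by
    rw [mul_comm]
    exact mul_le_mul_of_nonneg_left (le_mul_of_one_le_left hK hx') (by positivity)
  linarith

theorem sqrt_sq_mul_mul_sqrt {n a H : ℝ} (K : ℝ) (hn : 0 ≤ n) (ha : 0 ≤ a) (hH : 0 ≤ H) :
    √(n ^ 2 * a * H ^ 3) * √(K * H) = n * √a * H ^ 2 * √K := by
  rw [← Real.sqrt_mul (by positivity), show n ^ 2 * a * H ^ 3 * (K * H) = (n * H ^ 2) ^ 2 * (a * K)
    by ring, Real.sqrt_mul (by positivity), Real.sqrt_sq (by positivity), Real.sqrt_mul ha]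
  ring

theorem Policy.nonempty [Nonempty B] (S : Type*) : Nonempty (Policy S B) :=
  ⟨{ prob := fun _ _ _ => 1 / Fintype.card B
     nonneg := fun _ _ _ => by positivity
     sum_eq_one := fun _ _ => by simp }⟩

variable {G : Game S₁ S₂ A B} {D : PlayLog S₁ S₂ A B} {H K : ℕ} {δ : ℝ} {μ : ℕ → Policy S₁ A}
  {ν : ℕ → Policy S₂ B} {L : ℝ}

theorem Game.card_fst_pos (G : Game S₁ S₂ A B) : 0 < Fintype.card S₁ :=
  Fintype.card_pos_iff.2 ⟨G.init.1⟩

theorem Game.card_snd_pos (G : Game S₁ S₂ A B) : 0 < Fintype.card S₂ :=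
  Fintype.card_pos_iff.2 ⟨G.init.2⟩

/-- The accumulated expected bonus at one step of the episodes. Counting the visits only up to the
previous episode makes the bonus larger and determined by the past. -/
theorem Game.WidthsOK.sum_expect_le (hw : ∀ h < H, G.WidthsOK D K L μ ν h) [Nonempty A] [Nonempty B]
    (hL : L = Real.log ((Fintype.card S₁ : ℝ) * Fintype.card S₂ * Fintype.card A *
      Fintype.card B * H * K / δ)) (hL1 : 1 ≤ L) {l₁ l₂ : ℝ}
    (hl₁ : l₁ = Real.log (2 * Fintype.card S₁ * Fintype.card A * H * K / δ))
    (hl₂ : l₂ = Real.log (2 * Fintype.card S₂ * Fintype.card B * H * K / δ))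
    (h₁0 : 0 ≤ l₁) (h₂0 : 0 ≤ l₂) (h₁ : l₁ ≤ 2 * L) (h₂ : l₂ ≤ 2 * L) {h : ℕ} (hh : h < H) :
    ∑ k ∈ Finset.Icc 1 K, G.expect (μ k) (ν k) h (fun s a b => 2 * D.bonusR H K δ k h s a b +
        (3 * H * D.radius₁ H K δ k h s.1 a + 2 * H * D.radius₂ H K δ k h s.2 b)) ≤
      16 * L * (√(Fintype.card S₁ * Fintype.card S₂ * Fintype.card A * Fintype.card B) * √K) +
      (24 * L * (H * (Fintype.card S₁ * √(Fintype.card A) * √K)) +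
       16 * L * (H * (Fintype.card S₂ * √(Fintype.card B) * √K))) := by
  have hA : (1 : ℝ) ≤ Fintype.card A := by exact_mod_cast Fintype.card_pos
  have hB : (1 : ℝ) ≤ Fintype.card B := by exact_mod_cast Fintype.card_pos
  have hS₁ : (1 : ℝ) ≤ Fintype.card S₁ := by exact_mod_cast G.card_fst_pos
  have hS₂ : (1 : ℝ) ≤ Fintype.card S₂ := by exact_mod_cast G.card_snd_pos
  have hL0 : 0 ≤ L := by linarith
  have hsL : √L * √L = L := Real.mul_self_sqrt hL0
  have hexp : ∀ k ∈ Finset.Icc 1 K, G.expect (μ k) (ν k) h (fun s a b =>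
      2 * D.bonusR H K δ k h s a b +
        (3 * H * D.radius₁ H K δ k h s.1 a + 2 * H * D.radius₂ H K δ k h s.2 b)) ≤
      2 * √(4 * L) * G.expect (μ k) (ν k) h
        (fun s a b => 1 / √(max (D.count (k - 1) h s a b : ℝ) 1)) +
      (3 * H * √(2 * Fintype.card S₁ * l₁) * G.expect (μ k) (ν k) h
        (fun s a _ => 1 / √(max (D.count₁ (k - 1) h s.1 a : ℝ) 1)) +
       2 * H * √(2 * Fintype.card S₂ * l₂) * G.expect (μ k) (ν k) h
        (fun s _ b => 1 / √(max (D.count₂ (k - 1) h s.2 b : ℝ) 1))) := by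
    intro k hk
    rw [← G.expect_const_mul, ← G.expect_const_mul, ← G.expect_const_mul, ← G.expect_add,
      ← G.expect_add]
    refine G.expect_mono _ _ _ fun s a b => ?_
    have e1 : D.bonusR H K δ k h s a b ≤
        √(4 * L) * (1 / √(max (D.count (k - 1) h s a b : ℝ) 1)) := by
      rw [PlayLog.bonusR, ← hL]
      refine sqrt_div_max_le (by positivity) ?_
      classical
      rw [D.count_eq_sum, D.count_eq_sum]
      exact sum_Icc_one_mono _ (Nat.sub_le k 1)
    have e2 : D.radius₁ H K δ k h s.1 a ≤
        √(2 * Fintype.card S₁ * l₁) * (1 / √(max (D.count₁ (k - 1) h s.1 a : ℝ) 1)) := by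
      rw [PlayLog.radius₁, ← hl₁]
      refine sqrt_div_max_le (by positivity) ?_
      classical
      rw [D.count₁_eq_sum, D.count₁_eq_sum]
      exact sum_Icc_one_mono _ (Nat.sub_le k 1)
    have e3 : D.radius₂ H K δ k h s.2 b ≤
        √(2 * Fintype.card S₂ * l₂) * (1 / √(max (D.count₂ (k - 1) h s.2 b : ℝ) 1)) := by
      rw [PlayLog.radius₂, ← hl₂]
      refine sqrt_div_max_le (by positivity) ?_
      classical
      rw [D.count₂_eq_sum, D.count₂_eq_sum]
      exact sum_Icc_one_mono _ (Nat.sub_le k 1)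
    have e2' := mul_le_mul_of_nonneg_left e2 (show (0 : ℝ) ≤ 3 * H by positivity)
    have e3' := mul_le_mul_of_nonneg_left e3 (show (0 : ℝ) ≤ 2 * H by positivity)
    simp only [mul_assoc] at e1 e2' e3' ⊢
    linarith
  refine (Finset.sum_le_sum hexp).trans ?_
  rw [Finset.sum_add_distrib, Finset.sum_add_distrib, ← Finset.mul_sum, ← Finset.mul_sum,
    ← Finset.mul_sum]
  have hsq : ∀ {n l : ℝ}, 0 ≤ n → l ≤ 2 * L → √(2 * n * l) ≤ 2 * (√n * √L) := by
    intro n l hn hl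
    have e : (2 : ℝ) * (√n * √L) = √(4 * (n * L)) := by
      rw [Real.sqrt_mul (by norm_num), Real.sqrt_mul hn, show (4 : ℝ) = 2 ^ 2 by norm_num,
        Real.sqrt_sq (by norm_num)]
    rw [e]
    exact Real.sqrt_le_sqrt (by nlinarith)
  refine add_le_add ?_ (add_le_add ?_ ?_)
  · have e1 := (hw h hh).joint.trans (add_le_add_left (D.sum_one_div_sqrt_count h K) _)
    have e2 := e1.trans (three_mul_sqrt_add_sqrt_le K (one_le_mul_of_one_le_of_one_le
      (one_le_mul_of_one_le_of_one_le (one_le_mul_of_one_le_of_one_le hS₁ hS₂) hA) hB) hL1)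
    refine (mul_le_mul_of_nonneg_left e2 (by positivity)).trans_eq ?_
    have e3 : √(4 * L) = 2 * √L := by
      rw [Real.sqrt_mul (by norm_num), show (4 : ℝ) = 2 ^ 2 by norm_num,
        Real.sqrt_sq (by norm_num)]
    rw [e3]
    linear_combination (16 * (√(Fintype.card S₁ * Fintype.card S₂ * Fintype.card A *
      Fintype.card B) * √K)) * hsL
  · have e1 := (hw h hh).fst.trans (add_le_add_left (D.sum_one_div_sqrt_count₁ h K) _)
    have e2 := e1.trans (three_mul_sqrt_add_sqrt_le K (one_le_mul_of_one_le_of_one_le hS₁ hA) hL1)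
    have e3 : 3 * (H : ℝ) * √(2 * Fintype.card S₁ * l₁) ≤
        3 * H * (2 * (√(Fintype.card S₁) * √L)) :=
      mul_le_mul_of_nonneg_left (hsq (by positivity) h₁) (by positivity)
    refine (mul_le_mul_of_nonneg_left e2 (by positivity)).trans
      ((mul_le_mul_of_nonneg_right e3 (by positivity)).trans_eq ?_)
    have e4 : √(Fintype.card S₁ : ℝ) * √(Fintype.card S₁) = Fintype.card S₁ :=
      Real.mul_self_sqrt (by positivity)
    rw [Real.sqrt_mul (Nat.cast_nonneg _)]
    calc 3 * (H : ℝ) * (2 * (√(Fintype.card S₁) * √L)) *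
          (4 * √L * (√(Fintype.card S₁) * √(Fintype.card A) * √K))
        = 24 * (√L * √L) * (H * ((√(Fintype.card S₁) * √(Fintype.card S₁)) *
          √(Fintype.card A) * √K)) := by ring
      _ = _ := by rw [hsL, e4]
  · have e1 := (hw h hh).snd.trans (add_le_add_left (D.sum_one_div_sqrt_count₂ h K) _)
    have e2 := e1.trans (three_mul_sqrt_add_sqrt_le K (one_le_mul_of_one_le_of_one_le hS₂ hB) hL1)
    have e3 : 2 * (H : ℝ) * √(2 * Fintype.card S₂ * l₂) ≤
        2 * H * (2 * (√(Fintype.card S₂) * √L)) :=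
      mul_le_mul_of_nonneg_left (hsq (by positivity) h₂) (by positivity)
    refine (mul_le_mul_of_nonneg_left e2 (by positivity)).trans
      ((mul_le_mul_of_nonneg_right e3 (by positivity)).trans_eq ?_)
    have e4 : √(Fintype.card S₂ : ℝ) * √(Fintype.card S₂) = Fintype.card S₂ :=
      Real.mul_self_sqrt (by positivity)
    rw [Real.sqrt_mul (Nat.cast_nonneg _)]
    calc 2 * (H : ℝ) * (2 * (√(Fintype.card S₂) * √L)) *
          (4 * √L * (√(Fintype.card S₂) * √(Fintype.card B) * √K))
        = 16 * (√L * √L) * (H * ((√(Fintype.card S₂) * √(Fintype.card S₂)) *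
          √(Fintype.card B) * √K)) := by ring
      _ = _ := by rw [hsL, e4]

/-- The regret bound on the event that all estimates are accurate. -/
theorem Game.regret₂_le [Nonempty A] [Nonempty B] (hH : 1 ≤ H) (hK : 1 ≤ K)
    (hest : ∀ k ∈ Finset.Icc 1 K, G.EstimatesOK D H K δ k)
    (hw : ∀ h < H, G.WidthsOK D K L μ ν h)
    (hrun : RunsOptimisticPO₂ H K δ (√(Real.log (Fintype.card B) / ((K : ℝ) * (H : ℝ) ^ 2)))
      G.init.1 D μ ν)
    (hL : L = Real.log ((Fintype.card S₁ : ℝ) * Fintype.card S₂ * Fintype.card A *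
      Fintype.card B * H * K / δ)) (hL1 : 1 ≤ L) {l₁ l₂ : ℝ}
    (hl₁ : l₁ = Real.log (2 * Fintype.card S₁ * Fintype.card A * H * K / δ))
    (hl₂ : l₂ = Real.log (2 * Fintype.card S₂ * Fintype.card B * H * K / δ))
    (h₁0 : 0 ≤ l₁) (h₂0 : 0 ≤ l₂) (h₁ : l₁ ≤ 2 * L) (h₂ : l₂ ≤ 2 * L)
    (hB : Real.log (Fintype.card B) ≤ L) :
    G.regret₂ H K μ ν ≤ 42 * L * (regretConst (Fintype.card S₁) (Fintype.card S₂)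
      (Fintype.card A) (Fintype.card B) H * √((K : ℝ) * H)) := by
  have hne : Nonempty (Policy S₂ B) := Policy.nonempty S₂
  have hKr : (1 : ℝ) ≤ K := by exact_mod_cast hK
  have hHr : (1 : ℝ) ≤ H := by exact_mod_cast hH
  have hA : (1 : ℝ) ≤ Fintype.card A := by exact_mod_cast Fintype.card_pos
  have hS₁ : (1 : ℝ) ≤ Fintype.card S₁ := by exact_mod_cast G.card_fst_pos
  rw [Game.regret₂, sub_le_comm]
  refine le_ciInf fun ν' => ?_
  rw [sub_le_comm, ← Finset.sum_sub_distrib]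
  have hk0 : ∀ k ∈ Finset.Icc 1 K, k ≠ 0 := fun k hk =>
    (Nat.lt_of_lt_of_le Nat.zero_lt_one (Finset.mem_Icc.1 hk).1).ne'
  have hstep := Finset.sum_le_sum fun k hk =>
    (hest k hk).value_sub_value_le (hk0 k hk) (μ k) (ν k) ν'
  rw [Finset.sum_add_distrib] at hstep
  have homd := hrun.sum_occ_loss_le hK hH ν' G.P₂ G.init.2
  rw [Finset.sum_comm] at hstep
  have hbon := Finset.sum_le_sum fun h (hh : h ∈ Finset.range H) =>
    Game.WidthsOK.sum_expect_le hw hL hL1 hl₁ hl₂ h₁0 h₂0 h₁ h₂ (Finset.mem_range.1 hh)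
  rw [Finset.sum_const, Finset.card_range, nsmul_eq_mul] at hbon
  set n₁ : ℝ := (Fintype.card S₁ : ℝ)
  set n₂ : ℝ := (Fintype.card S₂ : ℝ)
  set nA : ℝ := (Fintype.card A : ℝ)
  set nB : ℝ := (Fintype.card B : ℝ)
  have hn₂ : 0 ≤ n₂ := Nat.cast_nonneg _
  have hnB : 0 ≤ nB := Nat.cast_nonneg _
  have hL0 : 0 ≤ L := by linarith
  let T : ℝ := √((n₁ ^ 2 * nA + n₂ ^ 2 * nB) * H ^ 3) * √(K * H)
  have hT₁ : n₁ * √nA * H ^ 2 * √K ≤ T := by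
    rw [← sqrt_sq_mul_mul_sqrt K (by linarith) (by linarith) (by linarith)]
    refine mul_le_mul_of_nonneg_right (Real.sqrt_le_sqrt ?_) (Real.sqrt_nonneg _)
    exact mul_le_mul_of_nonneg_right (le_add_of_nonneg_right (by positivity)) (by positivity)
  have hT₂ : n₂ * √nB * H ^ 2 * √K ≤ T := by
    rw [← sqrt_sq_mul_mul_sqrt K hn₂ hnB (by linarith)]
    refine mul_le_mul_of_nonneg_right (Real.sqrt_le_sqrt ?_) (Real.sqrt_nonneg _)
    exact mul_le_mul_of_nonneg_right (le_add_of_nonneg_left (by positivity)) (by positivity)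
  have hR : √(n₁ * n₂ * nA * nB * H) * √(K * H) = H * (√(n₁ * n₂ * nA * nB) * √K) := by
    rw [Real.sqrt_mul (by positivity), Real.sqrt_mul (Nat.cast_nonneg K)]
    have := Real.mul_self_sqrt (show (0 : ℝ) ≤ H by linarith)
    linear_combination (√(n₁ * n₂ * nA * nB) * √K) * this
  have hO : H * (2 * √(Real.log nB * (K * H ^ 2))) ≤ 2 * L * T := by
    have e1 : √(Real.log nB * (K * H ^ 2)) ≤ L * (H * √K) := by
      rw [Real.sqrt_le_iff]
      refine ⟨by positivity, ?_⟩
      rw [mul_pow, mul_pow, Real.sq_sqrt (by linarith)]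
      have e2 : Real.log nB ≤ L ^ 2 := by nlinarith
      have e3 : (0 : ℝ) ≤ K * H ^ 2 := by positivity
      nlinarith [mul_le_mul_of_nonneg_right e2 e3]
    have e4 : H ^ 2 * √K ≤ T := by
      refine le_trans ?_ hT₁
      have e5 : (1 : ℝ) ≤ n₁ * √nA :=
        one_le_mul_of_one_le_of_one_le hS₁ (Real.one_le_sqrt.2 hA)
      rw [mul_assoc (n₁ * √nA)]
      exact le_mul_of_one_le_left (by positivity) e5
    calc (H : ℝ) * (2 * √(Real.log nB * (K * H ^ 2))) ≤ H * (2 * (L * (H * √K))) := by gcongr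
      _ = 2 * L * (H ^ 2 * √K) := by ring
      _ ≤ 2 * L * T := by gcongr
  have hfin : regretConst n₁ n₂ nA nB H * √((K : ℝ) * H) =
      T + H * (√(n₁ * n₂ * nA * nB) * √K) := by
    rw [regretConst, add_mul, hR]
  rw [hfin]
  have g₁ := mul_le_mul_of_nonneg_left hT₁ (show 0 ≤ 24 * L by positivity)
  have g₂ := mul_le_mul_of_nonneg_left hT₂ (show 0 ≤ 16 * L by positivity)
  have g₃ : 0 ≤ L * (H * (√(n₁ * n₂ * nA * nB) * √K)) := by positivity
  linarith

end Regret

section Probability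

variable {S₁ S₂ A B Ω : Type*} {mΩ : MeasurableSpace Ω}
variable [Fintype S₁] [Fintype S₂] [Fintype A] [Fintype B]
variable {Pr : Measure Ω} [IsProbabilityMeasure Pr] {G : Game S₁ S₂ A B} {H K : ℕ}
  {𝓕 : Filtration ℕ mΩ} {D : Ω → PlayLog S₁ S₂ A B} {μ : ℕ → Ω → Policy S₁ A}
  {ν : ℕ → Ω → Policy S₂ B}

/-- The union bound over the parameters of a transition confidence set. -/
theorem mul_sq_mul_le {H n K δ : ℝ} (hH : 1 ≤ H) (hn : 1 ≤ n) (hK : 0 < K) (hδ : 0 < δ) :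
    H * n * (K ^ 2 * (2 * Real.exp (-Real.log (2 * (n * H * K) / δ))) ^ 2) ≤ δ ^ 2 := by
  have hQ : 0 < n * H * K := by positivity
  rw [Real.exp_neg, Real.exp_log (by positivity),
    show 2 * (2 * (n * H * K) / δ)⁻¹ = δ / (n * H * K) by field_simp,
    show H * n * (K ^ 2 * (δ / (n * H * K)) ^ 2) = δ ^ 2 / (n * H) by field_simp]
  exact div_le_self (by positivity) (one_le_mul_of_one_le_of_one_le hn hH)

/-- All estimates are accurate with probability at least `1 - 4 δ`. -/
theorem Plays.measureReal_not_good_le [Nonempty A] [Nonempty B] (hP : Plays Pr G H K 𝓕 D μ ν)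
    (hH : 1 ≤ H) (hK : 1 ≤ K) {δ : ℝ} (hδ : 0 < δ) (hδ4 : δ < 1 / 4) {L : ℝ}
    (hL : L = Real.log ((Fintype.card S₁ : ℝ) * Fintype.card S₂ * Fintype.card A *
      Fintype.card B * H * K / δ)) (hL1 : 1 ≤ L)
    (hl₁ : Real.log 2 ≤ Real.log (2 * Fintype.card S₁ * Fintype.card A * H * K / δ))
    (hl₂ : Real.log 2 ≤ Real.log (2 * Fintype.card S₂ * Fintype.card B * H * K / δ)) :
    Pr.real {ω | ¬ ((∀ k ∈ Finset.Icc 1 K, G.EstimatesOK (D ω) H K δ k) ∧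
      ∀ h < H, G.WidthsOK (D ω) K L (fun k => μ k ω) (fun k => ν k ω) h)} ≤ 4 * δ := by
  have hKr : (1 : ℝ) ≤ K := by exact_mod_cast hK
  have hHr : (1 : ℝ) ≤ H := by exact_mod_cast hH
  have hA : (1 : ℝ) ≤ Fintype.card A := by exact_mod_cast Fintype.card_pos
  have hB : (1 : ℝ) ≤ Fintype.card B := by exact_mod_cast Fintype.card_pos
  have hS₁ : (1 : ℝ) ≤ Fintype.card S₁ := by exact_mod_cast G.card_fst_pos
  have hS₂ : (1 : ℝ) ≤ Fintype.card S₂ := by exact_mod_cast G.card_snd_pos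
  have b₀ := hP.measureReal_reward_le (hL ▸ hL1)
  have b₁ := hP.measureReal_trans₁_le hl₁
  have b₂ := hP.measureReal_trans₂_le hl₂
  have b₃ := hP.measureReal_widths_le hK (L := L) (by linarith)
  rw [← hL] at b₀
  set n₁ : ℝ := (Fintype.card S₁ : ℝ)
  set n₂ : ℝ := (Fintype.card S₂ : ℝ)
  set nA : ℝ := (Fintype.card A : ℝ)
  set nB : ℝ := (Fintype.card B : ℝ)
  have c₁ := mul_sq_mul_le hHr (one_le_mul_of_one_le_of_one_le hS₁ hA)
    (show (0 : ℝ) < K by linarith) hδ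
  have c₂ := mul_sq_mul_le hHr (one_le_mul_of_one_le_of_one_le hS₂ hB)
    (show (0 : ℝ) < K by linarith) hδ
  rw [show 2 * (n₁ * nA * H * K) = 2 * n₁ * nA * H * K by ring] at c₁
  rw [show 2 * (n₂ * nB * H * K) = 2 * n₂ * nB * H * K by ring] at c₂
  -- the total number of parameters and the probability budget of each of them
  set M : ℝ := n₁ * n₂ * nA * nB * H * K with hM
  have hnn : 1 ≤ n₁ * n₂ * nA * nB := one_le_mul_of_one_le_of_one_le
    (one_le_mul_of_one_le_of_one_le (one_le_mul_of_one_le_of_one_le hS₁ hS₂) hA) hB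
  have hKM : K ≤ M := le_mul_of_one_le_left (by linarith) (one_le_mul_of_one_le_of_one_le hnn hHr)
  have hHM : H ≤ M := by
    rw [hM]
    calc (H : ℝ) ≤ n₁ * n₂ * nA * nB * H := le_mul_of_one_le_left (by linarith) hnn
      _ ≤ _ := le_mul_of_one_le_right (by positivity) hKr
  have hM1 : 1 ≤ M := hKr.trans hKM
  let x : ℝ := Real.exp (-L)
  have hx : M * x = δ := by
    simp only [x]
    rw [hL, Real.exp_neg, Real.exp_log (by positivity)]
    field_simp
  have hx0 : 0 < x := Real.exp_pos _
  have hx1 : x ≤ 1 := Real.exp_le_one_iff.2 (by linarith)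
  have e8 : Real.exp (-(8 * L)) = x ^ 8 := by
    rw [← Real.exp_nat_mul]; congr 1; push_cast; ring
  have e2 : Real.exp (-(2 * L)) = x ^ 2 := by
    rw [← Real.exp_nat_mul]; congr 1; push_cast; ring
  have hδ2 : δ ^ 2 ≤ δ / 4 := by nlinarith
  have d₀ : (H * (n₁ * n₂ * (nA * nB))) * (2 * K ^ 2 * Real.exp (-(8 * L))) ≤ 2 * δ ^ 2 := by
    rw [e8, ← hx]
    have : x ^ 8 ≤ x ^ 2 := pow_le_pow_of_le_one hx0.le hx1 (by norm_num)
    calc (H * (n₁ * n₂ * (nA * nB))) * (2 * K ^ 2 * x ^ 8) = 2 * (M * K * x ^ 8) := by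
          rw [hM]; ring
      _ ≤ 2 * (M * M * x ^ 2) := by gcongr
      _ = _ := by ring
  have d₃ : H * (3 * Real.exp (-(2 * L))) ≤ 3 * δ ^ 2 := by
    rw [e2, ← hx]
    calc H * (3 * x ^ 2) ≤ M * (3 * x ^ 2) := by gcongr
      _ ≤ M * (3 * x ^ 2) * M := le_mul_of_one_le_right (by positivity) hM1
      _ = _ := by ring
  refine (measureReal_le_of_subset_union (E₁ := _ ∪ _) (fun ω hω => ?_)
    ((measureReal_union_le _ _).trans (add_le_add b₀ b₁)) b₂ b₃).trans (by linarith)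
  by_contra hc
  simp only [Set.mem_union, Set.mem_ofPred_eq, not_or, not_exists, not_and, not_lt, not_not] at hc
  obtain ⟨⟨a₀, a₁⟩, a₂, a₃⟩ := hc
  refine hω ⟨fun k hk => ⟨fun h hh s a b => a₀ h hh s a b k hk, fun h hh s a => a₁ h hh s a k hk,
    fun h hh s b => a₂ h hh s b k hk⟩, a₃⟩

end Probability

end FactoredGame

theorem theorem2 :
    ∃ c : ℝ, 0 < c ∧ ∃ p : ℕ,
      ∀ (S₁ S₂ A B : Type*) [Fintype S₁] [Fintype S₂] [Fintype A] [Fintype B]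
        [Nonempty A] [Nonempty B]
        (G : Game S₁ S₂ A B) (H K : ℕ) (δ : ℝ), 1 ≤ H → 1 ≤ K → 0 < δ → δ < 1 →
      ∀ (Ω : Type*) (mΩ : MeasurableSpace Ω) (Pr : MeasureTheory.Measure Ω)
        [MeasureTheory.IsProbabilityMeasure Pr] (𝓕 : MeasureTheory.Filtration ℕ mΩ)
        (D : Ω → PlayLog S₁ S₂ A B) (μ : ℕ → Ω → Policy S₁ A) (ν : ℕ → Ω → Policy S₂ B),
        Plays Pr G H K 𝓕 D μ ν →
        (∀ ω, RunsOptimisticPO₂ H K δ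
          (√(Real.log (Fintype.card B) / ((K : ℝ) * (H : ℝ) ^ 2))) G.init.1
          (D ω) (fun k => μ k ω) (fun k => ν k ω)) →
        ENNReal.ofReal (1 - 4 * δ) ≤
          Pr {ω | G.regret₂ H K (fun k => μ k ω) (fun k => ν k ω) ≤
            c * Real.log ((Fintype.card S₁ : ℝ) * Fintype.card S₂ * Fintype.card A *
                Fintype.card B * H * K / δ) ^ p *
              (regretConst (Fintype.card S₁) (Fintype.card S₂) (Fintype.card A)
                (Fintype.card B) H * √((K : ℝ) * H))} := by
  refine ⟨42, by norm_num, 1, ?_⟩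
  intro S₁ S₂ A B _ _ _ _ _ _ G H K δ hH hK hδ _ Ω mΩ Pr _ 𝓕 D μ ν hP hrun
  -- for `δ ≥ 1 / 4` the asserted probability is not positive
  rcases le_or_gt (1 / 4) δ with hδ4 | hδ4
  · rw [ENNReal.ofReal_of_nonpos (by linarith)]
    exact zero_le
  have hKr : (1 : ℝ) ≤ K := by exact_mod_cast hK
  have hHr : (1 : ℝ) ≤ H := by exact_mod_cast hH
  have hA : (1 : ℝ) ≤ Fintype.card A := by exact_mod_cast Fintype.card_pos
  have hB : (1 : ℝ) ≤ Fintype.card B := by exact_mod_cast Fintype.card_pos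
  have hS₁ : (1 : ℝ) ≤ Fintype.card S₁ := by exact_mod_cast G.card_fst_pos
  have hS₂ : (1 : ℝ) ≤ Fintype.card S₂ := by exact_mod_cast G.card_snd_pos
  set n₁ : ℝ := (Fintype.card S₁ : ℝ) with hn₁
  set n₂ : ℝ := (Fintype.card S₂ : ℝ) with hn₂
  set nA : ℝ := (Fintype.card A : ℝ) with hnA
  set nB : ℝ := (Fintype.card B : ℝ) with hnB
  set L : ℝ := Real.log (n₁ * n₂ * nA * nB * H * K / δ) with hL
  have hHK : 1 ≤ (H : ℝ) * K := one_le_mul_of_one_le_of_one_le hHr hKr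
  have q₁ : 1 ≤ n₁ * nA * (H * K) :=
    one_le_mul_of_one_le_of_one_le (one_le_mul_of_one_le_of_one_le hS₁ hA) hHK
  have q₂ : 1 ≤ n₂ * nB * (H * K) :=
    one_le_mul_of_one_le_of_one_le (one_le_mul_of_one_le_of_one_le hS₂ hB) hHK
  have hM : n₁ * n₂ * nA * nB * H * K = n₂ * nB * (n₁ * nA * (H * K)) := by ring
  have hM' : n₁ * n₂ * nA * nB * H * K = n₁ * nA * (n₂ * nB * (H * K)) := by ring
  have hM1 : n₁ * nA * (H * K) ≤ n₁ * n₂ * nA * nB * H * K := by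
    rw [hM]
    exact le_mul_of_one_le_left (by linarith) (one_le_mul_of_one_le_of_one_le hS₂ hB)
  have hM2 : n₂ * nB * (H * K) ≤ n₁ * n₂ * nA * nB * H * K := by
    rw [hM']
    exact le_mul_of_one_le_left (by linarith) (one_le_mul_of_one_le_of_one_le hS₁ hA)
  have hMpos : 0 < n₁ * n₂ * nA * nB * H * K := by linarith
  have h4 : 4 ≤ n₁ * n₂ * nA * nB * H * K / δ := by
    rw [le_div_iff₀ hδ]; linarith
  have hlog4 : Real.log 4 = 2 * Real.log 2 := by
    rw [show (4 : ℝ) = 2 ^ 2 by norm_num, Real.log_pow]; norm_num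
  have hL4 : 2 * Real.log 2 ≤ L := by
    rw [← hlog4]; exact Real.log_le_log (by norm_num) h4
  have hln2 := Real.log_two_gt_d9
  have hL1 : 1 ≤ L := by linarith
  have hlog : ∀ y : ℝ, 1 ≤ y → y ≤ n₁ * n₂ * nA * nB * H * K →
      Real.log 2 ≤ Real.log (2 * y / δ) ∧ Real.log (2 * y / δ) ≤ 2 * L := by
    intro y hy hyM
    constructor
    · refine Real.log_le_log (by norm_num) ?_
      rw [le_div_iff₀ hδ]; nlinarith
    · calc Real.log (2 * y / δ) ≤ Real.log (2 * (n₁ * n₂ * nA * nB * H * K / δ)) := by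
            rw [← mul_div_assoc]
            exact Real.log_le_log (by positivity) (by gcongr)
        _ = Real.log 2 + L := Real.log_mul (by norm_num) (by positivity)
        _ ≤ 2 * L := by linarith
  obtain ⟨u₁, v₁⟩ := hlog _ q₁ hM1
  obtain ⟨u₂, v₂⟩ := hlog _ q₂ hM2
  rw [show 2 * (n₁ * nA * (H * K)) = 2 * n₁ * nA * H * K by ring] at u₁ v₁
  rw [show 2 * (n₂ * nB * (H * K)) = 2 * n₂ * nB * H * K by ring] at u₂ v₂
  have hBL : Real.log nB ≤ L := by
    refine Real.log_le_log (by linarith) ?_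
    rw [le_div_iff₀ hδ]
    calc nB * δ ≤ nB * 1 := by gcongr
      _ ≤ n₂ * nB * (H * K) := by
        rw [mul_one, show n₂ * nB * (H * K) = n₂ * (H * K) * nB by ring]
        exact le_mul_of_one_le_left (by linarith) (one_le_mul_of_one_le_of_one_le hS₂ hHK)
      _ ≤ _ := hM2
  have hbad := hP.measureReal_not_good_le hH hK hδ hδ4 hL hL1 u₁ u₂
  rw [ENNReal.ofReal_le_iff_le_toReal (measure_ne_top _ _)]
  have hsub : Set.univ ⊆ {ω | G.regret₂ H K (fun k => μ k ω) (fun k => ν k ω) ≤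
      42 * L ^ 1 * (regretConst n₁ n₂ nA nB H * √((K : ℝ) * H))} ∪
      {ω | ¬ ((∀ k ∈ Finset.Icc 1 K, G.EstimatesOK (D ω) H K δ k) ∧
        ∀ h < H, G.WidthsOK (D ω) K L (fun k => μ k ω) (fun k => ν k ω) h)} := by
    intro ω _
    by_cases hω : (∀ k ∈ Finset.Icc 1 K, G.EstimatesOK (D ω) H K δ k) ∧
        ∀ h < H, G.WidthsOK (D ω) K L (fun k => μ k ω) (fun k => ν k ω) h
    · left
      rw [Set.mem_ofPred_eq, pow_one]
      exact Game.regret₂_le hH hK hω.1 hω.2 (hrun ω) hL hL1 rfl rfl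
        ((Real.log_nonneg (by norm_num)).trans u₁) ((Real.log_nonneg (by norm_num)).trans u₂)
        v₁ v₂ hBL
    · exact Or.inr hω
  have hcover := (measureReal_mono (μ := Pr) hsub).trans (measureReal_union_le _ _)
  rw [probReal_univ] at hcover
  rw [← measureReal_def]
  linarith
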